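/- All graphs are simple, and the members of a family $\mathcal F$ (finite or infinite) are finite graphs. A graph is $\mathcal F$-free if it has no subgraph (not necessarily induced) isomorphic to a member of $\mathcal F$. Let $\mathrm{EX}(n,\mathcal F)$ be the set of $n$-vertex $\mathcal F$-free graphs with the maximum number of edges, $\mathrm{EX}_c(n,\mathcal F)$ the set of connected $n$-vertex $\mathcal F$-free graphs with the maximum number of edges among all connected $n$-vertex $\mathcal F$-free graphs, and $\mathrm{SPEX}(n,\mathcal F)$ the set of $n$-vertex $\mathcal F$-free graphs (connected or not) whose adjacency matrix has the maximum spectral radius. Write $G+G'$ for the join, $G\cup G'$ for the disjoint union, $\infty\cdot G$ for the disjoint union of countably infinitely many copies of $G$, and $e(G)$ for the number of edges. **Corollary 1.3.** Let $\mathcal F$ be a family of graphs, let $k\ge 1$ be a fixed integer, and for each $n$ let $H=H_n$ be an $n$-vertex graph such that one of the following holds for all sufficiently large $n$ (the same case for all $n$): - (a) $H=K_{k,n-k}$; - (b) $H=K_k+\overline{K_{n-k}}$; - (c) $H=K_k+(K_2\cup\overline{K_{n-k-2}})$; - (d) $\mathcal F$ is finite and $H=K_k+X$, where $X=X_n$ satisfies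 $e(X)\le Qn+O(1)$ for some constant $Q\in[0,3/4)$; - (f) $\mathcal F$ is finite and $H=K_k+X$, where $X=X_n$ satisfies $e(X)\le Qn+O(1)$ for some constant $Q\in[3/4,1)$, all but a bounded number of vertices of $X$ have degree $d$ for some constant $d$ (independent of $n$), and $K_k+(\infty\cdot K_{1,d+1})$ is not $\mathcal F$-free. If $H_n\in\mathrm{EX}(n,\mathcal F)$ for all sufficiently large $n$, then $\mathrm{SPEX}(n,\mathcal F)\subseteq\mathrm{EX}(n,\mathcal F)$ for all sufficiently large $n$. If $H_n\in\mathrm{EX}_c(n,\mathcal F)$ for all sufficiently large $n$, then $\mathrm{SPEX}(n,\mathcal F)\subseteq\mathrm{EX}_c(n,\mathcal F)$ for all sufficiently large $n$. -/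

import Mathlib

open Filter
open scoped ENNReal

/-- A family of (finite) graphs, each presented on a vertex set `Fin m`. -/
abbrev GraphFamily : Type := Set (Σ m : ℕ, SimpleGraph (Fin m))

/-- `G` is `𝓕`-free: no member of `𝓕` is isomorphic to a (not necessarily induced) subgraph of
`G`.  The vertex set of `G` may be infinite. -/
def FamilyFree (𝓕 : GraphFamily) {V : Type} (G : SimpleGraph V) : Prop :=
  ∀ F ∈ 𝓕, F.2.Free G

/-- The spectral radius of the adjacency matrix of `G` (which is real symmetric, so that its whole
spectrum is real). -/
noncomputable def adjSpectralRadius {n : ℕ} (G : SimpleGraph (Fin n)) : ℝ≥0∞ := by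
  classical exact spectralRadius ℝ (G.adjMatrix ℝ)

/-- `EX(n, 𝓕)`: the `𝓕`-free graphs on `n` vertices with the maximum number of edges.  Graphs are
labelled by `Fin n`; the set is closed under isomorphism. -/
def EX (n : ℕ) (𝓕 : GraphFamily) : Set (SimpleGraph (Fin n)) :=
  {G | FamilyFree 𝓕 G ∧
    ∀ G' : SimpleGraph (Fin n), FamilyFree 𝓕 G' → G'.edgeSet.ncard ≤ G.edgeSet.ncard}

/-- `EX_c(n, 𝓕)`: the connected `𝓕`-free graphs on `n` vertices which have the maximum number of
edges among all connected `𝓕`-free graphs on `n` vertices. -/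
def EXc (n : ℕ) (𝓕 : GraphFamily) : Set (SimpleGraph (Fin n)) :=
  {G | (G.Connected ∧ FamilyFree 𝓕 G) ∧
    ∀ G' : SimpleGraph (Fin n), G'.Connected → FamilyFree 𝓕 G' →
      G'.edgeSet.ncard ≤ G.edgeSet.ncard}

/-- `SPEX(n, 𝓕)`: the `𝓕`-free graphs on `n` vertices (connected or not) with the maximum
adjacency spectral radius. -/
def SPEX (n : ℕ) (𝓕 : GraphFamily) : Set (SimpleGraph (Fin n)) :=
  {G | FamilyFree 𝓕 G ∧
    ∀ G' : SimpleGraph (Fin n), FamilyFree 𝓕 G' → adjSpectralRadius G' ≤ adjSpectralRadius G}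

/-- The join `G + H`: the disjoint union together with all edges between the two parts. -/
def graphJoin {V W : Type} (G : SimpleGraph V) (H : SimpleGraph W) : SimpleGraph (V ⊕ W) :=
  (G ⊕g H) ⊔ completeBipartiteGraph V W

/-- The disjoint union of copies of `G`, one for each element of `ι`. -/
def disjointCopies (ι : Type) {V : Type} (G : SimpleGraph V) : SimpleGraph (ι × V) where
  Adj p q := p.1 = q.1 ∧ G.Adj p.2 q.2
  symm := ⟨fun _ _ h => ⟨h.1.symm, h.2.symm⟩⟩
  loopless := ⟨fun _ h => G.irrefl h.2⟩

/-- `K_k + X`, the join of a complete graph on `k` vertices with `X`. -/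
def cliqueJoin (k : ℕ) {W : Type} (X : SimpleGraph W) : SimpleGraph (Fin k ⊕ W) :=
  graphJoin (⊤ : SimpleGraph (Fin k)) X

/-- Case (a): `H_n = K_{k,n-k}` for large `n`. -/
def CaseA (k : ℕ) (H : ∀ n : ℕ, SimpleGraph (Fin n)) : Prop :=
  ∀ᶠ n in atTop, Nonempty (H n ≃g completeBipartiteGraph (Fin k) (Fin (n - k)))

/-- Case (b): `H_n` is the join of `K_k` with `n - k` isolated vertices for large `n`. -/
def CaseB (k : ℕ) (H : ∀ n : ℕ, SimpleGraph (Fin n)) : Prop :=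
  ∀ᶠ n in atTop, Nonempty (H n ≃g cliqueJoin k (⊥ : SimpleGraph (Fin (n - k))))

/-- Case (c): `H_n` is the join of `K_k` with the union of one edge and `n - k - 2` isolated
vertices for large `n`. -/
def CaseC (k : ℕ) (H : ∀ n : ℕ, SimpleGraph (Fin n)) : Prop :=
  ∀ᶠ n in atTop, Nonempty
    (H n ≃g cliqueJoin k ((⊤ : SimpleGraph (Fin 2)) ⊕g (⊥ : SimpleGraph (Fin (n - k - 2)))))

/-- Case (d): `𝓕` is finite and, for large `n`, `H_n = K_k + X_n` with `e(X_n) ≤ Q n + O(1)` for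
some constant `Q ∈ [0, 3/4)`. -/
def CaseD (𝓕 : GraphFamily) (k : ℕ) (H : ∀ n : ℕ, SimpleGraph (Fin n)) : Prop :=
  𝓕.Finite ∧
  ∃ Q : ℝ, 0 ≤ Q ∧ Q < 3 / 4 ∧ ∃ C : ℝ,
    ∀ᶠ n : ℕ in atTop, ∃ X : SimpleGraph (Fin (n - k)),
      Nonempty (H n ≃g cliqueJoin k X) ∧ (X.edgeSet.ncard : ℝ) ≤ Q * n + C

/-- Case (f) with `Q < 1`: `𝓕` is finite and, for large `n`, `H_n = K_k + X_n` with
`e(X_n) ≤ Q n + O(1)` for some constant `Q ∈ [3/4, 1)`, where all but a bounded number of vertices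
of `X_n` have the constant degree `d`; and the join of `K_k` with countably many disjoint copies
of the star `K_{1,d+1}` is not `𝓕`-free. -/
def CaseF (𝓕 : GraphFamily) (k : ℕ) (H : ∀ n : ℕ, SimpleGraph (Fin n)) : Prop :=
  𝓕.Finite ∧
  ∃ Q : ℝ, 3 / 4 ≤ Q ∧ Q < 1 ∧ ∃ C : ℝ, ∃ d B : ℕ,
    (∀ᶠ n : ℕ in atTop, ∃ X : SimpleGraph (Fin (n - k)),
      Nonempty (H n ≃g cliqueJoin k X) ∧ (X.edgeSet.ncard : ℝ) ≤ Q * n + C ∧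
      {v | (X.neighborSet v).ncard ≠ d}.ncard ≤ B) ∧
    ¬ FamilyFree 𝓕
      (cliqueJoin k (disjointCopies ℕ (completeBipartiteGraph (Fin 1) (Fin (d + 1)))))

/-! Let `G` be spectrally extremal, with spectral radius ρ and eigenvector x scaled to maximum 1.
Edge extremality of `H n` bounds the edges of every large connected `𝓕`-free graph by (k+Q)n+O(1)
with Q < 1. Hence some K_{k+1,s} is not `𝓕`-free (`FewCommon`), and all `𝓕`-free graphs are
hereditarily sparse (`LinSparse`). Since `H n` contains K_{k,n-k}, ρ² ≥ k(n-k). Counting two-step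
walks (`exists_core`) then yields a set L of exactly k vertices of weight near 1, joined to almost
all other vertices, which have weight near 0.

The join from L to its complement is in fact complete (`completeTo_of_le`). Add the missing pairs
and delete the edges off L that meet an incomplete vertex. In the form yᵀ(A'-A)x, with y the
eigenvector of the new graph, an added pair weighs a constant and a deleted one only ε times a
constant, while the deleted pairs number O(missing pairs). Maximality of ρ leaves nothing missing.
The new graph is `𝓕`-free: for finite `𝓕`, a vertex seeing only L can be exchanged for an unused
complete vertex; for infinite `𝓕`, all edges off L are deleted and the result lies in a copy of `H
n`.

It remains to count edges. For K_{k,n-k} the complete join suffices. Otherwise the clique of `H n`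
is placed on L. A pair missing inside L costs order ρ in ρ², whereas a pair off L is worth only
order 1/ρ (`CompleteTo.lt_of_missing`). If L is a clique, iterating the eigenvalue equation gives
ρ-k+1 = k(r/ρ + w₁/ρ² + w₂/ρ³ + w₃/ρ⁴) + O(ρ⁻³), where r = n-k and wᵢ counts walks of length i off
L. Having fewer edges lowers w₁, which decides the comparison (`Dominating.lt_of_pairs`) once w₂ and
w₃ are controlled (`moment_bounds`). That control uses Q < 3/4: K_{1,3}, P₄ and K₃ have at least 3/4
edges per vertex, so K_k joined to many copies of any of them is not `𝓕`-free, and all but boundedly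
many vertices of G-L start at most two walks of length two. Case (f) reduces to Q = 1/2, because Q <
1 forces d ≤ 1. -/

/-- The `0/1` entries of the adjacency matrix of `G`. -/
noncomputable def adjInd {V : Type} (G : SimpleGraph V) (u v : V) : ℝ := by
  classical exact if G.Adj u v then 1 else 0

section Indicator

variable {V : Type} (G : SimpleGraph V)

lemma adjInd_of_adj {u v : V} (h : G.Adj u v) : adjInd G u v = 1 := by
  simp [adjInd, h]

lemma adjInd_of_not_adj {u v : V} (h : ¬ G.Adj u v) : adjInd G u v = 0 := by
  simp [adjInd, h]

lemma adjInd_nonneg (u v : V) : 0 ≤ adjInd G u v := by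
  by_cases h : G.Adj u v <;> simp [adjInd, h]

lemma adjInd_le_one (u v : V) : adjInd G u v ≤ 1 := by
  by_cases h : G.Adj u v <;> simp [adjInd, h]

lemma adjInd_comm (u v : V) : adjInd G u v = adjInd G v u := by
  by_cases h : G.Adj u v
  · rw [adjInd_of_adj _ h, adjInd_of_adj _ h.symm]
  · rw [adjInd_of_not_adj _ h, adjInd_of_not_adj _ fun h' => h h'.symm]

lemma adjInd_self (u : V) : adjInd G u u = 0 := by simp [adjInd]

end Indicator

/-! ### Perron vectors and Rayleigh quotients -/

/-- A nonnegative eigenvector of the adjacency matrix with largest entry `1`. -/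
structure IsPerron {V : Type} [Fintype V] (G : SimpleGraph V) (ρ : ℝ) (x : V → ℝ) : Prop where
  nonneg : ∀ v, 0 ≤ x v
  le_one : ∀ v, x v ≤ 1
  exists_one : ∃ v, x v = 1
  eig : ∀ v, ∑ u, adjInd G v u * x u = ρ * x v

/-- The quadratic form of the adjacency matrix is at most `ρ` times the squared norm. -/
def RayleighLE {V : Type} [Fintype V] (G : SimpleGraph V) (ρ : ℝ) : Prop :=
  ∀ z : V → ℝ, ∑ u, ∑ v, z u * adjInd G u v * z v ≤ ρ * ∑ u, z u ^ 2

/-- Semidefiniteness replaces Perron–Frobenius: ρ is the largest modulus of an eigenvalue, so ρ - A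
is positive semidefinite. The entrywise absolute value of an eigenvector for that modulus
annihilates the form of ρ - A, hence lies in its kernel. No connectedness is needed. -/
lemma exists_perron {n : ℕ} (hn : 0 < n) (G : SimpleGraph (Fin n)) :
    ∃ ρ : ℝ, 0 ≤ ρ ∧ adjSpectralRadius G = ENNReal.ofReal ρ ∧ RayleighLE G ρ ∧
      ∃ x, IsPerron G ρ x := by
  classical
  have : Nonempty (Fin n) := ⟨⟨0, hn⟩⟩
  set A : Matrix (Fin n) (Fin n) ℝ := Matrix.of (adjInd G) with hAdef
  have hAeq : A = G.adjMatrix ℝ := by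
    ext u v
    by_cases h : G.Adj u v <;> simp [hAdef, adjInd, h]
  have hA : A.IsHermitian := by
    ext u v
    simp [hAdef, Matrix.conjTranspose, adjInd_comm G u v]
  obtain ⟨i0, hi0⟩ := Finite.exists_max (fun i => |hA.eigenvalues i|)
  set ρ := |hA.eigenvalues i0| with hρ
  have hspec : spectrum ℝ A = Set.range hA.eigenvalues := hA.spectrum_real_eq_range_eigenvalues
  have hsr : adjSpectralRadius G = ENNReal.ofReal ρ := by
    have h1 : adjSpectralRadius G = spectralRadius ℝ A := by
      rw [hAeq]; unfold adjSpectralRadius; congr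
    rw [h1]
    apply le_antisymm
    · refine iSup₂_le ?_
      intro k hk
      rw [hspec] at hk
      obtain ⟨i, rfl⟩ := hk
      have := hi0 i
      calc (‖hA.eigenvalues i‖₊ : ℝ≥0∞) = ENNReal.ofReal |hA.eigenvalues i| := by
            rw [← Real.norm_eq_abs, ofReal_norm]; rfl
        _ ≤ _ := ENNReal.ofReal_le_ofReal this
    · have hk : hA.eigenvalues i0 ∈ spectrum ℝ A := by rw [hspec]; exact ⟨i0, rfl⟩
      refine le_trans (le_of_eq ?_) (le_iSup₂ (f := fun (k : ℝ) (_ : k ∈ spectrum ℝ A) =>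
        (‖k‖₊ : ℝ≥0∞)) _ hk)
      rw [hρ, ← Real.norm_eq_abs, ofReal_norm]; rfl
  have hρ0 : 0 ≤ ρ := abs_nonneg _
  have hM : (ρ • (1 : Matrix (Fin n) (Fin n) ℝ) - A).PosSemidef := by
    rw [Matrix.posSemidef_iff_isHermitian_and_spectrum_nonneg]
    refine ⟨?_, ?_⟩
    · ext u v
      simp [hAdef, Matrix.conjTranspose, adjInd_comm G u v, Matrix.one_apply]
    · intro k hk
      have h2 : ρ - k ∈ spectrum ℝ A := by
        rw [spectrum.mem_iff] at hk ⊢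
        intro hu
        apply hk
        have : (algebraMap ℝ (Matrix (Fin n) (Fin n) ℝ)) k - (ρ • 1 - A)
            = -((algebraMap ℝ (Matrix (Fin n) (Fin n) ℝ)) (ρ - k) - A) := by
          simp only [Algebra.algebraMap_eq_smul_one, sub_smul]; abel
        rw [this]
        exact hu.neg
      rw [hspec] at h2
      obtain ⟨i, hi⟩ := h2
      have := hi0 i
      have h3 := le_trans (le_abs_self _) this
      simp only [Set.mem_ofPred_eq]
      rw [hi] at h3
      linarith
  have hquad : ∀ z : Fin n → ℝ, z ⬝ᵥ ((ρ • (1 : Matrix (Fin n) (Fin n) ℝ) - A).mulVec z)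
      = ρ * ∑ u, z u ^ 2 - ∑ u, ∑ v, z u * adjInd G u v * z v := by
    intro z
    rw [Matrix.sub_mulVec, Matrix.smul_mulVec, Matrix.one_mulVec, dotProduct_sub]
    congr 1
    · simp only [dotProduct, Pi.smul_apply, smul_eq_mul, Finset.mul_sum]
      exact Finset.sum_congr rfl fun _ _ => by ring
    · simp only [dotProduct, Matrix.mulVec, Finset.mul_sum]
      exact Finset.sum_congr rfl fun _ _ => Finset.sum_congr rfl fun _ _ => by
        simp [hAdef]; ring
  have hray : RayleighLE G ρ := by
    intro z
    have := hM.dotProduct_mulVec_nonneg z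
    simp only [star_trivial] at this
    rw [hquad] at this
    linarith
  refine ⟨ρ, hρ0, hsr, hray, ?_⟩
  set z : Fin n → ℝ := (hA.eigenvectorBasis i0 : Fin n → ℝ) with hz
  have hz0 : z ≠ 0 := by
    intro h0
    have := (hA.eigenvectorBasis.orthonormal.ne_zero i0)
    apply this
    ext u
    exact congrFun h0 u
  have hze : A.mulVec z = hA.eigenvalues i0 • z := hA.mulVec_eigenvectorBasis i0
  -- Absolute values keep the norm and do not decrease the modulus of the quadratic form, so `w`
  -- attains the Rayleigh bound.
  set w : Fin n → ℝ := fun u => |z u| with hw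
  have hwlow : ρ * ∑ u, w u ^ 2 ≤ ∑ u, ∑ v, w u * adjInd G u v * w v := by
    have h1 : ∑ u, ∑ v, z u * adjInd G u v * z v = hA.eigenvalues i0 * ∑ u, z u ^ 2 := by
      have : z ⬝ᵥ A.mulVec z = z ⬝ᵥ (hA.eigenvalues i0 • z) := by rw [hze]
      simp only [dotProduct, Matrix.mulVec, Pi.smul_apply, smul_eq_mul, Finset.mul_sum] at this
      rw [Finset.mul_sum]
      convert this using 1
      · exact Finset.sum_congr rfl fun _ _ => Finset.sum_congr rfl fun _ _ => by
          simp [hAdef]; ring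
      · exact Finset.sum_congr rfl fun _ _ => by ring
    have h2 : ∑ u, w u ^ 2 = ∑ u, z u ^ 2 := by simp [hw]
    have h3 : ρ * ∑ u, z u ^ 2 = |∑ u, ∑ v, z u * adjInd G u v * z v| := by
      rw [h1, abs_mul, abs_of_nonneg (Finset.sum_nonneg fun u _ => sq_nonneg (z u))]
    rw [h2, h3]
    refine (Finset.abs_sum_le_sum_abs _ _).trans (Finset.sum_le_sum fun u _ => ?_)
    refine (Finset.abs_sum_le_sum_abs _ _).trans (Finset.sum_le_sum fun v _ => ?_)
    rw [abs_mul, abs_mul, abs_of_nonneg (adjInd_nonneg G u v)]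
  have hwz : star w ⬝ᵥ ((ρ • (1 : Matrix (Fin n) (Fin n) ℝ) - A).mulVec w) = 0 := by
    simp only [star_trivial]
    rw [hquad]
    have := hray w
    linarith
  rw [hM.dotProduct_mulVec_zero_iff] at hwz
  have hweig : ∀ v, ∑ u, adjInd G v u * w u = ρ * w v := by
    intro v
    have := congrFun hwz v
    rw [Matrix.sub_mulVec, Matrix.smul_mulVec, Matrix.one_mulVec] at this
    simp only [Pi.sub_apply, Pi.smul_apply, smul_eq_mul, Pi.zero_apply, Matrix.mulVec,
      dotProduct, hAdef, Matrix.of_apply] at this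
    linarith
  obtain ⟨v0, hv0⟩ := Finite.exists_max w
  have hpos : 0 < w v0 := by
    by_contra hcon
    apply hz0
    ext u
    have h1 := hv0 u
    have h2 : 0 ≤ w u := abs_nonneg _
    have h3 : w u = 0 := by linarith
    simpa [hw] using h3
  refine ⟨fun u => w u / w v0, ?_, ?_, ⟨v0, div_self hpos.ne'⟩, ?_⟩
  · intro v; exact div_nonneg (abs_nonneg _) hpos.le
  · intro v; exact (div_le_one hpos).2 (hv0 v)
  · intro v
    simp only [← mul_div_assoc, ← Finset.sum_div]
    rw [hweig v]

lemma RayleighLE.le_of_subsolution {V : Type} [Fintype V] {G : SimpleGraph V} {ρ μ : ℝ}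
    (hR : RayleighLE G ρ) (z : V → ℝ) (hz : ∀ v, 0 ≤ z v) (hz0 : ∃ v, 0 < z v)
    (h : ∀ v, μ * z v ≤ ∑ u, adjInd G v u * z u) : μ ≤ ρ := by
  have h1 := hR z
  have h2 : μ * ∑ u, z u ^ 2 ≤ ∑ u, ∑ v, z u * adjInd G u v * z v := by
    rw [Finset.mul_sum]
    refine Finset.sum_le_sum fun u _ => ?_
    have := mul_le_mul_of_nonneg_left (h u) (hz u)
    calc μ * z u ^ 2 = z u * (μ * z u) := by ring
      _ ≤ _ := this
      _ = _ := by rw [Finset.mul_sum]; exact Finset.sum_congr rfl fun _ _ => by ring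
  have h3 : 0 < ∑ u, z u ^ 2 := by
    obtain ⟨v, hv⟩ := hz0
    exact Finset.sum_pos' (fun u _ => sq_nonneg _) ⟨v, Finset.mem_univ _, by positivity⟩
  exact le_of_mul_le_mul_right (h2.trans h1) h3

/-- A `k`-set completely joined to the other `r` vertices forces spectral radius `√(kr)`. -/
lemma RayleighLE.mul_card_le_sq {V : Type} [Fintype V] [DecidableEq V] {G : SimpleGraph V} {ρ : ℝ}
    (hR : RayleighLE G ρ) (hρ : 0 ≤ ρ) (L : Finset V) (hL : ∀ l ∈ L, ∀ v ∉ L, G.Adj l v) :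
    (L.card : ℝ) * (Lᶜ.card : ℝ) ≤ ρ ^ 2 := by
  rcases L.eq_empty_or_nonempty with h0 | hne
  · simp [h0, sq_nonneg]
  rcases (Lᶜ).eq_empty_or_nonempty with h0 | hne'
  · simp [h0, sq_nonneg]
  set k : ℝ := (L.card : ℝ) with hk
  set r : ℝ := (Lᶜ.card : ℝ) with hr
  have hkpos : 0 < k := by rw [hk]; exact_mod_cast hne.card_pos
  have hrpos : 0 < r := by rw [hr]; exact_mod_cast hne'.card_pos
  have key : √(k * r) ≤ ρ := by
    -- The test vector is the Perron vector of K_{k,r}.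
    refine hR.le_of_subsolution (fun v => if v ∈ L then √r else √k) ?_ ?_ ?_
    · intro v; split_ifs <;> positivity
    · obtain ⟨l, hl⟩ := hne
      exact ⟨l, by simp [hl, hrpos]⟩
    · intro v
      rw [Real.sqrt_mul hkpos.le]
      by_cases hv : v ∈ L
      · calc √k * √r * (if v ∈ L then √r else √k) = ∑ u ∈ Lᶜ, √k := by
              rw [if_pos hv, Finset.sum_const, nsmul_eq_mul, ← hr, mul_assoc,
                Real.mul_self_sqrt hrpos.le, mul_comm]
          _ = ∑ u ∈ Lᶜ, adjInd G v u * (if u ∈ L then √r else √k) := by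
              refine Finset.sum_congr rfl fun u hu => ?_
              have hu' : u ∉ L := Finset.mem_compl.1 hu
              rw [if_neg hu', adjInd_of_adj _ (hL v hv u hu'), one_mul]
          _ ≤ _ := Finset.sum_le_sum_of_subset_of_nonneg (Finset.subset_univ _) fun u _ _ =>
              mul_nonneg (adjInd_nonneg _ _ _) (by split_ifs <;> positivity)
      · calc √k * √r * (if v ∈ L then √r else √k) = ∑ u ∈ L, √r := by
              rw [if_neg hv, Finset.sum_const, nsmul_eq_mul, ← hk, mul_right_comm,
                Real.mul_self_sqrt hkpos.le]
          _ = ∑ u ∈ L, adjInd G v u * (if u ∈ L then √r else √k) := by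
              refine Finset.sum_congr rfl fun u hu => ?_
              rw [if_pos hu, adjInd_comm, adjInd_of_adj _ (hL u hu v hv), one_mul]
          _ ≤ _ := Finset.sum_le_sum_of_subset_of_nonneg (Finset.subset_univ _) fun u _ _ =>
              mul_nonneg (adjInd_nonneg _ _ _) (by split_ifs <;> positivity)
  exact (Real.sqrt_le_left hρ).1 key

/-- Comparing two graphs through the eigenvectors of both. -/
lemma IsPerron.mixed {V : Type} [Fintype V] {G G' : SimpleGraph V} {ρ ρ' : ℝ} {x y : V → ℝ}
    (hx : IsPerron G ρ x) (hy : IsPerron G' ρ' y) (h : ρ' ≤ ρ) :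
    ∑ u, ∑ v, adjInd G' u v * (y u * x v) ≤ ∑ u, ∑ v, adjInd G u v * (y u * x v) := by
  -- Letting A act on x and A' on y makes both forms multiples of the same nonnegative number ∑ y u
  -- * x u.
  have h1 : ∑ u, ∑ v, adjInd G u v * (y u * x v) = ρ * ∑ u, y u * x u := by
    rw [Finset.mul_sum]
    refine Finset.sum_congr rfl fun u _ => ?_
    calc _ = y u * ∑ v, adjInd G u v * x v := by
          rw [Finset.mul_sum]; exact Finset.sum_congr rfl fun _ _ => by ring
      _ = _ := by rw [hx.eig]; ring
  have h2 : ∑ u, ∑ v, adjInd G' u v * (y u * x v) = ρ' * ∑ u, y u * x u := by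
    rw [Finset.sum_comm, Finset.mul_sum]
    refine Finset.sum_congr rfl fun u _ => ?_
    calc _ = x u * ∑ v, adjInd G' u v * y v := by
          rw [Finset.mul_sum]
          exact Finset.sum_congr rfl fun v _ => by rw [adjInd_comm]; ring
      _ = _ := by rw [hy.eig]; ring
  rw [h1, h2]
  exact mul_le_mul_of_nonneg_right h
    (Finset.sum_nonneg fun u _ => mul_nonneg (hy.nonneg u) (hx.nonneg u))

/-! ### Sparsity and two-step walks -/

/-- The neighbours of `v`. -/
noncomputable def nbrs {V : Type} [Fintype V] (G : SimpleGraph V) (v : V) : Finset V := by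
  classical exact Finset.univ.filter (G.Adj v)

/-- The vertices adjacent to every element of `T`. -/
noncomputable def commonNbrs {V : Type} [Fintype V] (G : SimpleGraph V) (T : Finset V) :
    Finset V := by
  classical exact Finset.univ.filter fun v => ∀ t ∈ T, G.Adj t v

/-- The degree of `v`, as a real number. -/
noncomputable def degR {V : Type} [Fintype V] (G : SimpleGraph V) (v : V) : ℝ :=
  ∑ u, adjInd G v u

/-- The number of ordered adjacent pairs in `S × T`. -/
noncomputable def pairs {V : Type} (G : SimpleGraph V) (S T : Finset V) : ℝ :=
  ∑ u ∈ S, ∑ v ∈ T, adjInd G u v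

section Pairs

variable {V : Type} {G : SimpleGraph V}

lemma pairs_nonneg (S T : Finset V) : 0 ≤ pairs G S T :=
  Finset.sum_nonneg fun _ _ => Finset.sum_nonneg fun _ _ => adjInd_nonneg _ _ _

lemma pairs_mono {S S' T T' : Finset V} (h : S ⊆ S') (h' : T ⊆ T') :
    pairs G S T ≤ pairs G S' T' :=
  (Finset.sum_le_sum fun _ _ => Finset.sum_le_sum_of_subset_of_nonneg h'
    fun _ _ _ => adjInd_nonneg _ _ _).trans
  (Finset.sum_le_sum_of_subset_of_nonneg h fun _ _ _ =>
    Finset.sum_nonneg fun _ _ => adjInd_nonneg _ _ _)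

lemma pairs_comm (S T : Finset V) : pairs G S T = pairs G T S := by
  unfold pairs
  rw [Finset.sum_comm]
  exact Finset.sum_congr rfl fun _ _ => Finset.sum_congr rfl fun _ _ => adjInd_comm _ _ _

lemma pairs_union_left [DecidableEq V] {S S' : Finset V} (h : Disjoint S S') (T : Finset V) :
    pairs G (S ∪ S') T = pairs G S T + pairs G S' T := Finset.sum_union h

end Pairs

section Counting

variable {V : Type} [Fintype V] {G : SimpleGraph V}

lemma mem_nbrs {v u : V} : u ∈ nbrs G v ↔ G.Adj v u := by simp [nbrs]

lemma mem_commonNbrs {T : Finset V} {v : V} :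
    v ∈ commonNbrs G T ↔ ∀ t ∈ T, G.Adj t v := by simp [commonNbrs]

lemma sum_adjInd_mul (v : V) (f : V → ℝ) :
    ∑ u, adjInd G v u * f u = ∑ u ∈ nbrs G v, f u := by
  classical
  rw [nbrs, Finset.sum_filter]
  refine Finset.sum_congr rfl fun u _ => ?_
  by_cases h : G.Adj v u <;> simp [adjInd, h]

lemma degR_eq_card (v : V) : degR G v = ((nbrs G v).card : ℝ) := by
  have := sum_adjInd_mul (G := G) v (fun _ => 1)
  simpa [degR] using this

lemma degR_nonneg (v : V) : 0 ≤ degR G v := Finset.sum_nonneg fun _ _ => adjInd_nonneg _ _ _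

/-- Every vertex set `S` spans at most `c |S|` ordered adjacent pairs. -/
def LinSparse (G : SimpleGraph V) (c : ℝ) : Prop :=
  ∀ S : Finset V, pairs G S S ≤ c * S.card

/-- Any `j` vertices have fewer than `s` common neighbours. -/
def FewCommon (G : SimpleGraph V) (j s : ℕ) : Prop :=
  ∀ T : Finset V, T.card = j → (commonNbrs G T).card < s

lemma IsPerron.two_step {ρ : ℝ} {x : V → ℝ} (hx : IsPerron G ρ x) (v : V) :
    ρ ^ 2 * x v = ∑ u ∈ nbrs G v, ∑ w, adjInd G u w * x w := by
  rw [← sum_adjInd_mul]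
  simp_rw [hx.eig]
  calc ρ ^ 2 * x v = ρ * (ρ * x v) := by ring
    _ = _ := by rw [← hx.eig, Finset.mul_sum]; exact Finset.sum_congr rfl fun _ _ => by ring

lemma LinSparse.sum_degR_le {c : ℝ} (hc : LinSparse G c) :
    ∑ v, degR G v ≤ c * Fintype.card V := by
  have := hc Finset.univ
  rwa [Finset.card_univ] at this

/-- Two-step walks ending off `M` contribute at most η each, and their number is at most the degree
sum, which is at most c·n. -/
lemma IsPerron.two_step_le {ρ c η : ℝ} {x : V → ℝ} (hx : IsPerron G ρ x) (hc : LinSparse G c)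
    (hη : 0 ≤ η) (M : Finset V) (hM : ∀ w ∉ M, x w ≤ η) (v : V) :
    ρ ^ 2 * x v ≤ ∑ u ∈ nbrs G v, ∑ w ∈ M, adjInd G u w * x w + η * (c * Fintype.card V) := by
  classical
  rw [hx.two_step]
  have h1 : ∀ u, ∑ w, adjInd G u w * x w ≤ ∑ w ∈ M, adjInd G u w * x w + η * degR G u := by
    intro u
    rw [← Finset.sum_add_sum_compl M]
    gcongr
    calc ∑ w ∈ Mᶜ, adjInd G u w * x w ≤ ∑ w ∈ Mᶜ, η * adjInd G u w := by
          refine Finset.sum_le_sum fun w hw => ?_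
          rw [mul_comm]
          exact mul_le_mul_of_nonneg_right (hM w (Finset.mem_compl.1 hw)) (adjInd_nonneg _ _ _)
      _ ≤ ∑ w, η * adjInd G u w := Finset.sum_le_sum_of_subset_of_nonneg (Finset.subset_univ _)
          fun w _ _ => mul_nonneg hη (adjInd_nonneg _ _ _)
      _ = _ := by rw [degR, Finset.mul_sum]
  calc _ ≤ ∑ u ∈ nbrs G v, (∑ w ∈ M, adjInd G u w * x w + η * degR G u) :=
        Finset.sum_le_sum fun u _ => h1 u
    _ = ∑ u ∈ nbrs G v, ∑ w ∈ M, adjInd G u w * x w + η * ∑ u ∈ nbrs G v, degR G u := by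
        rw [Finset.sum_add_distrib, Finset.mul_sum]
    _ ≤ _ := by
        gcongr
        exact (Finset.sum_le_sum_of_subset_of_nonneg (Finset.subset_univ _)
          fun _ _ _ => degR_nonneg _).trans hc.sum_degR_le

/-- Vertices of small degree have small weight. -/
lemma IsPerron.le_of_degR_lt {ρ c θ : ℝ} {x : V → ℝ} (hx : IsPerron G ρ x) (hc : LinSparse G c)
    (hc1 : 1 ≤ c) (hθ : 0 < θ) (hρ : c / θ ^ 2 ≤ ρ) (hρn : (Fintype.card V : ℝ) / 2 ≤ ρ ^ 2)
    {v : V} (hv : degR G v < θ * Fintype.card V) : x v ≤ 6 * c * θ := by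
  classical
  set n : ℝ := (Fintype.card V : ℝ) with hn
  have hnpos : 0 < n := by
    have : 0 < Fintype.card V := Fintype.card_pos_iff.2 ⟨v⟩
    rw [hn]; exact_mod_cast this
  set T : Finset V := Finset.univ.filter fun w => θ ≤ x w with hT
  have hρ0 : 0 < ρ := lt_of_lt_of_le (by positivity) hρ
  have hdeg : ∀ w, ρ * x w ≤ degR G w := by
    intro w
    rw [← hx.eig, degR]
    exact Finset.sum_le_sum fun u _ =>
      mul_le_of_le_one_right (adjInd_nonneg _ _ _) (hx.le_one u)
  have hTcard : (T.card : ℝ) * (ρ * θ) ≤ c * n := by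
    calc (T.card : ℝ) * (ρ * θ) = ∑ w ∈ T, ρ * θ := by simp
      _ ≤ ∑ w ∈ T, degR G w := by
          refine Finset.sum_le_sum fun w hw => ?_
          have : θ ≤ x w := (Finset.mem_filter.1 hw).2
          exact (mul_le_mul_of_nonneg_left this hρ0.le).trans (hdeg w)
      _ ≤ ∑ w, degR G w := Finset.sum_le_sum_of_subset_of_nonneg (Finset.subset_univ _)
          fun _ _ _ => degR_nonneg _
      _ ≤ _ := hc.sum_degR_le
  -- The bound |T| ≤ cn/(ρθ) becomes θn because ρ ≥ c/θ².
  have hT2 : (T.card : ℝ) ≤ θ * n := by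
    have h1 : c / θ ≤ ρ * θ := by
      calc c / θ = c / θ ^ 2 * θ := by field_simp
        _ ≤ _ := by gcongr
    have h2 : (T.card : ℝ) * (c / θ) ≤ c * n :=
      (mul_le_mul_of_nonneg_left h1 (Nat.cast_nonneg _)).trans hTcard
    have h3 : (T.card : ℝ) * (c / θ) = c * (T.card / θ) := by ring
    rw [h3] at h2
    have h4 := le_of_mul_le_mul_left h2 (by linarith)
    rwa [div_le_iff₀ hθ, mul_comm] at h4
  have h2 := hx.two_step_le hc hθ.le T (fun w hw => by
    have : ¬ θ ≤ x w := fun h => hw (Finset.mem_filter.2 ⟨Finset.mem_univ _, h⟩)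
    linarith) v
  have h3 : ∑ u ∈ nbrs G v, ∑ w ∈ T, adjInd G u w * x w ≤ c * (degR G v + T.card) := by
    calc _ ≤ pairs G (nbrs G v) T := Finset.sum_le_sum fun u _ => Finset.sum_le_sum fun w _ =>
          mul_le_of_le_one_right (adjInd_nonneg _ _ _) (hx.le_one w)
      _ ≤ pairs G (nbrs G v ∪ T) (nbrs G v ∪ T) :=
          pairs_mono Finset.subset_union_left Finset.subset_union_right
      _ ≤ c * ((nbrs G v ∪ T).card : ℝ) := hc _
      _ ≤ _ := by
          rw [degR_eq_card]
          gcongr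
          exact_mod_cast Finset.card_union_le _ _
  have h4 : c * (degR G v + T.card) ≤ c * (θ * n + θ * n) := by gcongr
  have h5 : n / 2 * x v ≤ ρ ^ 2 * x v := mul_le_mul_of_nonneg_right hρn (hx.nonneg v)
  -- Pairs between the neighbourhood and `T` give 2cθn and light end vertices give cθn; dividing by
  -- ρ² ≥ n/2 doubles the sum to 6cθ.
  have h6 : n * x v ≤ n * (6 * c * θ) := by nlinarith
  exact le_of_mul_le_mul_left h6 hnpos

/-- Few vertices have `k + 1` or more neighbours in a bounded set. -/
lemma FewCommon.card_many_le {k s : ℕ} (hs : FewCommon G (k + 1) s) [DecidableEq V]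
    (M : Finset V) :
    (Finset.univ.filter fun u => k + 1 ≤ (M ∩ nbrs G u).card).card ≤ 2 ^ M.card * s := by
  classical
  -- Each such vertex is a common neighbour of some (k+1)-subset of `M`; there are at most 2^|M| of
  -- these, each with fewer than s common neighbours.
  have hsub : (Finset.univ.filter fun u => k + 1 ≤ (M ∩ nbrs G u).card) ⊆
      (M.powersetCard (k + 1)).biUnion (commonNbrs G) := by
    intro u hu
    have hu' := (Finset.mem_filter.1 hu).2
    obtain ⟨T, hT1, hT2⟩ := Finset.exists_subset_card_eq hu'
    rw [Finset.mem_biUnion]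
    refine ⟨T, Finset.mem_powersetCard.2 ⟨hT1.trans Finset.inter_subset_left, hT2⟩, ?_⟩
    rw [mem_commonNbrs]
    intro t ht
    exact (mem_nbrs.1 (Finset.mem_inter.1 (hT1 ht)).2).symm
  refine (Finset.card_le_card hsub).trans ?_
  refine (Finset.card_biUnion_le_card_mul _ _ s fun T hT =>
    (hs T (Finset.mem_powersetCard.1 hT).2).le).trans ?_
  gcongr
  rw [← Finset.card_powerset]
  exact Finset.card_le_card fun T hT =>
    Finset.mem_powerset.2 (Finset.mem_powersetCard.1 hT).1

/-- For an exceptional vertex the trivial bound |M| is used. The set `U` will be the bounded set of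
vertices with more than k neighbours of linear degree. -/
lemma sum_nbrs_le_of_exception {U M : Finset V} {x : V → ℝ} (hx0 : ∀ v, 0 ≤ x v)
    (hx1 : ∀ v, x v ≤ 1) {b : ℝ} (hb : 0 ≤ b) (h : ∀ u ∉ U, ∑ w ∈ M, adjInd G u w * x w ≤ b)
    (v : V) :
    ∑ u ∈ nbrs G v, ∑ w ∈ M, adjInd G u w * x w ≤ b * degR G v + U.card * M.card := by
  classical
  have h1 : ∀ u, ∑ w ∈ M, adjInd G u w * x w ≤ b + if u ∈ U then (M.card : ℝ) else 0 := by
    intro u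
    by_cases hu : u ∈ U
    · rw [if_pos hu]
      have : ∑ w ∈ M, adjInd G u w * x w ≤ ∑ w ∈ M, (1 : ℝ) := Finset.sum_le_sum fun w _ =>
        mul_le_one₀ (adjInd_le_one _ _ _) (hx0 w) (hx1 w)
      simp only [Finset.sum_const, nsmul_eq_mul, mul_one] at this
      linarith
    · rw [if_neg hu]; linarith [h u hu]
  calc _ ≤ ∑ u ∈ nbrs G v, (b + if u ∈ U then (M.card : ℝ) else 0) :=
        Finset.sum_le_sum fun u _ => h1 u
    _ = b * degR G v + ∑ u ∈ nbrs G v, if u ∈ U then (M.card : ℝ) else 0 := by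
        rw [Finset.sum_add_distrib, degR_eq_card]; simp [mul_comm]
    _ ≤ b * degR G v + ∑ u, if u ∈ U then (M.card : ℝ) else 0 := by
        gcongr
        exact Finset.subset_univ _
    _ = _ := by simp

end Counting

/-! ### The core of heavy vertices -/

/-- The vertices outside `L` that are not adjacent to all of `L`. -/
noncomputable def incompleteVerts {V : Type} [Fintype V] (G : SimpleGraph V) (L : Finset V) :
    Finset V := by
  classical exact Finset.univ.filter fun v => v ∉ L ∧ ¬ ∀ l ∈ L, G.Adj l v

lemma mem_incompleteVerts {V : Type} [Fintype V] {G : SimpleGraph V} {L : Finset V} {v : V} :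
    v ∈ incompleteVerts G L ↔ v ∉ L ∧ ¬ ∀ l ∈ L, G.Adj l v := by simp [incompleteVerts]

section Core

variable {V : Type} [Fintype V] {G : SimpleGraph V}

lemma card_not_complete_le [DecidableEq V] (L : Finset V) {ε : ℝ}
    (hL : ∀ l ∈ L, (1 - ε) * Fintype.card V ≤ degR G l) :
    (((commonNbrs G L)ᶜ : Finset V).card : ℝ) ≤ L.card * (ε * Fintype.card V) := by
  classical
  have hsub : (commonNbrs G L)ᶜ ⊆ L.biUnion fun l => (nbrs G l)ᶜ := by
    intro v hv
    rw [Finset.mem_compl, mem_commonNbrs] at hv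
    push Not at hv
    obtain ⟨l, hl, hlv⟩ := hv
    exact Finset.mem_biUnion.2 ⟨l, hl, by rwa [Finset.mem_compl, mem_nbrs]⟩
  calc (((commonNbrs G L)ᶜ : Finset V).card : ℝ)
      ≤ ((L.biUnion fun l => (nbrs G l)ᶜ).card : ℝ) := by
        exact_mod_cast Finset.card_le_card hsub
    _ ≤ ∑ l ∈ L, (((nbrs G l)ᶜ : Finset V).card : ℝ) := by
        exact_mod_cast Finset.card_biUnion_le
    _ ≤ ∑ l ∈ L, ε * Fintype.card V := by
        refine Finset.sum_le_sum fun l hl => ?_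
        have h1 := hL l hl
        rw [degR_eq_card] at h1
        have h2 : ((nbrs G l).card : ℝ) + (((nbrs G l)ᶜ : Finset V).card : ℝ) = Fintype.card V := by
          exact_mod_cast Finset.card_add_card_compl (nbrs G l)
        linarith
    _ = _ := by simp

/-- The main two-step estimate: all but boundedly many vertices see at most `k` heavy vertices. -/
lemma IsPerron.main_estimate {ρ c θ : ℝ} {k s : ℕ} {x : V → ℝ} (hx : IsPerron G ρ x)
    (hc : LinSparse G c) (hs : FewCommon G (k + 1) s)
    (hc1 : 1 ≤ c) (hθ : 0 < θ) (hρ : c / θ ^ 2 ≤ ρ) (hρn : (Fintype.card V : ℝ) / 2 ≤ ρ ^ 2)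
    (hn : 2 ^ ⌊c / θ⌋₊ * s * (c / θ) ≤ c ^ 2 * θ * Fintype.card V) (L : Finset V)
    {b δ : ℝ} (hb : 0 ≤ b) (hL : ∀ v ∉ L, x v ≤ 1 - δ)
    (hLb : ∀ i j : ℕ, i + j ≤ k → i ≤ L.card → (i : ℝ) + (1 - δ) * j ≤ b) (v : V) :
    ρ ^ 2 * x v ≤ b * degR G v + 7 * c ^ 2 * θ * Fintype.card V := by
  classical
  have hnpos : (0 : ℝ) < Fintype.card V := by
    have : 0 < Fintype.card V := Fintype.card_pos_iff.2 ⟨v⟩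
    exact_mod_cast this
  set n : ℝ := (Fintype.card V : ℝ) with hndef
  -- Only boundedly many vertices have linear degree; all others have weight at most 6cθ.
  set M : Finset V := Finset.univ.filter fun w => θ * n ≤ degR G w with hM
  have hMoff : ∀ w ∉ M, x w ≤ 6 * c * θ := by
    intro w hw
    refine hx.le_of_degR_lt hc hc1 hθ hρ hρn ?_
    by_contra hcon
    exact hw (Finset.mem_filter.2 ⟨Finset.mem_univ _, not_lt.1 hcon⟩)
  have hMcard : (M.card : ℝ) ≤ c / θ := by
    have h1 : (M.card : ℝ) * (θ * n) ≤ c * n := by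
      calc (M.card : ℝ) * (θ * n) = ∑ w ∈ M, θ * n := by simp
        _ ≤ ∑ w ∈ M, degR G w := Finset.sum_le_sum fun w hw => (Finset.mem_filter.1 hw).2
        _ ≤ ∑ w, degR G w := Finset.sum_le_sum_of_subset_of_nonneg (Finset.subset_univ _)
          fun _ _ _ => degR_nonneg _
        _ ≤ _ := hc.sum_degR_le
    rw [le_div_iff₀ hθ]
    rw [← mul_assoc] at h1
    exact le_of_mul_le_mul_right h1 hnpos
  set U : Finset V := Finset.univ.filter fun u => k + 1 ≤ (M ∩ nbrs G u).card with hU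
  have hUcard : U.card ≤ 2 ^ M.card * s := hs.card_many_le M
  have h1 := hx.two_step_le hc (η := 6 * c * θ) (by positivity) M hMoff v
  -- Such a `u` sees at most k members of `M`, of weight at most 1 inside `L` and at most 1 - δ
  -- outside, which is the quantity bounded by `hLb`.
  have h2 : ∀ u ∉ U, ∑ w ∈ M, adjInd G u w * x w ≤ b := by
    intro u hu
    have hu' : (M ∩ nbrs G u).card ≤ k := by
      by_contra hcon
      exact hu (Finset.mem_filter.2 ⟨Finset.mem_univ _, by omega⟩)
    have h3 : ∑ w ∈ M, adjInd G u w * x w = ∑ w ∈ M ∩ nbrs G u, x w := by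
      have h0 : M ∩ nbrs G u = M.filter (· ∈ nbrs G u) := (Finset.filter_mem_eq_inter).symm
      rw [h0, Finset.sum_filter (· ∈ nbrs G u)]
      refine Finset.sum_congr rfl fun w _ => ?_
      by_cases h : G.Adj u w <;> simp [adjInd, h, mem_nbrs]
    set P := M ∩ nbrs G u
    rw [h3, ← Finset.sum_filter_add_sum_filter_not P (· ∈ L)]
    have h4 : ∑ w ∈ P.filter (· ∈ L), x w ≤ ((P.filter (· ∈ L)).card : ℝ) := by
      calc _ ≤ ∑ w ∈ P.filter (· ∈ L), (1 : ℝ) := Finset.sum_le_sum fun w _ => hx.le_one w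
        _ = _ := by simp
    have h5 : ∑ w ∈ P.filter (fun w => w ∉ L), x w
        ≤ (1 - δ) * ((P.filter (fun w => w ∉ L)).card : ℝ) := by
      calc _ ≤ ∑ w ∈ P.filter (fun w => w ∉ L), (1 - δ) :=
            Finset.sum_le_sum fun w hw => hL w (Finset.mem_filter.1 hw).2
        _ = _ := by rw [Finset.sum_const, nsmul_eq_mul, mul_comm]
    refine (add_le_add h4 h5).trans (hLb _ _ ?_ ?_)
    · rw [Finset.card_filter_add_card_filter_not]; exact hu'
    · exact Finset.card_le_card fun w hw => (Finset.mem_filter.1 hw).2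
  have h3 := sum_nbrs_le_of_exception hx.nonneg hx.le_one hb h2 v
  have h4 : (U.card : ℝ) * M.card ≤ c ^ 2 * θ * n := by
    refine le_trans ?_ hn
    have : (U.card : ℝ) ≤ 2 ^ ⌊c / θ⌋₊ * s := by
      have h5 : M.card ≤ ⌊c / θ⌋₊ := Nat.le_floor hMcard
      have h6 : U.card ≤ 2 ^ ⌊c / θ⌋₊ * s :=
        hUcard.trans (Nat.mul_le_mul_right _ (Nat.pow_le_pow_right (by norm_num) h5))
      exact_mod_cast h6
    gcongr
  -- The constant 7 is 6 from the light end vertices plus 1 from the exceptional set.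
  calc _ ≤ _ := h1
    _ ≤ b * degR G v + U.card * M.card + 6 * c * θ * (c * n) := by linarith
    _ ≤ _ := by nlinarith

set_option maxHeartbeats 1000000 in
/-- In a sparse graph with few common neighbourhoods and spectral radius at least `√(k(n-k))`,
there are `k` vertices of weight near `1`, nearly completely joined to the remaining vertices,
which have small weight. -/
theorem exists_core (k s : ℕ) (hk : 1 ≤ k) (c ε : ℝ) (hc1 : 1 ≤ c) (hε : 0 < ε) :
    ∃ n1 : ℕ, ∀ (V : Type) [Fintype V] (G : SimpleGraph V) (ρ : ℝ) (x : V → ℝ),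
      n1 ≤ Fintype.card V → IsPerron G ρ x → 0 ≤ ρ →
      (k : ℝ) * (Fintype.card V - k) ≤ ρ ^ 2 → LinSparse G c → FewCommon G (k + 1) s →
      ∃ L : Finset V, L.card = k ∧ (∀ l ∈ L, 1 - ε ≤ x l) ∧ (∀ v ∉ L, x v ≤ ε) ∧
        ((incompleteVerts G L).card : ℝ) ≤ ε * Fintype.card V := by
  classical
  -- A core for ε = 1/2 serves every larger ε.
  wlog hε2 : ε ≤ 1 / 2 generalizing ε
  · obtain ⟨n1, h⟩ := this (1 / 2) (by norm_num) le_rfl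
    refine ⟨n1, fun V _ G ρ x h1 h2 h3 h4 h5 h6 => ?_⟩
    obtain ⟨L, hL1, hL2, hL3, hL4⟩ := h V G ρ x h1 h2 h3 h4 h5 h6
    have : (1 / 2 : ℝ) ≤ ε := by linarith
    exact ⟨L, hL1, fun l hl => by linarith [hL2 l hl], fun v hv => (hL3 v hv).trans this,
      hL4.trans (by gcongr)⟩
  have hkR : (1 : ℝ) ≤ k := by exact_mod_cast hk
  set δ : ℝ := ε / (8 * k) with hδdef
  have hδ : 0 < δ := by positivity
  have hδk : 8 * k * δ = ε := by rw [hδdef]; field_simp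
  have hδε : 8 * δ ≤ ε := by
    have : δ ≤ k * δ := le_mul_of_one_le_left hδ.le hkR
    linarith
  -- This makes the error 7c²θ of the main estimate equal to δ/3.
  set θ : ℝ := δ / (21 * c ^ 2) with hθdef
  have hθ : 0 < θ := by positivity
  have hβ : 7 * c ^ 2 * θ = δ / 3 := by rw [hθdef]; field_simp; norm_num
  obtain ⟨N, hN⟩ := exists_nat_ge (2 * (c / θ ^ 2) ^ 2 + 2 * k + 3 * (k + k ^ 2) / δ + s / δ + 1 +
    2 ^ ⌊c / θ⌋₊ * s * (c / θ) / (c ^ 2 * θ))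
  refine ⟨N, fun V _ G ρ x hNV hx hρ hρk hc hs => ?_⟩
  set n : ℝ := (Fintype.card V : ℝ) with hn
  have hnN : (N : ℝ) ≤ n := by rw [hn]; exact_mod_cast hNV
  have p1 : 0 ≤ 2 * (c / θ ^ 2) ^ 2 := by positivity
  have p2 : 0 ≤ 3 * ((k : ℝ) + k ^ 2) / δ := by positivity
  have p3 : 0 ≤ (s : ℝ) / δ := by positivity
  have p4 : 0 ≤ 2 ^ ⌊c / θ⌋₊ * s * (c / θ) / (c ^ 2 * θ) := by positivity
  have n1 : 2 * (k : ℝ) ≤ n := by linarith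
  have n2 : 2 * (c / θ ^ 2) ^ 2 ≤ n := by linarith
  have n3 : 3 * ((k : ℝ) + k ^ 2) < δ * n := by
    have : 3 * ((k : ℝ) + k ^ 2) / δ < n := by linarith
    rwa [div_lt_iff₀ hδ, mul_comm n] at this
  have n4 : (s : ℝ) ≤ δ * n := by
    have : (s : ℝ) / δ ≤ n := by linarith
    rwa [div_le_iff₀ hδ, mul_comm n] at this
  have n5 : 2 ^ ⌊c / θ⌋₊ * s * (c / θ) ≤ c ^ 2 * θ * n := by
    have : 2 ^ ⌊c / θ⌋₊ * s * (c / θ) / (c ^ 2 * θ) ≤ n := by linarith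
    rwa [div_le_iff₀ (by positivity), mul_comm n] at this
  have hnpos : 0 < n := by linarith
  have hkn : (k : ℝ) * n / 2 ≤ ρ ^ 2 := by
    have : (k : ℝ) * (2 * k) ≤ k * n := by gcongr
    have e : (k : ℝ) * (n - k) = k * n - k * (2 * k) / 2 := by ring
    linarith
  have hρn : n / 2 ≤ ρ ^ 2 := by
    have : n ≤ k * n := le_mul_of_one_le_left hnpos.le hkR
    linarith
  have hρθ : c / θ ^ 2 ≤ ρ := by
    have : (c / θ ^ 2) ^ 2 ≤ ρ ^ 2 := by linarith
    exact (sq_le_sq₀ (by positivity) hρ).1 this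
  set L : Finset V := Finset.univ.filter fun v => 1 - δ ≤ x v with hL
  have hLmem : ∀ v, v ∈ L ↔ 1 - δ ≤ x v := fun v => by simp [hL]
  have hLoff : ∀ v ∉ L, x v ≤ 1 - δ := fun v hv => by
    rw [hLmem] at hv; linarith
  -- With all vertices in place of `L` the estimate reads ρ² x v ≤ k deg v + δn/3, so weight near 1
  -- forces degree near n.
  have est := fun (v : V) => hx.main_estimate hc hs hc1 hθ hρθ hρn n5 (Finset.univ : Finset V)
    (b := k) (δ := 0) (by positivity) (fun v hv => absurd (Finset.mem_univ v) hv)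
    (fun i j hij _ => by
      have : (i : ℝ) + j ≤ k := by exact_mod_cast hij
      linarith) v
  rw [hβ] at est
  have hLdeg : ∀ l ∈ L, (1 - 2 * δ) * n ≤ degR G l := by
    intro l hl
    have h1 := est l
    have h2 := (hLmem l).1 hl
    have h3 : (k : ℝ) * (n - k) * (1 - δ) ≤ ρ ^ 2 * x l := by
      have : 0 ≤ 1 - δ := by linarith
      exact mul_le_mul hρk h2 this (sq_nonneg _)
    have h4 : (k : ℝ) * ((n - k) * (1 - δ)) ≤ k * (degR G l + δ / 3 * n) := by
      have e : (k : ℝ) * ((n - k) * (1 - δ)) = k * (n - k) * (1 - δ) := by ring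
      have e2 : δ / 3 * n ≤ k * (δ / 3 * n) := le_mul_of_one_le_left (by positivity) hkR
      rw [e, mul_add]
      linarith
    have h5 := le_of_mul_le_mul_left h4 (by linarith)
    have e : (n - k) * (1 - δ) = n - δ * n - k + k * δ := by ring
    have e2 : 0 ≤ (k : ℝ) * δ := by positivity
    have e3 : 0 ≤ (k : ℝ) ^ 2 := by positivity
    linarith
  -- Any k+1 members of `L`, each missing at most 2δn vertices, would have at least s common
  -- neighbours.
  have hLle : L.card ≤ k := by
    by_contra hcon
    obtain ⟨T, hTL, hT⟩ := Finset.exists_subset_card_eq (show k + 1 ≤ L.card by omega)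
    have h1 := card_not_complete_le (G := G) T (ε := 2 * δ) fun l hl => hLdeg l (hTL hl)
    have h2 := hs T hT
    have h3 : ((commonNbrs G T).card : ℝ) + (((commonNbrs G T)ᶜ : Finset V).card : ℝ) = n := by
      rw [hn]; exact_mod_cast Finset.card_add_card_compl (commonNbrs G T)
    have h4 : ((commonNbrs G T).card : ℝ) < s := by exact_mod_cast h2
    rw [hT] at h1
    push_cast at h1
    have h5 : ((k : ℝ) + 1) * (2 * δ * n) ≤ n / 4 := by
      have : ((k : ℝ) + 1) * (2 * δ) ≤ 1 / 4 := by
        have e : ((k : ℝ) + 1) * (2 * δ) = (8 * k * δ) / 4 + 2 * δ := by ring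
        rw [e]; linarith
      calc ((k : ℝ) + 1) * (2 * δ * n) = ((k : ℝ) + 1) * (2 * δ) * n := by ring
        _ ≤ 1 / 4 * n := by gcongr
        _ = n / 4 := by ring
    have h6 : δ * n ≤ 1 / 4 * n := by
      gcongr; linarith
    linarith
  -- If |L| < k, any k vertices include one of weight at most 1 - δ, so b = k - δ is allowed. At a
  -- vertex of weight 1 this contradicts ρ² ≥ k(n-k).
  have hLge : k ≤ L.card := by
    by_contra hcon
    obtain ⟨v0, hv0⟩ := hx.exists_one
    have h1 := hx.main_estimate hc hs hc1 hθ hρθ hρn n5 L (b := k - δ) (δ := δ) (by linarith)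
      hLoff (fun i j hij hi => by
        have h2 : (i : ℝ) + j ≤ k := by exact_mod_cast hij
        have h3 : (i : ℝ) + 1 ≤ k := by
          have : i + 1 ≤ k := by omega
          exact_mod_cast this
        have h4 : (1 - δ) * (j : ℝ) ≤ (1 - δ) * (k - i) :=
          mul_le_mul_of_nonneg_left (by linarith) (by linarith)
        have h5 : δ * (i : ℝ) ≤ δ * (k - 1) := mul_le_mul_of_nonneg_left (by linarith) hδ.le
        have e : (1 - δ) * ((k : ℝ) - i) = k - i - δ * k + δ * i := by ring
        have e2 : δ * ((k : ℝ) - 1) = δ * k - δ := by ring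
        linarith) v0
    rw [hβ, hv0, mul_one] at h1
    have h2 : degR G v0 ≤ n := by
      rw [degR_eq_card, hn]; exact_mod_cast Finset.card_le_univ _
    have h3 : (k - δ) * degR G v0 ≤ (k - δ) * n := mul_le_mul_of_nonneg_left h2 (by linarith)
    have e : (k : ℝ) * (n - k) = k * n - k ^ 2 := by ring
    have e2 : (k - δ) * n = k * n - δ * n := by ring
    have e3 : 0 < (k : ℝ) := by linarith
    have e4 : 0 ≤ (k : ℝ) ^ 2 := by positivity
    linarith
  have hLk : L.card = k := le_antisymm hLle hLge
  have hcompl := card_not_complete_le (G := G) L (ε := 2 * δ) hLdeg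
  rw [hLk] at hcompl
  refine ⟨L, hLk, fun l hl => by linarith [(hLmem l).1 hl], fun v hv => ?_, ?_⟩
  · have h1 := est v
    -- Neighbours of `v` that are complete to `L` are common neighbours of k+1 vertices, so there
    -- are fewer than s; the others lie in the small set of vertices not complete to `L`.
    have h2 : degR G v ≤ s + k * (2 * δ * n) := by
      have h3 : (commonNbrs G (insert v L)).card < s :=
        hs _ (by rw [Finset.card_insert_of_notMem hv, hLk])
      have h4 : nbrs G v ⊆ commonNbrs G (insert v L) ∪ (commonNbrs G L)ᶜ := by
        intro u hu
        rw [Finset.mem_union, Finset.mem_compl, mem_commonNbrs, mem_commonNbrs]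
        by_cases h : ∀ t ∈ L, G.Adj t u
        · left
          intro t ht
          rcases Finset.mem_insert.1 ht with rfl | ht
          · exact mem_nbrs.1 hu
          · exact h t ht
        · exact Or.inr h
      have h5 := (Finset.card_le_card h4).trans (Finset.card_union_le _ _)
      have h6 : ((nbrs G v).card : ℝ) ≤ (commonNbrs G (insert v L)).card
          + (((commonNbrs G L)ᶜ : Finset V).card : ℝ) := by exact_mod_cast h5
      have h7 : ((commonNbrs G (insert v L)).card : ℝ) ≤ s := by exact_mod_cast h3.le
      rw [degR_eq_card]
      linarith
    have h3 : (k : ℝ) * n / 2 * x v ≤ ρ ^ 2 * x v := mul_le_mul_of_nonneg_right hkn (hx.nonneg v)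
    have h4 : (k : ℝ) * degR G v ≤ k * (δ * n + k * (2 * δ * n)) := by
      gcongr; linarith
    have h5 : δ / 3 * n ≤ k * (δ / 3 * n) := le_mul_of_one_le_left (by positivity) hkR
    have h6 : (k : ℝ) * (n / 2 * x v) ≤ k * ((δ * n + k * (2 * δ * n)) + δ / 3 * n) := by
      have e : (k : ℝ) * (n / 2 * x v) = k * n / 2 * x v := by ring
      rw [e, mul_add]
      linarith
    have h7 := le_of_mul_le_mul_left h6 (by linarith)
    have h8 : n * x v ≤ n * (8 * k * δ) := by
      have : δ * n ≤ k * (δ * n) := le_mul_of_one_le_left (by positivity) hkR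
      have e : n * (8 * k * δ) = 8 * (k * (δ * n)) := by ring
      have e2 : (k : ℝ) * (2 * δ * n) = 2 * (k * (δ * n)) := by ring
      rw [e]
      linarith
    rw [← hδk]
    exact le_of_mul_le_mul_left h8 hnpos
  · have h1 : incompleteVerts G L ⊆ (commonNbrs G L)ᶜ := by
      intro v hv
      rw [Finset.mem_compl, mem_commonNbrs]
      exact (mem_incompleteVerts.1 hv).2
    have h2 : ((incompleteVerts G L).card : ℝ) ≤ (((commonNbrs G L)ᶜ : Finset V).card : ℝ) := by
      exact_mod_cast Finset.card_le_card h1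
    rw [← hδk]
    have : 0 ≤ (k : ℝ) * δ * n := by positivity
    linarith

end Core

/-! ### Completing the join between the core and the rest -/

/-- Every vertex of `L` is adjacent to every vertex outside `L`. -/
def CompleteTo {V : Type} (G : SimpleGraph V) (L : Finset V) : Prop :=
  ∀ l ∈ L, ∀ v ∉ L, G.Adj l v

section Blocks

variable {V : Type} [Fintype V] [DecidableEq V] {G : SimpleGraph V} {L : Finset V}

lemma sum_blocks (L : Finset V) (f : V → V → ℝ) :
    ∑ u, ∑ v, f u v = (∑ u ∈ L, ∑ v ∈ L, f u v + ∑ u ∈ L, ∑ v ∈ Lᶜ, f u v) +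
      (∑ u ∈ Lᶜ, ∑ v ∈ L, f u v + ∑ u ∈ Lᶜ, ∑ v ∈ Lᶜ, f u v) := by
  rw [← Finset.sum_add_sum_compl L, ← Finset.sum_add_distrib, ← Finset.sum_add_distrib]
  congr 1 <;> exact Finset.sum_congr rfl fun u _ => (Finset.sum_add_sum_compl L _).symm

lemma CompleteTo.eig_off {ρ : ℝ} {x : V → ℝ} (hL : CompleteTo G L) (hx : IsPerron G ρ x)
    {v : V} (hv : v ∉ L) :
    ∑ l ∈ L, x l + ∑ u ∈ Lᶜ, adjInd G v u * x u = ρ * x v := by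
  rw [← hx.eig, ← Finset.sum_add_sum_compl L]
  congr 1
  refine Finset.sum_congr rfl fun l hl => ?_
  rw [adjInd_of_adj _ (hL l hl v hv).symm, one_mul]

lemma CompleteTo.sum_le_off {ρ : ℝ} {x : V → ℝ} (hL : CompleteTo G L) (hx : IsPerron G ρ x)
    {v : V} (hv : v ∉ L) : ∑ l ∈ L, x l ≤ ρ * x v := by
  rw [← hL.eig_off hx hv]
  have : 0 ≤ ∑ u ∈ Lᶜ, adjInd G v u * x u :=
    Finset.sum_nonneg fun u _ => mul_nonneg (adjInd_nonneg _ _ _) (hx.nonneg u)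
  linarith

/-- At a vertex maximising x off `L`, the neighbours off `L` contribute at most D times that
maximum. With `CompleteTo.sum_le_off` this pins all weights off `L` between σ/ρ and σ/(ρ-D), where σ
is the weight of `L`. -/
lemma CompleteTo.off_le {ρ D : ℝ} {x : V → ℝ} (hL : CompleteTo G L) (hx : IsPerron G ρ x)
    (hD : ∀ v ∉ L, ∑ u ∈ Lᶜ, adjInd G v u ≤ D) (hDρ : D < ρ) {v : V} (hv : v ∉ L) :
    (ρ - D) * x v ≤ ∑ l ∈ L, x l := by
  obtain ⟨w, hw, hmax⟩ := Finset.exists_max_image Lᶜ x ⟨v, Finset.mem_compl.2 hv⟩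
  have h1 := hL.eig_off hx (Finset.mem_compl.1 hw)
  have h2 : ∑ u ∈ Lᶜ, adjInd G w u * x u ≤ D * x w := by
    calc _ ≤ ∑ u ∈ Lᶜ, adjInd G w u * x w := Finset.sum_le_sum fun u hu =>
          mul_le_mul_of_nonneg_left (hmax u hu) (adjInd_nonneg _ _ _)
      _ = (∑ u ∈ Lᶜ, adjInd G w u) * x w := by rw [Finset.sum_mul]
      _ ≤ _ := mul_le_mul_of_nonneg_right (hD w (Finset.mem_compl.1 hw)) (hx.nonneg w)
  have h3 := mul_le_mul_of_nonneg_left (hmax v (Finset.mem_compl.2 hv)) (sub_pos.2 hDρ).le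
  linarith

lemma CompleteTo.sum_pos {ρ D : ℝ} {x : V → ℝ} (hL : CompleteTo G L) (hx : IsPerron G ρ x)
    (hD : ∀ v ∉ L, ∑ u ∈ Lᶜ, adjInd G v u ≤ D) (hDρ : D < ρ) : 0 < ∑ l ∈ L, x l := by
  by_contra hcon
  have h0 : ∑ l ∈ L, x l = 0 :=
    le_antisymm (not_lt.1 hcon) (Finset.sum_nonneg fun l _ => hx.nonneg l)
  obtain ⟨v, hv⟩ := hx.exists_one
  by_cases hvL : v ∈ L
  · have := (Finset.sum_eq_zero_iff_of_nonneg fun l _ => hx.nonneg l).1 h0 v hvL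
    linarith
  · have := hL.off_le hx hD hDρ hvL
    rw [h0, hv] at this
    linarith

/-- If completing the pairs between `L` and its complement, at the cost of deleting a comparable
number of edges off `L`, does not increase the spectral radius, then no pair was missing. -/
theorem completeTo_of_le {G' : SimpleGraph V} {ρ ρ' ε D C : ℝ} {x y : V → ℝ}
    (hx : IsPerron G ρ x) (hy : IsPerron G' ρ' y) (hle : ρ' ≤ ρ)
    (hxL : ∀ l ∈ L, 1 / 2 ≤ x l) (hxR : ∀ v ∉ L, x v ≤ ε) (hε : 0 ≤ ε)
    (hL' : CompleteTo G' L) (hLL : ∀ u ∈ L, ∀ v ∈ L, (G'.Adj u v ↔ G.Adj u v))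
    (hRR : ∀ u ∉ L, ∀ v ∉ L, G'.Adj u v → G.Adj u v)
    (hD0 : 0 ≤ D) (hD : ∀ v ∉ L, ∑ u ∈ Lᶜ, adjInd G' v u ≤ D) (hρ' : 2 * D < ρ')
    (hC : pairs G Lᶜ Lᶜ - pairs G' Lᶜ Lᶜ ≤ C * ∑ v ∈ Lᶜ, ∑ l ∈ L, (1 - adjInd G v l))
    (hεC : 4 * ε * C < 1) : CompleteTo G L := by
  -- The four blocks of this inequality are treated separately: `b1` is unchanged, `b2` can only
  -- gain, `b3` gains at least σ/(2ρ') per missing pair, and `b4` loses at most 2σε/ρ' per deleted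
  -- pair.
  have hmix := hx.mixed hy hle
  rw [sum_blocks L, sum_blocks L] at hmix
  set m := ∑ v ∈ Lᶜ, ∑ l ∈ L, (1 - adjInd G v l) with hm
  have hterm : ∀ v l, 0 ≤ 1 - adjInd G v l := fun v l => by linarith [adjInd_le_one G v l]
  have hm0 : 0 ≤ m := Finset.sum_nonneg fun v _ => Finset.sum_nonneg fun l _ => hterm v l
  have hρ0 : 0 < ρ' := by linarith
  set σ := ∑ l ∈ L, y l with hσ
  have hσpos : 0 < σ := hL'.sum_pos hy hD (by linarith)
  have b1 : ∑ u ∈ L, ∑ v ∈ L, adjInd G u v * (y u * x v)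
      = ∑ u ∈ L, ∑ v ∈ L, adjInd G' u v * (y u * x v) :=
    Finset.sum_congr rfl fun u hu => Finset.sum_congr rfl fun v hv => by
      by_cases h : G.Adj u v
      · rw [adjInd_of_adj _ h, adjInd_of_adj _ ((hLL u hu v hv).2 h)]
      · rw [adjInd_of_not_adj _ h, adjInd_of_not_adj _ fun h' => h ((hLL u hu v hv).1 h')]
  have b2 : ∑ u ∈ L, ∑ v ∈ Lᶜ, adjInd G u v * (y u * x v)
      ≤ ∑ u ∈ L, ∑ v ∈ Lᶜ, adjInd G' u v * (y u * x v) :=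
    Finset.sum_le_sum fun u hu => Finset.sum_le_sum fun v hv => by
      rw [adjInd_of_adj _ (hL' u hu v (Finset.mem_compl.1 hv))]
      exact mul_le_mul_of_nonneg_right (adjInd_le_one _ _ _)
        (mul_nonneg (hy.nonneg _) (hx.nonneg _))
  have b3 : ∑ u ∈ Lᶜ, ∑ v ∈ L, adjInd G u v * (y u * x v) + σ / ρ' * (1 / 2) * m
      ≤ ∑ u ∈ Lᶜ, ∑ v ∈ L, adjInd G' u v * (y u * x v) := by
    rw [hm, Finset.mul_sum, ← Finset.sum_add_distrib]
    refine Finset.sum_le_sum fun u hu => ?_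
    rw [Finset.mul_sum, ← Finset.sum_add_distrib]
    refine Finset.sum_le_sum fun v hv => ?_
    rw [adjInd_of_adj _ (hL' v hv u (Finset.mem_compl.1 hu)).symm]
    have h1 : σ / ρ' ≤ y u := by
      rw [div_le_iff₀ hρ0, mul_comm]
      exact hL'.sum_le_off hy (Finset.mem_compl.1 hu)
    have h2 : σ / ρ' * (1 / 2) ≤ y u * x v :=
      mul_le_mul h1 (hxL v hv) (by norm_num) (hy.nonneg u)
    have h3 := mul_le_mul_of_nonneg_right h2 (hterm u v)
    linarith
  have b4 : ∑ u ∈ Lᶜ, ∑ v ∈ Lᶜ, adjInd G u v * (y u * x v)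
      ≤ ∑ u ∈ Lᶜ, ∑ v ∈ Lᶜ, adjInd G' u v * (y u * x v)
        + 2 * σ / ρ' * ε * (pairs G Lᶜ Lᶜ - pairs G' Lᶜ Lᶜ) := by
    unfold pairs
    rw [← Finset.sum_sub_distrib, Finset.mul_sum, ← Finset.sum_add_distrib]
    refine Finset.sum_le_sum fun u hu => ?_
    rw [← Finset.sum_sub_distrib, Finset.mul_sum, ← Finset.sum_add_distrib]
    refine Finset.sum_le_sum fun v hv => ?_
    have hu' := Finset.mem_compl.1 hu
    have hv' := Finset.mem_compl.1 hv
    have h1 : y u ≤ 2 * σ / ρ' := by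
      rw [le_div_iff₀ hρ0]
      have h2 := hL'.off_le hy hD (by linarith) hu'
      have h3 : D * y u ≤ ρ' / 2 * y u := mul_le_mul_of_nonneg_right (by linarith) (hy.nonneg u)
      rw [sub_mul] at h2
      linarith
    have h2 : y u * x v ≤ 2 * σ / ρ' * ε :=
      mul_le_mul h1 (hxR v hv') (hx.nonneg v) ((hy.nonneg u).trans h1)
    have h3 : 0 ≤ adjInd G u v - adjInd G' u v := by
      by_cases h : G'.Adj u v
      · rw [adjInd_of_adj _ h, adjInd_of_adj _ (hRR u hu' v hv' h)]; norm_num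
      · rw [adjInd_of_not_adj G' h, sub_zero]; exact adjInd_nonneg _ _ _
    have h4 := mul_le_mul_of_nonneg_left h2 h3
    linarith
  have h5 : 2 * σ / ρ' * ε * (pairs G Lᶜ Lᶜ - pairs G' Lᶜ Lᶜ) ≤ 2 * σ / ρ' * ε * (C * m) :=
    mul_le_mul_of_nonneg_left hC (by positivity)
  have h6 : σ / ρ' * (1 / 2 * m) ≤ σ / ρ' * (2 * ε * C * m) := by
    have e1 : σ / ρ' * (1 / 2 * m) = σ / ρ' * (1 / 2) * m := by ring
    have e2 : σ / ρ' * (2 * ε * C * m) = 2 * σ / ρ' * ε * (C * m) := by ring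
    rw [e1, e2]; linarith
  have h7 := le_of_mul_le_mul_left h6 (by positivity)
  -- Here m/2 ≤ 2εCm, while 4εC < 1.
  have h8 : m = 0 := by nlinarith
  intro l hl v hv
  by_contra hcon
  have h9 := (Finset.sum_eq_zero_iff_of_nonneg fun v _ =>
    Finset.sum_nonneg fun l _ => hterm v l).1 h8 v (Finset.mem_compl.2 hv)
  have h10 := (Finset.sum_eq_zero_iff_of_nonneg fun l _ => hterm v l).1 h9 l hl
  rw [adjInd_of_not_adj _ fun h => hcon h.symm] at h10
  norm_num at h10

end Blocks

/-! ### Expansion of the spectral radius in walk counts off the core -/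

/-- The adjacency operator of the graph induced on the complement of `L`. -/
noncomputable def offOp {V : Type} [Fintype V] [DecidableEq V] (G : SimpleGraph V) (L : Finset V)
    (f : V → ℝ) (u : V) : ℝ :=
  ∑ v ∈ Lᶜ, adjInd G u v * f v

/-- The degree in the graph induced on the complement of `L`. -/
noncomputable def offDeg {V : Type} [Fintype V] [DecidableEq V] (G : SimpleGraph V) (L : Finset V)
    (u : V) : ℝ :=
  ∑ v ∈ Lᶜ, adjInd G u v

/-- Every vertex of `L` is adjacent to every other vertex. -/
def Dominating {V : Type} (G : SimpleGraph V) (L : Finset V) : Prop :=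
  ∀ l ∈ L, ∀ v, v ≠ l → G.Adj l v

lemma Dominating.completeTo {V : Type} {G : SimpleGraph V} {L : Finset V}
    (h : Dominating G L) : CompleteTo G L :=
  fun l hl v hv => h l hl v fun e => hv (e ▸ hl)

section Moments

variable {V : Type} [Fintype V] [DecidableEq V] {G : SimpleGraph V} {L : Finset V}

lemma offOp_one : offOp G L (fun _ => 1) = offDeg G L := by
  ext u; simp [offOp, offDeg]

lemma offDeg_nonneg (u : V) : 0 ≤ offDeg G L u := Finset.sum_nonneg fun _ _ => adjInd_nonneg _ _ _

lemma sum_offDeg : ∑ u ∈ Lᶜ, offDeg G L u = pairs G Lᶜ Lᶜ := rfl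

lemma offOp_nonneg {f : V → ℝ} (hf : ∀ v, 0 ≤ f v) (u : V) : 0 ≤ offOp G L f u :=
  Finset.sum_nonneg fun v _ => mul_nonneg (adjInd_nonneg _ _ _) (hf v)

lemma offOp_le {f : V → ℝ} {D E : ℝ} (hE : 0 ≤ E) (hD : ∀ v ∉ L, offDeg G L v ≤ D)
    (hf : ∀ v ∉ L, f v ≤ E) {u : V} (hu : u ∉ L) : offOp G L f u ≤ D * E := by
  calc offOp G L f u ≤ ∑ v ∈ Lᶜ, adjInd G u v * E := Finset.sum_le_sum fun v hv =>
        mul_le_mul_of_nonneg_left (hf v (Finset.mem_compl.1 hv)) (adjInd_nonneg _ _ _)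
    _ = offDeg G L u * E := by rw [offDeg, Finset.sum_mul]
    _ ≤ _ := mul_le_mul_of_nonneg_right (hD u hu) hE

lemma sum_offOp_mul (f g : V → ℝ) :
    ∑ u ∈ Lᶜ, offOp G L f u * g u = ∑ u ∈ Lᶜ, f u * offOp G L g u := by
  simp only [offOp, Finset.sum_mul, Finset.mul_sum]
  rw [Finset.sum_comm]
  exact Finset.sum_congr rfl fun u _ => Finset.sum_congr rfl fun v _ => by
    rw [adjInd_comm]; ring

/-- The eigenvalue equation off `L`, tested against f, with the self-adjoint `offOp` moved onto f.
One factor ρ is traded for one step of a walk, so the identity can be iterated. -/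
lemma CompleteTo.sum_off_mul {ρ : ℝ} {x : V → ℝ} (hL : CompleteTo G L) (hx : IsPerron G ρ x)
    (f : V → ℝ) :
    ρ * ∑ u ∈ Lᶜ, f u * x u
      = (∑ l ∈ L, x l) * ∑ u ∈ Lᶜ, f u + ∑ u ∈ Lᶜ, offOp G L f u * x u := by
  rw [sum_offOp_mul, Finset.mul_sum, Finset.mul_sum, ← Finset.sum_add_distrib]
  refine Finset.sum_congr rfl fun u hu => ?_
  have := hL.eig_off hx (Finset.mem_compl.1 hu)
  rw [offOp]
  linear_combination (-f u) * this

lemma CompleteTo.eig_on {ρ : ℝ} {x : V → ℝ} (hL : CompleteTo G L) (hx : IsPerron G ρ x)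
    {l : V} (hl : l ∈ L) :
    ∑ m ∈ L, adjInd G l m * x m + ∑ u ∈ Lᶜ, x u = ρ * x l := by
  rw [← hx.eig, ← Finset.sum_add_sum_compl L]
  congr 1
  refine Finset.sum_congr rfl fun u hu => ?_
  rw [adjInd_of_adj _ (hL l hl u (Finset.mem_compl.1 hu)), one_mul]

/-- The number (ρ+1) x v is the total weight when v is dominating and at most that for any v, so
dominating vertices carry the maximum weight. -/
lemma Dominating.eq_one {ρ : ℝ} {x : V → ℝ} (hL : Dominating G L) (hx : IsPerron G ρ x)
    (hρ : 0 ≤ ρ) {l : V} (hl : l ∈ L) : x l = 1 := by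
  have h1 : (ρ + 1) * x l = ∑ v, x v := by
    rw [add_mul, ← hx.eig, one_mul, ← Finset.sum_erase_add _ _ (Finset.mem_univ l),
      adjInd_self, zero_mul, add_zero, ← Finset.sum_erase_add (a := l) _ x (Finset.mem_univ l)]
    congr 1
    refine Finset.sum_congr rfl fun v hv => ?_
    rw [adjInd_of_adj _ (hL l hl v (Finset.ne_of_mem_erase hv)), one_mul]
  obtain ⟨w, hw⟩ := hx.exists_one
  have h2 : (ρ + 1) * x w ≤ ∑ v, x v := by
    rw [add_mul, ← hx.eig, one_mul, ← Finset.sum_erase_add _ _ (Finset.mem_univ w),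
      adjInd_self, zero_mul, add_zero, ← Finset.sum_erase_add (a := w) _ x (Finset.mem_univ w)]
    gcongr with v hv
    exact mul_le_of_le_one_left (hx.nonneg v) (adjInd_le_one _ _ _)
  rw [← h1] at h2
  have h3 := le_of_mul_le_mul_left h2 (by linarith)
  exact le_antisymm (hx.le_one l) (hw ▸ h3)

lemma Dominating.rho_eq {ρ : ℝ} {x : V → ℝ} (hL : Dominating G L) (hx : IsPerron G ρ x)
    (hρ : 0 ≤ ρ) (hne : L.Nonempty) : ρ - L.card + 1 = ∑ u ∈ Lᶜ, x u := by
  obtain ⟨l, hl⟩ := hne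
  have h1 := hL.completeTo.eig_on hx hl
  rw [hL.eq_one hx hρ hl, mul_one, ← Finset.sum_erase_add _ _ hl, adjInd_self, zero_mul,
    add_zero] at h1
  have h2 : ∑ m ∈ L.erase l, adjInd G l m * x m = ∑ m ∈ L.erase l, (1 : ℝ) :=
    Finset.sum_congr rfl fun m hm => by
      rw [adjInd_of_adj _ (hL l hl m (Finset.ne_of_mem_erase hm)),
        hL.eq_one hx hρ (Finset.mem_of_mem_erase hm), mul_one]
  rw [h2, Finset.sum_const, nsmul_eq_mul, mul_one, Finset.card_erase_of_mem hl,
    Nat.cast_sub (Finset.card_pos.2 ⟨l, hl⟩)] at h1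
  push_cast at h1
  linarith

/-- The second moment of the off-degrees. -/
noncomputable def offMoment2 (G : SimpleGraph V) (L : Finset V) : ℝ :=
  ∑ u ∈ Lᶜ, offDeg G L u ^ 2

/-- The number of walks of length three off `L`. -/
noncomputable def offMoment3 (G : SimpleGraph V) (L : Finset V) : ℝ :=
  ∑ u ∈ Lᶜ, offDeg G L u * offOp G L (offDeg G L) u

/-- Four applications of `CompleteTo.sum_off_mul`, starting from the constant function, to the
weight off `L` found in `Dominating.rho_eq`; each splits off |L| times the next walk count. -/
lemma Dominating.expansion {ρ : ℝ} {x : V → ℝ} (hL : Dominating G L) (hx : IsPerron G ρ x)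
    (hρ : 0 ≤ ρ) (hne : L.Nonempty) :
    ρ ^ 4 * (ρ - L.card + 1) = L.card * ((Lᶜ.card : ℝ) * ρ ^ 3 + pairs G Lᶜ Lᶜ * ρ ^ 2 +
        offMoment2 G L * ρ + offMoment3 G L) +
      ∑ u ∈ Lᶜ, offOp G L (offOp G L (offOp G L (offDeg G L))) u * x u := by
  have hτ : ∑ l ∈ L, x l = L.card := by
    rw [Finset.sum_congr rfl fun l hl => hL.eq_one hx hρ hl]; simp
  have h0 := hL.completeTo.sum_off_mul hx (fun _ => 1)
  have h1 := hL.completeTo.sum_off_mul hx (offDeg G L)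
  have h2 := hL.completeTo.sum_off_mul hx (offOp G L (offDeg G L))
  have h3 := hL.completeTo.sum_off_mul hx (offOp G L (offOp G L (offDeg G L)))
  rw [hτ] at h0 h1 h2 h3
  rw [offOp_one] at h0
  have e2 : ∑ u ∈ Lᶜ, offOp G L (offDeg G L) u = offMoment2 G L := by
    have := sum_offOp_mul (G := G) (L := L) (offDeg G L) (fun _ => 1)
    rw [offOp_one] at this
    simp only [mul_one] at this
    rw [this, offMoment2]
    exact Finset.sum_congr rfl fun u _ => by ring
  have e3 : ∑ u ∈ Lᶜ, offOp G L (offOp G L (offDeg G L)) u = offMoment3 G L := by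
    have := sum_offOp_mul (G := G) (L := L) (offOp G L (offDeg G L)) (fun _ => 1)
    rw [offOp_one] at this
    simp only [mul_one] at this
    rw [this, offMoment3]
    exact Finset.sum_congr rfl fun u _ => by ring
  rw [sum_offDeg] at h1
  rw [e2] at h2
  rw [e3] at h3
  simp only [one_mul, Finset.sum_const, nsmul_eq_mul, mul_one] at h0
  rw [hL.rho_eq hx hρ hne]
  linear_combination ρ ^ 3 * h0 + ρ ^ 2 * h1 + ρ * h2 + h3

lemma offMoment2_nonneg : 0 ≤ offMoment2 G L := Finset.sum_nonneg fun _ _ => sq_nonneg _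

lemma offMoment3_nonneg : 0 ≤ offMoment3 G L := Finset.sum_nonneg fun _ _ =>
  mul_nonneg (offDeg_nonneg _) (offOp_nonneg offDeg_nonneg _)

set_option maxHeartbeats 600000 in
/-- Among graphs in which `L` is dominating, having fewer edges lowers the spectral radius as soon
as the higher walk counts are under control. -/
theorem Dominating.lt_of_pairs {G' : SimpleGraph V} {ρ ρ' D C : ℝ} {x y : V → ℝ}
    (hL : Dominating G L) (hL' : Dominating G' L) (hx : IsPerron G ρ x) (hy : IsPerron G' ρ' y)
    (hne : L.Nonempty) (hρ' : 0 < ρ') (hC : 0 ≤ C)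
    (hD0 : 0 ≤ D) (hD : ∀ v ∉ L, offDeg G L v ≤ D)
    (h1 : pairs G Lᶜ Lᶜ + 1 ≤ pairs G' Lᶜ Lᶜ) (h2 : offMoment2 G L ≤ offMoment2 G' L + C)
    (h3 : offMoment3 G L ≤ offMoment3 G' L + C + (pairs G' Lᶜ Lᶜ - pairs G Lᶜ Lᶜ))
    (hbig : 2 * (2 * C + D ^ 4) + 2 < ρ) : ρ < ρ' := by
  by_contra hcon
  have hle : ρ' ≤ ρ := not_lt.1 hcon
  have hρ : 0 < ρ := hρ'.trans_le hle
  have E := hL.expansion hx hρ.le hne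
  have E' := hL'.expansion hy hρ'.le hne
  set k : ℝ := (L.card : ℝ) with hk
  have hk1 : 1 ≤ k := by
    rw [hk]; exact_mod_cast hne.card_pos
  set r : ℝ := (Lᶜ.card : ℝ) with hr
  have hr0 : 0 ≤ r := Nat.cast_nonneg _
  set w1 := pairs G Lᶜ Lᶜ with hw1
  set w2 := offMoment2 G L
  set w3 := offMoment3 G L
  set v1 := pairs G' Lᶜ Lᶜ with hv1
  set v2 := offMoment2 G' L
  set v3 := offMoment3 G' L
  have hv1' : 0 ≤ v1 := pairs_nonneg _ _
  have hv2' : 0 ≤ v2 := offMoment2_nonneg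
  have hv3' : 0 ≤ v3 := offMoment3_nonneg
  have hrem' : 0 ≤ ∑ u ∈ Lᶜ, offOp G' L (offOp G' L (offOp G' L (offDeg G' L))) u * y u :=
    Finset.sum_nonneg fun u _ => mul_nonneg
      (offOp_nonneg (offOp_nonneg (offOp_nonneg offDeg_nonneg)) u) (hy.nonneg u)
  -- At most D⁴ walks of length four start at any vertex off `L`, and the total weight off `L` is ρ
  -- - k + 1 ≤ ρ.
  have hrem : ∑ u ∈ Lᶜ, offOp G L (offOp G L (offOp G L (offDeg G L))) u * x u ≤ D ^ 4 * ρ := by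
    have hb : ∀ u ∉ L, offOp G L (offOp G L (offOp G L (offDeg G L))) u ≤ D ^ 4 := by
      intro u hu
      have := offOp_le (G := G) (L := L) (E := D * (D * D)) (by positivity) hD
        (fun v hv => offOp_le (by positivity) hD (fun w hw => offOp_le hD0 hD hD hw) hv) hu
      calc _ ≤ _ := this
        _ = _ := by ring
    calc _ ≤ ∑ u ∈ Lᶜ, D ^ 4 * x u := Finset.sum_le_sum fun u hu =>
          mul_le_mul_of_nonneg_right (hb u (Finset.mem_compl.1 hu)) (hx.nonneg u)
      _ = D ^ 4 * (ρ - k + 1) := by rw [← Finset.mul_sum, hL.rho_eq hx hρ.le hne]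
      _ ≤ _ := by gcongr; linarith
  have F : ρ - k + 1 ≤ k * (r / ρ + w1 / ρ ^ 2 + w2 / ρ ^ 3 + w3 / ρ ^ 4) + D ^ 4 / ρ ^ 3 := by
    have e : k * (r / ρ + w1 / ρ ^ 2 + w2 / ρ ^ 3 + w3 / ρ ^ 4) + D ^ 4 / ρ ^ 3
        = (k * (r * ρ ^ 3 + w1 * ρ ^ 2 + w2 * ρ + w3) + D ^ 4 * ρ) / ρ ^ 4 := by
      field_simp
    rw [e, le_div_iff₀ (by positivity)]
    linarith
  have F' : k * (r / ρ' + v1 / ρ' ^ 2 + v2 / ρ' ^ 3 + v3 / ρ' ^ 4) ≤ ρ' - k + 1 := by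
    have e : k * (r / ρ' + v1 / ρ' ^ 2 + v2 / ρ' ^ 3 + v3 / ρ' ^ 4)
        = (k * (r * ρ' ^ 3 + v1 * ρ' ^ 2 + v2 * ρ' + v3)) / ρ' ^ 4 := by
      field_simp
    rw [e, div_le_iff₀ (by positivity)]
    linarith
  -- The main terms decrease in the spectral radius, so those of `G'` may be evaluated at ρ ≥ ρ',
  -- where both graphs are compared.
  have Fm : k * (r / ρ + v1 / ρ ^ 2 + v2 / ρ ^ 3 + v3 / ρ ^ 4)
      ≤ k * (r / ρ' + v1 / ρ' ^ 2 + v2 / ρ' ^ 3 + v3 / ρ' ^ 4) := by gcongr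
  have F2 : k * ((v1 - w1) / ρ ^ 2 + (v2 - w2) / ρ ^ 3 + (v3 - w3) / ρ ^ 4) ≤ D ^ 4 / ρ ^ 3 := by
    have e : k * ((v1 - w1) / ρ ^ 2 + (v2 - w2) / ρ ^ 3 + (v3 - w3) / ρ ^ 4)
      = k * (r / ρ + v1 / ρ ^ 2 + v2 / ρ ^ 3 + v3 / ρ ^ 4)
        - k * (r / ρ + w1 / ρ ^ 2 + w2 / ρ ^ 3 + w3 / ρ ^ 4) := by ring
    rw [e]; linarith
  have F3 : k * ((v1 - w1) * ρ ^ 2 + (v2 - w2) * ρ + (v3 - w3)) ≤ D ^ 4 * ρ := by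
    have e : k * ((v1 - w1) / ρ ^ 2 + (v2 - w2) / ρ ^ 3 + (v3 - w3) / ρ ^ 4)
        = (k * ((v1 - w1) * ρ ^ 2 + (v2 - w2) * ρ + (v3 - w3))) / ρ ^ 4 := by
      field_simp
    rw [e, div_le_iff₀ (by positivity)] at F2
    have e2 : D ^ 4 / ρ ^ 3 * ρ ^ 4 = D ^ 4 * ρ := by field_simp
    rwa [e2] at F2
  have hD4 : 0 ≤ D ^ 4 := by positivity
  have hρ2 : 2 < ρ := by linarith
  have g0 : 2 * ρ < ρ ^ 2 := by rw [pow_two]; exact mul_lt_mul_of_pos_right hρ2 hρ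
  have g1 : (v2 - w2) * ρ ≥ -C * ρ := mul_le_mul_of_nonneg_right (by linarith) hρ.le
  -- The allowance v1 - w1 granted to the third moment merely lowers the factor ρ² to ρ² - 1.
  have g2 : ρ ^ 2 - 1 ≤ (v1 - w1) * (ρ ^ 2 - 1) := le_mul_of_one_le_left (by linarith)
    (by linarith)
  have g3 : ρ ^ 2 - 1 - C * ρ - C ≤ (v1 - w1) * ρ ^ 2 + (v2 - w2) * ρ + (v3 - w3) := by
    linarith
  have g4 : D ^ 4 * ρ < ρ ^ 2 - 1 - C * ρ - C := by
    have h := mul_lt_mul_of_pos_right hbig hρ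
    have h' : C ≤ C * ρ := le_mul_of_one_le_right hC (by linarith)
    have e : (2 * (2 * C + D ^ 4) + 2) * ρ = 4 * (C * ρ) + 2 * (D ^ 4 * ρ) + 2 * ρ := by ring
    have h'' : 0 ≤ D ^ 4 * ρ := by positivity
    rw [e, ← pow_two] at h
    linarith
  have g5 : ρ ^ 2 - 1 - C * ρ - C ≤ k * (ρ ^ 2 - 1 - C * ρ - C) :=
    le_mul_of_one_le_left (by have := mul_nonneg hD4 hρ.le; linarith) hk1
  have g6 := mul_le_mul_of_nonneg_left g3 (by linarith : 0 ≤ k)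
  linarith

set_option maxHeartbeats 600000 in
/-- A graph in which `L` is not a clique has smaller spectral radius than a graph with no fewer
edges in which `L` is dominating. -/
theorem CompleteTo.lt_of_missing {G' : SimpleGraph V} {ρ ρ' D E : ℝ} {x y : V → ℝ}
    (hL : CompleteTo G L) (hL' : Dominating G' L) (hx : IsPerron G ρ x) (hy : IsPerron G' ρ' y)
    (hne : L.Nonempty) (hρ' : 0 < ρ') (hkρ : (L.card : ℝ) ≤ ρ')
    (hD0 : 0 ≤ D) (hE : 0 ≤ E) (hD : ∀ v ∉ L, offDeg G L v ≤ D)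
    (hxL : ∀ l ∈ L, 1 / 2 ≤ x l)
    (hM : pairs G L L + 1 ≤ L.card * (L.card - 1))
    (hW : pairs G Lᶜ Lᶜ + pairs G L L ≤ pairs G' Lᶜ Lᶜ + L.card * (L.card - 1))
    (hX : pairs G' Lᶜ Lᶜ ≤ E * ρ ^ 2)
    (hbig : 4 * (L.card : ℝ) ^ 2 * (D * E + 1) + 2 * D + 1 < ρ) : ρ < ρ' := by
  by_contra hcon
  have hle : ρ' ≤ ρ := not_lt.1 hcon
  have hρ : 0 < ρ := hρ'.trans_le hle
  have hk1 : (1 : ℝ) ≤ (L.card : ℝ) := by exact_mod_cast hne.card_pos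
  have hxdeg := hL.sum_pos hx hD
  have hofx := fun v (hv : v ∉ L) => hL.off_le hx hD
    (by have : 0 ≤ 4 * (L.card : ℝ) ^ 2 * (D * E + 1) := by positivity
        linarith) hv
  set k : ℝ := (L.card : ℝ) with hk
  have hbig0 : 0 ≤ 4 * k ^ 2 * (D * E + 1) := by positivity
  have hDρ : 2 * D < ρ := by linarith
  have hρ1 : 1 < ρ := by linarith
  replace hxdeg := hxdeg (by linarith)
  set r : ℝ := (Lᶜ.card : ℝ) with hr
  set τ := ∑ l ∈ L, x l with hτ
  have hτk : τ ≤ k := by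
    calc τ ≤ ∑ l ∈ L, (1 : ℝ) := Finset.sum_le_sum fun l _ => hx.le_one l
      _ = k := by simp [hk]
  set WY := pairs G Lᶜ Lᶜ with hWY
  set WX := pairs G' Lᶜ Lᶜ with hWX
  have hWX0 : 0 ≤ WX := pairs_nonneg _ _
  set M := k * (k - 1) - pairs G L L with hMdef
  -- the equations for `G`
  have a1 : ρ * τ ≤ (k - 1) * τ - M / 2 + k * ∑ u ∈ Lᶜ, x u := by
    have b1 : ρ * τ = ∑ l ∈ L, ∑ m ∈ L, adjInd G l m * x m + k * ∑ u ∈ Lᶜ, x u := by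
      rw [hτ, Finset.mul_sum, Finset.sum_congr rfl fun l hl => (hL.eig_on hx hl).symm,
        Finset.sum_add_distrib]
      simp [hk]
    have b2 : ∑ l ∈ L, ∑ m ∈ L, adjInd G l m * x m
        = (k - 1) * τ - ∑ m ∈ L, ((k - 1) - ∑ l ∈ L, adjInd G l m) * x m := by
      rw [Finset.sum_comm, hτ, Finset.mul_sum, ← Finset.sum_sub_distrib]
      refine Finset.sum_congr rfl fun m _ => ?_
      rw [← Finset.sum_mul]; ring
    have b3 : M / 2 ≤ ∑ m ∈ L, ((k - 1) - ∑ l ∈ L, adjInd G l m) * x m := by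
      have b4 : ∀ m ∈ L, ∑ l ∈ L, adjInd G l m ≤ k - 1 := by
        intro m hm
        rw [← Finset.sum_erase_add _ _ hm, adjInd_self, add_zero]
        calc _ ≤ ∑ l ∈ L.erase m, (1 : ℝ) := Finset.sum_le_sum fun l _ => adjInd_le_one _ _ _
          _ = k - 1 := by
            rw [Finset.sum_const, nsmul_eq_mul, mul_one, Finset.card_erase_of_mem hm,
              Nat.cast_sub (Finset.card_pos.2 ⟨m, hm⟩), hk]
            simp
      have b5 : M / 2 = ∑ m ∈ L, ((k - 1) - ∑ l ∈ L, adjInd G l m) * (1 / 2) := by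
        rw [← Finset.sum_mul, Finset.sum_sub_distrib, ← Finset.sum_comm]
        simp only [Finset.sum_const, nsmul_eq_mul]
        rw [hMdef, pairs, hk]; ring
      rw [b5]
      exact Finset.sum_le_sum fun m hm =>
        mul_le_mul_of_nonneg_left (hxL m hm) (by linarith [b4 m hm])
    linarith
  have a2 : ρ * ∑ u ∈ Lᶜ, x u ≤ τ * r + WY * τ / (ρ - D) := by
    have b1 := hL.sum_off_mul hx (fun _ => 1)
    rw [offOp_one] at b1
    simp only [one_mul, Finset.sum_const, nsmul_eq_mul, mul_one] at b1
    rw [b1]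
    have b2 : ∑ u ∈ Lᶜ, offDeg G L u * x u ≤ ∑ u ∈ Lᶜ, offDeg G L u * (τ / (ρ - D)) := by
      refine Finset.sum_le_sum fun u hu => mul_le_mul_of_nonneg_left ?_ (offDeg_nonneg u)
      rw [le_div_iff₀ (by linarith), mul_comm]
      exact hofx u (Finset.mem_compl.1 hu)
    rw [← Finset.sum_mul, sum_offDeg] at b2
    rw [mul_div_assoc]
    linarith
  -- The weight off `L` is eliminated and τ divided out; τ ≤ k turns the loss M/2 into M/(2k) per
  -- unit of τ.
  have a3 : ρ ^ 2 ≤ ρ * (k - 1) - ρ * M / (2 * k) + k * r + k * WY / (ρ - D) := by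
    have b1 : ρ ^ 2 * τ ≤ (ρ * (k - 1) + k * r + k * WY / (ρ - D)) * τ - ρ * M / 2 := by
      have b2 := mul_le_mul_of_nonneg_left a1 hρ.le
      have b3 := mul_le_mul_of_nonneg_left a2 (by linarith : 0 ≤ k)
      have e1 : k * (τ * r + WY * τ / (ρ - D)) = (k * r + k * WY / (ρ - D)) * τ := by ring
      rw [e1] at b3
      linarith
    have b4 : ρ * M / (2 * k) * τ ≤ ρ * M / 2 := by
      have e : ρ * M / (2 * k) * τ = ρ * M / 2 * (τ / k) := by field_simp
      rw [e]
      exact mul_le_of_le_one_right (by have : 0 ≤ M := by linarith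
                                       positivity) ((div_le_one (by linarith)).2 hτk)
    have b5 : ρ ^ 2 * τ
        ≤ (ρ * (k - 1) - ρ * M / (2 * k) + k * r + k * WY / (ρ - D)) * τ := by linarith
    exact le_of_mul_le_mul_right b5 hxdeg
  -- the equations for `G'`
  have hτ' : ∑ l ∈ L, y l = k := by
    rw [Finset.sum_congr rfl fun l hl => hL'.eq_one hy hρ'.le hl]; simp [hk]
  have a4 : ρ' * (k - 1) + k * r + k * WX / ρ' ≤ ρ' ^ 2 := by
    have b1 := hL'.completeTo.sum_off_mul hy (fun _ => 1)
    rw [offOp_one] at b1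
    simp only [one_mul, Finset.sum_const, nsmul_eq_mul, mul_one] at b1
    rw [hτ', ← hL'.rho_eq hy hρ'.le hne] at b1
    have b2 : ∑ u ∈ Lᶜ, offDeg G' L u * (k / ρ') ≤ ∑ u ∈ Lᶜ, offDeg G' L u * y u := by
      refine Finset.sum_le_sum fun u hu => mul_le_mul_of_nonneg_left ?_ (offDeg_nonneg u)
      rw [div_le_iff₀ hρ', mul_comm, ← hτ']
      exact hL'.completeTo.sum_le_off hy (Finset.mem_compl.1 hu)
    rw [← Finset.sum_mul, sum_offDeg] at b2
    have e : k * WX / ρ' = WX * (k / ρ') := by ring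
    rw [e]
    linarith
  -- The function t² - (k-1)t does not decrease from ρ' to ρ because ρ + ρ' ≥ k - 1.
  have a5 : ρ' ^ 2 - ρ' * (k - 1) ≤ ρ ^ 2 - ρ * (k - 1) := by
    have := mul_nonneg (sub_nonneg.2 hle) (by linarith : 0 ≤ ρ + ρ' - (k - 1))
    linarith
  have a6 : k * WX / ρ ≤ k * WX / ρ' := by gcongr
  have a7 : k * WY / (ρ - D) ≤ k * (WX + M) / (ρ - D) := by
    have : 0 < ρ - D := by linarith
    gcongr
    linarith
  have a8 : k * (WX + M) / (ρ - D) ≤ k * WX / ρ + 2 * k * D * E + 2 * k * M := by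
    have hpos : 0 < ρ - D := by linarith
    have hhalf : ρ / 2 ≤ ρ - D := by linarith
    have b1 : k * WX / (ρ - D) ≤ k * WX / ρ + 2 * k * D * E := by
      have e : k * WX / (ρ - D) = k * WX / ρ + k * D * (WX / (ρ * (ρ - D))) := by
        field_simp; ring
      rw [e]
      have b2 : WX / (ρ * (ρ - D)) ≤ 2 * E := by
        rw [div_le_iff₀ (by positivity)]
        calc WX ≤ E * ρ ^ 2 := hX
          _ = 2 * E * (ρ * (ρ / 2)) := by ring
          _ ≤ _ := by gcongr
      have b3 : k * D * (WX / (ρ * (ρ - D))) ≤ k * D * (2 * E) := by gcongr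
      linarith
    have b4 : k * M / (ρ - D) ≤ 2 * k * M := by
      rw [div_le_iff₀ hpos]
      have : 0 ≤ M := by linarith
      have h5 : 1 ≤ 2 * (ρ - D) := by linarith
      have h6 := le_mul_of_one_le_right (by positivity : 0 ≤ k * M) h5
      linarith
    have e : k * (WX + M) / (ρ - D) = k * WX / (ρ - D) + k * M / (ρ - D) := by ring
    rw [e]; linarith
  -- The loss grows with ρ, the possible gain does not; with M ≥ 1 this fails for large ρ.
  have a9 : ρ * M / (2 * k) ≤ 2 * k * D * E + 2 * k * M := by linarith
  rw [div_le_iff₀ (by positivity)] at a9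
  have hM1 : 1 ≤ M := by linarith
  have a10 : (4 * k ^ 2 * (D * E + 1)) * M < ρ * M :=
    mul_lt_mul_of_pos_right (by linarith) (by linarith)
  have a11 : 4 * k ^ 2 * (D * E) ≤ 4 * k ^ 2 * (D * E) * M :=
    le_mul_of_one_le_right (by positivity) hM1
  linarith

end Moments

/-! ### Edge bounds for connected graphs and their hereditary form -/

section Transport

lemma FamilyFree.of_isContained {𝓕 : GraphFamily} {V W : Type} {G : SimpleGraph V}
    {G' : SimpleGraph W} (h : FamilyFree 𝓕 G) (h' : G'.IsContained G) : FamilyFree 𝓕 G' :=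
  fun F hF hc => h F hF (hc.trans h')

lemma FamilyFree.not_isContained {𝓕 : GraphFamily} {V W : Type} {G : SimpleGraph V}
    {G' : SimpleGraph W} (h : FamilyFree 𝓕 G) (h' : ¬ FamilyFree 𝓕 G') : ¬ G'.IsContained G :=
  fun hc => h' (h.of_isContained hc)

lemma adjInd_eq_of_iff {V W : Type} {G : SimpleGraph V} {G' : SimpleGraph W} {u v : V} {u' v' : W}
    (h : G.Adj u v ↔ G'.Adj u' v') : adjInd G u v = adjInd G' u' v' := by
  by_cases h1 : G.Adj u v
  · rw [adjInd_of_adj _ h1, adjInd_of_adj _ (h.1 h1)]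
  · rw [adjInd_of_not_adj _ h1, adjInd_of_not_adj _ fun h2 => h1 (h.2 h2)]

lemma pairs_univ_iso {V W : Type} [Fintype V] [Fintype W] {G : SimpleGraph V} {G' : SimpleGraph W}
    (e : G ≃g G') : pairs G Finset.univ Finset.univ = pairs G' Finset.univ Finset.univ := by
  unfold pairs
  rw [← Equiv.sum_comp e.toEquiv]
  refine Finset.sum_congr rfl fun u _ => ?_
  rw [← Equiv.sum_comp e.toEquiv]
  exact Finset.sum_congr rfl fun v _ => adjInd_eq_of_iff e.map_rel_iff.symm

lemma pairs_induce {V : Type} (G : SimpleGraph V) (S : Finset V) :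
    pairs (G.induce (S : Set V)) (Finset.univ : Finset (S : Set V)) Finset.univ = pairs G S S := by
  unfold pairs
  rw [← Finset.sum_coe_sort S]
  refine Finset.sum_congr rfl fun u _ => ?_
  rw [← Finset.sum_coe_sort S]
  exact Finset.sum_congr rfl fun v _ => adjInd_eq_of_iff (by simp)

lemma two_mul_ncard_edgeSet {n : ℕ} (G : SimpleGraph (Fin n)) :
    2 * (G.edgeSet.ncard : ℝ) = pairs G Finset.univ Finset.univ := by
  classical
  have h := G.sum_degrees_eq_twice_card_edges
  have h1 : G.edgeSet.ncard = G.edgeFinset.card := by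
    rw [← SimpleGraph.coe_edgeFinset, Set.ncard_coe_finset]
  have h2 : ∀ v, (G.degree v : ℝ) = ∑ u, adjInd G v u := by
    intro v
    have : ∑ u, adjInd G v u = degR G v := rfl
    rw [this, degR_eq_card, nbrs, ← SimpleGraph.card_neighborFinset_eq_degree,
      SimpleGraph.neighborFinset_eq_filter]
  rw [h1, pairs, ← Finset.sum_congr rfl fun v _ => h2 v]
  exact_mod_cast h.symm

/-- Every connected `𝓕`-free graph on `n ≥ n₀` vertices has at most `h n` ordered adjacent
pairs. -/
def ConnBound (𝓕 : GraphFamily) (h : ℕ → ℝ) (n₀ : ℕ) : Prop :=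
  ∀ n, n₀ ≤ n → ∀ G : SimpleGraph (Fin n), G.Connected → FamilyFree 𝓕 G →
    pairs G Finset.univ Finset.univ ≤ h n

variable {𝓕 : GraphFamily} {h : ℕ → ℝ} {n₀ : ℕ}

lemma ConnBound.le_card (hb : ConnBound 𝓕 h n₀) {V : Type} [Fintype V] {G : SimpleGraph V}
    (hV : n₀ ≤ Fintype.card V) (hc : G.Connected) (hG : FamilyFree 𝓕 G) :
    pairs G Finset.univ Finset.univ ≤ h (Fintype.card V) := by
  have e := SimpleGraph.overFinIso G (rfl : Fintype.card V = Fintype.card V)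
  rw [pairs_univ_iso e]
  exact hb _ hV _ (e.connected_iff.1 hc) (hG.of_isContained e.isContained')

lemma ConnBound.le_card_induce (hb : ConnBound 𝓕 h n₀) {V : Type} {G : SimpleGraph V}
    (hG : FamilyFree 𝓕 G) (S : Finset V) (hS : n₀ ≤ S.card)
    (hc : (G.induce (S : Set V)).Connected) : pairs G S S ≤ h S.card := by
  have hcard : Fintype.card (S : Set V) = S.card := by simp
  rw [← pairs_induce, ← hcard]
  exact hb.le_card (by rw [hcard]; exact hS) hc
    (hG.of_isContained (SimpleGraph.Copy.induce G _).isContained)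

lemma pairs_le_sq {V : Type} (G : SimpleGraph V) (S T : Finset V) :
    pairs G S T ≤ S.card * T.card := by
  calc pairs G S T ≤ ∑ u ∈ S, ∑ v ∈ T, (1 : ℝ) :=
        Finset.sum_le_sum fun u _ => Finset.sum_le_sum fun v _ => adjInd_le_one _ _ _
    _ = _ := by simp

lemma pairs_eq_zero {V : Type} {G : SimpleGraph V} {S T : Finset V}
    (h : ∀ u ∈ S, ∀ v ∈ T, ¬ G.Adj u v) : pairs G S T = 0 :=
  Finset.sum_eq_zero fun u hu => Finset.sum_eq_zero fun v hv => adjInd_of_not_adj _ (h u hu v hv)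

/-- A linear bound for connected graphs gives hereditary linear sparsity. -/
lemma ConnBound.linSparse (hb : ConnBound 𝓕 h n₀) {c : ℝ} (hc : (n₀ : ℝ) ≤ c)
    (hh : ∀ n, n₀ ≤ n → h n ≤ c * n) {V : Type} {G : SimpleGraph V} (hG : FamilyFree 𝓕 G) :
    LinSparse G c := by
  classical
  intro S
  induction S using Finset.strongInduction with
  | H S ih =>
  rcases S.eq_empty_or_nonempty with rfl | ⟨u, hu⟩
  · simp [pairs]
  by_cases hconn : (G.induce (S : Set V)).Connected
  · by_cases hn : n₀ ≤ S.card
    · exact (hb.le_card_induce hG S hn hconn).trans (hh _ hn)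
    -- Sets smaller than n₀ need only the trivial bound |S|², since n₀ ≤ c.
    · refine (pairs_le_sq G S S).trans ?_
      have : (S.card : ℝ) ≤ c := le_trans (by exact_mod_cast (not_le.1 hn).le) hc
      gcongr
  · let u' : (S : Set V) := ⟨u, hu⟩
    -- `T` is the component of `u` inside `S`. No edge joins it to `S \ T`, so the bounds for the
    -- two parts add up.
    set T : Finset V := S.filter fun w => ∃ hw : w ∈ S,
      (G.induce (S : Set V)).Reachable u' ⟨w, hw⟩ with hT
    have hTS : T ⊆ S := Finset.filter_subset _ _
    have huT : u ∈ T := Finset.mem_filter.2 ⟨hu, hu, SimpleGraph.Reachable.refl _⟩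
    have hne : T ≠ S := by
      intro hTS'
      apply hconn
      rw [SimpleGraph.connected_iff_exists_forall_reachable]
      refine ⟨u', fun ⟨w, hw⟩ => ?_⟩
      have hw' : w ∈ T := by rw [hTS']; exact hw
      exact (Finset.mem_filter.1 hw').2.2
    have hcross : ∀ a ∈ T, ∀ b ∈ S \ T, ¬ G.Adj a b := by
      intro a ha b hb' hab
      obtain ⟨haS, _, hr⟩ := Finset.mem_filter.1 ha
      obtain ⟨hbS, hbT⟩ := Finset.mem_sdiff.1 hb'
      refine hbT (Finset.mem_filter.2 ⟨hbS, hbS, hr.trans (SimpleGraph.Adj.reachable ?_)⟩)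
      exact hab
    have h1 := ih T (Finset.ssubset_iff_subset_ne.2 ⟨hTS, hne⟩)
    have h2 := ih (S \ T) (Finset.sdiff_ssubset hTS ⟨u, huT⟩)
    have hdis : Disjoint T (S \ T) := Finset.disjoint_sdiff
    have hun : S = T ∪ (S \ T) := (Finset.union_sdiff_of_subset hTS).symm
    have e : pairs G S S = pairs G T T + pairs G (S \ T) (S \ T) := by
      have z : pairs G T (S \ T) = 0 := pairs_eq_zero hcross
      conv_lhs => rw [hun]
      rw [pairs_union_left hdis, pairs_comm T, pairs_comm (S \ T), pairs_union_left hdis,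
        pairs_union_left hdis, pairs_comm (S \ T) T, z]
      ring
    have hcard : (S.card : ℝ) = T.card + (S \ T).card := by
      rw [← Nat.cast_add, ← Finset.card_union_of_disjoint hdis, ← hun]
    rw [e, hcard, mul_add]
    exact add_le_add h1 h2

end Transport

/-! ### Joins with a clique -/

section Join

variable {W : Type} {X : SimpleGraph W} {k : ℕ}

lemma cliqueJoin_adj_inl_inl {a b : Fin k} :
    (cliqueJoin k X).Adj (Sum.inl a) (Sum.inl b) ↔ a ≠ b := by
  simp [cliqueJoin, graphJoin]

lemma cliqueJoin_adj_inl_inr {a : Fin k} {b : W} :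
    (cliqueJoin k X).Adj (Sum.inl a) (Sum.inr b) := by
  simp [cliqueJoin, graphJoin]

lemma cliqueJoin_adj_inr_inl {a : Fin k} {b : W} :
    (cliqueJoin k X).Adj (Sum.inr b) (Sum.inl a) := by
  simp [cliqueJoin, graphJoin]

lemma cliqueJoin_adj_inr_inr {a b : W} :
    (cliqueJoin k X).Adj (Sum.inr a) (Sum.inr b) ↔ X.Adj a b := by
  simp [cliqueJoin, graphJoin]

lemma cliqueJoin_adj_inl {a : Fin k} {v : Fin k ⊕ W} (h : v ≠ Sum.inl a) :
    (cliqueJoin k X).Adj (Sum.inl a) v := by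
  rcases v with b | b
  · exact cliqueJoin_adj_inl_inl.2 fun e => h (by rw [e])
  · exact cliqueJoin_adj_inl_inr

lemma connected_of_adj_all {V : Type} {G : SimpleGraph V} {a : V} (h : ∀ v, v ≠ a → G.Adj a v) :
    G.Connected := by
  rw [SimpleGraph.connected_iff_exists_forall_reachable]
  refine ⟨a, fun v => ?_⟩
  by_cases hv : v = a
  · rw [hv]
  · exact (h v hv).reachable

lemma cliqueJoin_connected (hk : 1 ≤ k) : (cliqueJoin k X).Connected :=
  connected_of_adj_all (a := Sum.inl ⟨0, hk⟩) fun _ hv => cliqueJoin_adj_inl hv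

lemma pairs_cliqueJoin [Fintype W] :
    pairs (cliqueJoin k X) Finset.univ Finset.univ
      = k * (k - 1) + 2 * k * Fintype.card W + pairs X Finset.univ Finset.univ := by
  classical
  unfold pairs
  simp only [Fintype.sum_sum_type, Finset.sum_add_distrib]
  have h1 : ∀ a : Fin k, ∑ b : Fin k, adjInd (cliqueJoin k X) (Sum.inl a) (Sum.inl b)
      = (k : ℝ) - 1 := by
    intro a
    have : ∀ b : Fin k, adjInd (cliqueJoin k X) (Sum.inl a) (Sum.inl b)
        = 1 - if a = b then (1 : ℝ) else 0 := by
      intro b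
      by_cases hab : a = b
      · rw [adjInd_of_not_adj _ (by rw [cliqueJoin_adj_inl_inl]; simpa using hab)]; simp [hab]
      · rw [adjInd_of_adj _ (cliqueJoin_adj_inl_inl.2 hab)]; simp [hab]
    simp [this]
  have h2 : ∀ (a : Fin k) (b : W), adjInd (cliqueJoin k X) (Sum.inl a) (Sum.inr b) = 1 :=
    fun a b => adjInd_of_adj _ cliqueJoin_adj_inl_inr
  have h3 : ∀ (a : Fin k) (b : W), adjInd (cliqueJoin k X) (Sum.inr b) (Sum.inl a) = 1 :=
    fun a b => adjInd_of_adj _ cliqueJoin_adj_inr_inl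
  have h4 : ∀ a b : W, adjInd (cliqueJoin k X) (Sum.inr a) (Sum.inr b) = adjInd X a b :=
    fun a b => adjInd_eq_of_iff cliqueJoin_adj_inr_inr
  simp only [h1, h2, h3, h4]
  simp
  ring

end Join

/-! ### An excluded complete bipartite graph -/

section Bipartite

/-- If the edge bound is below that of `K_{k+1,m}`, some `K_{k+1,s}` is not `𝓕`-free. -/
lemma ConnBound.exists_not_free_bipartite {𝓕 : GraphFamily} {h : ℕ → ℝ} {n₀ k : ℕ} {Q C : ℝ}
    (hb : ConnBound 𝓕 h n₀) (hQ : Q < 1) (hh : ∀ n : ℕ, n₀ ≤ n → h n ≤ 2 * (k + Q) * n + C) :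
    ∃ s : ℕ, 1 ≤ s ∧ ¬ FamilyFree 𝓕 (completeBipartiteGraph (Fin (k + 1)) (Fin s)) := by
  by_contra hcon
  push Not at hcon
  -- The connected graph K_{k+1,s} has about k+1 edges per vertex, whereas the bound allows only
  -- k+Q, so large s is impossible.
  have key : ∀ s : ℕ, n₀ + 1 ≤ s →
      2 * ((k : ℝ) + 1) * s ≤ 2 * (k + Q) * ((k + 1) + s) + C := by
    intro s hs
    have hcard : Fintype.card (Fin (k + 1) ⊕ Fin s) = k + 1 + s := by simp
    have hconn : (completeBipartiteGraph (Fin (k + 1)) (Fin s)).Connected := by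
      rw [SimpleGraph.connected_iff_exists_forall_reachable]
      have h1 : ∀ b : Fin s, (completeBipartiteGraph (Fin (k + 1)) (Fin s)).Reachable
          (Sum.inl 0) (Sum.inr b) := fun b => SimpleGraph.Adj.reachable (by simp)
      refine ⟨Sum.inl 0, fun v => ?_⟩
      rcases v with a | b
      · refine (h1 ⟨0, by omega⟩).trans (SimpleGraph.Adj.reachable (by simp))
      · exact h1 b
    have h1 := hb.le_card (by rw [hcard]; omega) hconn (hcon s (by omega))
    have h2 : pairs (completeBipartiteGraph (Fin (k + 1)) (Fin s)) Finset.univ Finset.univ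
        = 2 * ((k : ℝ) + 1) * s := by
      unfold pairs
      simp only [Fintype.sum_sum_type, Finset.sum_add_distrib]
      simp [adjInd]
      ring
    rw [h2, hcard] at h1
    have h3 := h1.trans (hh _ (by omega))
    push_cast at h3
    exact h3
  obtain ⟨s, hs⟩ := exists_nat_gt ((2 * (k + Q) * (k + 1) + C) / (2 * (1 - Q)))
  have h1 := key (max s (n₀ + 1)) (le_max_right _ _)
  have h2 : (s : ℝ) ≤ ((max s (n₀ + 1) : ℕ) : ℝ) := by exact_mod_cast le_max_left _ _
  rw [div_lt_iff₀ (by linarith)] at hs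
  have h3 : (s : ℝ) * (2 * (1 - Q)) ≤ ((max s (n₀ + 1) : ℕ) : ℝ) * (2 * (1 - Q)) := by
    gcongr
  linarith

lemma FamilyFree.fewCommon {𝓕 : GraphFamily} {j s : ℕ} {V : Type} [Fintype V] {G : SimpleGraph V}
    (hG : FamilyFree 𝓕 G) (hs : ¬ FamilyFree 𝓕 (completeBipartiteGraph (Fin j) (Fin s))) :
    FewCommon G j s := by
  intro T hT
  by_contra hcon
  apply hG.not_isContained hs
  obtain ⟨S, hS, hScard⟩ := Finset.exists_subset_card_eq (not_lt.1 hcon)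
  let f := (Finset.equivFinOfCardEq hT).symm
  let g := (Finset.equivFinOfCardEq hScard).symm
  have hadj : ∀ a b, G.Adj (f a) (g b) := fun a b =>
    mem_commonNbrs.1 (hS (g b).2) _ (f a).2
  refine ⟨⟨⟨Sum.elim (fun a => (f a : V)) (fun b => (g b : V)), ?_⟩, ?_⟩⟩
  · intro u v huv
    rcases u with a | a <;> rcases v with b | b
    · simp at huv
    · exact hadj a b
    · exact (hadj b a).symm
    · simp at huv
  · intro u v huv
    rcases u with a | a <;> rcases v with b | b
    · simp only [RelHom.coeFn_mk, Sum.elim_inl] at huv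
      rw [f.injective (Subtype.ext huv)]
    · exact absurd huv (hadj a b).ne
    · exact absurd huv.symm (hadj b a).ne
    · simp only [RelHom.coeFn_mk, Sum.elim_inr] at huv
      rw [g.injective (Subtype.ext huv)]

end Bipartite

/-! ### Tilings and packings by small patterns -/

/-- Disjoint copies of `T`, filling up `r` vertices. -/
def tile {m : ℕ} [NeZero m] (T : SimpleGraph (Fin m)) (r : ℕ) : SimpleGraph (Fin r) :=
  (disjointCopies ℕ T).comap fun a => ((a : ℕ) / m, Fin.ofNat m a)

section Tile

variable {m : ℕ} [NeZero m] {T : SimpleGraph (Fin m)} {r : ℕ}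

lemma tile_adj {a b : Fin r} : (tile T r).Adj a b ↔
    (a : ℕ) / m = (b : ℕ) / m ∧ T.Adj (Fin.ofNat m a) (Fin.ofNat m b) := Iff.rfl

lemma sum_comp_le {α β : Type} [Fintype α] [Fintype β] {g : α → β} (hg : Function.Injective g)
    {f : β → ℝ} (hf : ∀ b, 0 ≤ f b) : ∑ a, f (g a) ≤ ∑ b, f b := by
  have : ∑ a, f (g a) = ∑ b ∈ Finset.univ.map ⟨g, hg⟩, f b := by simp
  rw [this]
  exact Finset.sum_le_sum_of_subset_of_nonneg (Finset.subset_univ _) fun b _ _ => hf b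

/-- Only complete tiles are counted; the last, truncated one may add further pairs. -/
lemma le_pairs_tile : ((r / m : ℕ) : ℝ) * pairs T Finset.univ Finset.univ
    ≤ pairs (tile T r) Finset.univ Finset.univ := by
  have hm : 0 < m := Nat.pos_of_ne_zero (NeZero.ne m)
  have hlt : ∀ (q : Fin (r / m)) (i : Fin m), (i : ℕ) + m * q < r := by
    intro q i
    have h1 : m * (q + 1) ≤ m * (r / m) := Nat.mul_le_mul_left _ q.2
    have h2 := Nat.mul_div_le r m
    have := i.2
    rw [mul_add, mul_one] at h1
    omega
  let φ : Fin (r / m) × Fin m → Fin r := fun p => ⟨p.2 + m * p.1, hlt p.1 p.2⟩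
  have hdiv : ∀ p, ((φ p : Fin r) : ℕ) / m = p.1 := fun p => by
    simp only [φ]
    rw [Nat.add_mul_div_left _ _ hm, Nat.div_eq_of_lt p.2.2, zero_add]
  have hmod : ∀ p, Fin.ofNat m ((φ p : Fin r) : ℕ) = p.2 := fun p => by
    ext
    simp only [φ, Fin.val_ofNat]
    rw [Nat.add_mul_mod_self_left, Nat.mod_eq_of_lt p.2.2]
  have hφ : Function.Injective φ := by
    intro p p' h
    refine Prod.ext (Fin.ext ?_) ?_
    · rw [← hdiv p, ← hdiv p', h]
    · rw [← hmod p, ← hmod p', h]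
  have h1 : ∑ p, ∑ b, adjInd (tile T r) (φ p) b ≤ pairs (tile T r) Finset.univ Finset.univ :=
    sum_comp_le (f := fun a => ∑ b, adjInd (tile T r) a b) hφ fun a =>
      Finset.sum_nonneg fun b _ => adjInd_nonneg _ _ _
  refine le_trans ?_ h1
  rw [Fintype.sum_prod_type]
  have h2 : ∀ q : Fin (r / m), pairs T Finset.univ Finset.univ
      ≤ ∑ i, ∑ b, adjInd (tile T r) (φ (q, i)) b := by
    intro q
    refine Finset.sum_le_sum fun i _ => ?_
    have hinj : Function.Injective fun j => φ (q, j) := fun j j' h =>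
      (Prod.ext_iff.1 (hφ h)).2
    refine le_trans (le_of_eq (Finset.sum_congr rfl fun j _ => ?_))
      (sum_comp_le hinj fun b => adjInd_nonneg (tile T r) (φ (q, i)) b)
    refine adjInd_eq_of_iff ?_
    rw [tile_adj, hdiv, hdiv, hmod, hmod]
    simp
  calc ((r / m : ℕ) : ℝ) * pairs T Finset.univ Finset.univ
      = ∑ q : Fin (r / m), pairs T Finset.univ Finset.univ := by simp
    _ ≤ _ := Finset.sum_le_sum fun q _ => h2 q

end Tile

section Packing

variable {V : Type} [Fintype V] [DecidableEq V] {G : SimpleGraph V} {L : Finset V}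

/-- A copy of `T` off `L`, rooted at `v`. -/
def RootedCopy (G : SimpleGraph V) (L : Finset V) {m : ℕ} [NeZero m] (T : SimpleGraph (Fin m))
    (v : V) (f : Fin m → V) : Prop :=
  f 0 = v ∧ Function.Injective f ∧ (∀ i, f i ∉ L) ∧ ∀ i j, T.Adj i j → G.Adj (f i) (f j)

/-- The vertices off `L` adjacent to `v`. -/
noncomputable def offNbrs (G : SimpleGraph V) (L : Finset V) (v : V) : Finset V := nbrs G v \ L

lemma mem_offNbrs {u v : V} : u ∈ offNbrs G L v ↔ G.Adj v u ∧ u ∉ L := by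
  simp [offNbrs, mem_nbrs]

lemma offOp_eq_sum (f : V → ℝ) (v : V) : offOp G L f v = ∑ u ∈ offNbrs G L v, f u := by
  have h0 : offNbrs G L v = Lᶜ.filter (· ∈ nbrs G v) := by
    ext u; simp [mem_offNbrs, mem_nbrs, and_comm]
  rw [h0, offOp, Finset.sum_filter (· ∈ nbrs G v)]
  refine Finset.sum_congr rfl fun u _ => ?_
  by_cases h : G.Adj v u <;> simp [adjInd, h, mem_nbrs]

lemma offDeg_eq_card (v : V) : offDeg G L v = ((offNbrs G L v).card : ℝ) := by
  rw [← offOp_one, offOp_eq_sum]; simp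

/-- A pairwise disjoint subfamily of largest size meets every nonempty member, which could otherwise
be added. -/
lemma exists_disjoint_subfamily (S : Finset V) (C : V → Finset V) :
    ∃ I ⊆ S, (∀ i ∈ I, ∀ j ∈ I, i ≠ j → Disjoint (C i) (C j)) ∧
      ∀ v ∈ S, (C v).Nonempty → ∃ i ∈ I, ¬ Disjoint (C i) (C v) := by
  classical
  set P := S.powerset.filter fun I => ∀ i ∈ I, ∀ j ∈ I, i ≠ j → Disjoint (C i) (C j) with hP
  obtain ⟨I, hI, hmax⟩ := Finset.exists_max_image P Finset.card ⟨∅, by simp [hP]⟩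
  obtain ⟨hIS, hdis⟩ := Finset.mem_filter.1 hI
  rw [Finset.mem_powerset] at hIS
  refine ⟨I, hIS, hdis, fun v hv hne => ?_⟩
  by_contra hcon
  push Not at hcon
  have hvI : v ∉ I := by
    intro h
    have := hcon v h
    rw [disjoint_self] at this
    exact hne.ne_empty this
  have hmem : insert v I ∈ P := by
    refine Finset.mem_filter.2 ⟨Finset.mem_powerset.2 (Finset.insert_subset hv hIS), ?_⟩
    intro i hi j hj hij
    rcases Finset.mem_insert.1 hi with h1 | hi <;> rcases Finset.mem_insert.1 hj with h2 | hj
    · exact absurd (h1.trans h2.symm) hij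
    · rw [h1]; exact (hcon j hj).symm
    · rw [h2]; exact hcon i hi
    · exact hdis i hi j hj hij
  have := hmax _ hmem
  rw [Finset.card_insert_of_notMem hvI] at this
  omega

/-- If `K_k` joined to many copies of `T` is forbidden, and off-degrees are bounded, then only
boundedly many vertices off `L` are roots of copies of `T`. -/
lemma card_roots_le {𝓕 : GraphFamily} {m r D : ℕ} [NeZero m] {T : SimpleGraph (Fin m)}
    (hG : FamilyFree 𝓕 G) (hL : Dominating G L)
    (hT : ¬ FamilyFree 𝓕 (cliqueJoin L.card (tile T r)))
    (hD : ∀ v ∉ L, (offNbrs G L v).card ≤ D)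
    (hrad : ∀ i, i = 0 ∨ T.Adj i 0 ∨ ∃ j, T.Adj i j ∧ T.Adj j 0)
    (S : Finset V) (hS : ∀ v ∈ S, ∃ f, RootedCopy G L T v f) :
    S.card ≤ r * (m * (1 + D + D * D)) := by
  classical
  choose! f hf using hS
  -- Every rooted copy meets one of the selected disjoint copies, and by `hrad` its root is within
  -- distance two, off `L`, of the meeting vertex. Balls of radius two around the used vertices
  -- therefore contain all roots.
  obtain ⟨I, hIS, hdis, hmax⟩ := exists_disjoint_subfamily S fun v => Finset.univ.image (f v)
  set ball : V → Finset V := fun u =>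
    ({u} ∪ offNbrs G L u) ∪ (offNbrs G L u).biUnion (offNbrs G L) with hball
  have hballcard : ∀ u ∉ L, (ball u).card ≤ 1 + D + D * D := by
    intro u hu
    refine (Finset.card_union_le _ _).trans (Nat.add_le_add ?_ ?_)
    · refine (Finset.card_union_le _ _).trans (Nat.add_le_add (by simp) (hD u hu))
    · refine (Finset.card_biUnion_le_card_mul _ _ D fun w hw =>
        hD w (mem_offNbrs.1 hw).2).trans (Nat.mul_le_mul_right _ (hD u hu))
  have hsub : S ⊆ I.biUnion fun i => (Finset.univ.image (f i)).biUnion ball := by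
    intro v hv
    obtain ⟨h0, hinj, hoff, hadj⟩ := hf v hv
    obtain ⟨i, hi, hnd⟩ := hmax v hv ⟨f v 0, Finset.mem_image_of_mem _ (Finset.mem_univ _)⟩
    rw [Finset.not_disjoint_iff] at hnd
    obtain ⟨u, hu1, hu2⟩ := hnd
    refine Finset.mem_biUnion.2 ⟨i, hi, Finset.mem_biUnion.2 ⟨u, hu1, ?_⟩⟩
    obtain ⟨a, -, rfl⟩ := Finset.mem_image.1 hu2
    simp only [hball, Finset.mem_union, Finset.mem_singleton, Finset.mem_biUnion, mem_offNbrs]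
    have hvL : v ∉ L := h0 ▸ hoff 0
    have hadj0 : ∀ j, T.Adj j 0 → G.Adj (f v j) v := fun j hj => by
      have := hadj j 0 hj
      rwa [h0] at this
    rcases hrad a with rfl | h | ⟨j, h1, h2⟩
    · exact Or.inl (Or.inl h0.symm)
    · exact Or.inl (Or.inr ⟨hadj0 _ h, hvL⟩)
    · exact Or.inr ⟨f v j, ⟨hadj _ _ h1, hoff j⟩, hadj0 _ h2, hvL⟩
  -- With r disjoint copies, more than enough, K_k joined to `tile T r` embeds: the clique goes to
  -- `L` and the vertex a of the tiling to the copy of index a / m.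
  have hI : I.card ≤ r := by
    by_contra hcon
    apply hG.not_isContained hT
    obtain ⟨J, hJI, hJ⟩ := Finset.exists_subset_card_eq (not_le.1 hcon).le
    let g := (Finset.equivFinOfCardEq hJ).symm
    let e := L.equivFin.symm
    let φ : Fin r → V := fun a => f (g ⟨(a : ℕ) / m, (Nat.div_le_self _ _).trans_lt a.2⟩)
      (Fin.ofNat m a)
    have hgS : ∀ q, ((g q : V)) ∈ S := fun q => hIS (hJI (g q).2)
    have hφL : ∀ a, φ a ∉ L := fun a => (hf _ (hgS _)).2.2.1 _
    have hφ : Function.Injective φ := by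
      intro a b hab
      have hq : (a : ℕ) / m = (b : ℕ) / m := by
        by_contra hne
        have hne' : (g ⟨(a : ℕ) / m, (Nat.div_le_self _ _).trans_lt a.2⟩ : V)
            ≠ g ⟨(b : ℕ) / m, (Nat.div_le_self _ _).trans_lt b.2⟩ := by
          intro h
          have := g.injective (Subtype.ext h)
          exact hne (Fin.mk.inj_iff.1 this)
        have := hdis _ (hJI (g _).2) _ (hJI (g _).2) hne'
        refine Finset.disjoint_left.1 this (Finset.mem_image_of_mem _ (Finset.mem_univ
          (Fin.ofNat m (a : ℕ)))) ?_
        exact Finset.mem_image.2 ⟨Fin.ofNat m (b : ℕ), Finset.mem_univ _, hab.symm⟩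
      have hab' : f (g ⟨(a : ℕ) / m, (Nat.div_le_self _ _).trans_lt a.2⟩) (Fin.ofNat m a)
          = f (g ⟨(a : ℕ) / m, (Nat.div_le_self _ _).trans_lt a.2⟩) (Fin.ofNat m b) := by
        have : (⟨(a : ℕ) / m, (Nat.div_le_self _ _).trans_lt a.2⟩ : Fin r)
          = ⟨(b : ℕ) / m, (Nat.div_le_self _ _).trans_lt b.2⟩ := Fin.ext hq
        conv_rhs => rw [this]
        exact hab
      have h2 := (hf _ (hgS _)).2.1 hab'
      have h3 : (a : ℕ) % m = (b : ℕ) % m := by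
        have := congrArg Fin.val h2
        simpa using this
      ext
      rw [← Nat.div_add_mod (a : ℕ) m, ← Nat.div_add_mod (b : ℕ) m, hq, h3]
    refine ⟨⟨⟨Sum.elim (fun a => (e a : V)) φ, ?_⟩, ?_⟩⟩
    · intro u v huv
      rcases u with a | a <;> rcases v with b | b
      · refine hL _ (e a).2 _ fun h => ?_
        exact cliqueJoin_adj_inl_inl.1 huv (e.injective (Subtype.ext h.symm))
      · exact hL.completeTo _ (e a).2 _ (hφL b)
      · exact (hL.completeTo _ (e b).2 _ (hφL a)).symm
      · obtain ⟨hq, hadj⟩ := tile_adj.1 (cliqueJoin_adj_inr_inr.1 huv)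
        have : (⟨(b : ℕ) / m, (Nat.div_le_self _ _).trans_lt b.2⟩ : Fin r)
          = ⟨(a : ℕ) / m, (Nat.div_le_self _ _).trans_lt a.2⟩ := Fin.ext hq.symm
        simp only [Sum.elim_inr, φ]
        rw [this]
        exact (hf _ (hgS _)).2.2.2 _ _ hadj
    · intro u v huv
      rcases u with a | a <;> rcases v with b | b
      · simp only [RelHom.coeFn_mk, Sum.elim_inl] at huv
        rw [e.injective (Subtype.ext huv)]
      · exact absurd ((show (e a : V) = φ b from huv) ▸ (e a).2) (hφL b)
      · exact absurd ((show φ a = (e b : V) from huv) ▸ (e b).2) (hφL a)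
      · rw [hφ (show φ a = φ b from huv)]
  calc S.card ≤ _ := Finset.card_le_card hsub
    _ ≤ I.card * (m * (1 + D + D * D)) := by
        refine Finset.card_biUnion_le_card_mul _ _ _ fun i hi => ?_
        refine (Finset.card_biUnion_le_card_mul _ _ (1 + D + D * D) fun u hu => ?_).trans
          (Nat.mul_le_mul_right _ ?_)
        · obtain ⟨a, -, rfl⟩ := Finset.mem_image.1 hu
          exact hballcard _ ((hf i (hIS hi)).2.2.1 a)
        · exact Finset.card_image_le.trans (by simp)
    _ ≤ _ := Nat.mul_le_mul_right _ hI

end Packing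

/-! ### The patterns: stars, the path on four vertices, the triangle -/

/-- The star on `m` vertices with centre `0`. -/
def starOn (m : ℕ) [NeZero m] : SimpleGraph (Fin m) := SimpleGraph.fromRel fun a _ => a = 0

/-- The path `1 - 0 - 2 - 3`. -/
def pathOnFour : SimpleGraph (Fin 4) := SimpleGraph.fromRel fun a b =>
  (a = 0 ∧ b = 1) ∨ (a = 0 ∧ b = 2) ∨ (a = 2 ∧ b = 3)

lemma starOn_adj {m : ℕ} [NeZero m] {a b : Fin m} :
    (starOn m).Adj a b ↔ a ≠ b ∧ (a = 0 ∨ b = 0) := by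
  simp [starOn]

lemma pathOnFour_adj {a b : Fin 4} : pathOnFour.Adj a b ↔ a ≠ b ∧
    (((a = 0 ∧ b = 1) ∨ (a = 0 ∧ b = 2) ∨ (a = 2 ∧ b = 3)) ∨
     ((b = 0 ∧ a = 1) ∨ (b = 0 ∧ a = 2) ∨ (b = 2 ∧ a = 3))) := by
  simp [pathOnFour]

lemma pairs_starOn_three : pairs (starOn 3) Finset.univ Finset.univ = 4 := by
  simp [pairs, adjInd, Fin.sum_univ_succ, starOn_adj, -Finset.sum_boole]; norm_num

lemma pairs_starOn_four : pairs (starOn 4) Finset.univ Finset.univ = 6 := by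
  simp [pairs, adjInd, Fin.sum_univ_succ, starOn_adj, -Finset.sum_boole]; norm_num

lemma pairs_pathOnFour : pairs pathOnFour Finset.univ Finset.univ = 6 := by
  simp [pairs, adjInd, Fin.sum_univ_succ, pathOnFour_adj, -Finset.sum_boole]; norm_num

lemma pairs_top_three : pairs (⊤ : SimpleGraph (Fin 3)) Finset.univ Finset.univ = 6 := by
  simp [pairs, adjInd, Fin.sum_univ_succ]; norm_num

section Patterns

variable {V : Type} [Fintype V] [DecidableEq V] {G : SimpleGraph V} {L : Finset V}

lemma exists_rooted_star {j : ℕ} {v : V} (hv : v ∉ L) (hj : j ≤ (offNbrs G L v).card) :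
    ∃ f, RootedCopy G L (starOn (j + 1)) v f := by
  obtain ⟨S, hS, hScard⟩ := Finset.exists_subset_card_eq hj
  let g := (Finset.equivFinOfCardEq hScard).symm
  have hg : ∀ i, G.Adj v (g i) ∧ (g i : V) ∉ L := fun i => mem_offNbrs.1 (hS (g i).2)
  refine ⟨Fin.cons v fun i => (g i : V), rfl, ?_, ?_, ?_⟩
  · rw [Fin.cons_injective_iff]
    refine ⟨?_, fun a b hab => g.injective (Subtype.ext hab)⟩
    rintro ⟨i, hi⟩
    exact (hg i).1.ne hi.symm
  · intro i
    refine Fin.cases hv (fun i => (hg i).2) i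
  · intro a b hab
    obtain ⟨hne, h⟩ := starOn_adj.1 hab
    rcases h with rfl | rfl
    · obtain ⟨b, rfl⟩ := Fin.exists_succ_eq.2 hne.symm
      exact (hg b).1
    · obtain ⟨a, rfl⟩ := Fin.exists_succ_eq.2 hne
      exact (hg a).1.symm

/-- A further neighbour v₁ of v and a further neighbour u₁ of u either coincide, closing a triangle,
or give the path v₁ v u u₁, whose root is an inner vertex. -/
lemma exists_rooted_path_or_triangle {v u : V} (hv : v ∉ L) (hu : u ∈ offNbrs G L v)
    (hv2 : 2 ≤ (offNbrs G L v).card) (hu2 : 2 ≤ (offNbrs G L u).card) :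
    (∃ f, RootedCopy G L pathOnFour v f) ∨
      ∃ f, RootedCopy G L (⊤ : SimpleGraph (Fin 3)) v f := by
  obtain ⟨v₁, hv₁, hne₁⟩ := Finset.exists_mem_ne (show 1 < (offNbrs G L v).card by omega) u
  obtain ⟨u₁, hu₁, hne₂⟩ := Finset.exists_mem_ne (show 1 < (offNbrs G L u).card by omega) v
  rw [mem_offNbrs] at hu hv₁ hu₁
  by_cases h : u₁ = v₁
  · right
    subst h
    refine ⟨![v, u, u₁], rfl, ?_, ?_, ?_⟩
    · intro a b hab
      fin_cases a <;> fin_cases b <;> simp_all [hu.1.ne, hv₁.1.ne, hu.1.ne', hv₁.1.ne', hne₁.symm]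
    · intro a; fin_cases a <;> simp_all
    · intro a b hab
      fin_cases a <;> fin_cases b <;> simp_all [G.adj_comm]
  · left
    refine ⟨![v, v₁, u, u₁], rfl, ?_, ?_, ?_⟩
    · intro a b hab
      have e1 := hu.1.ne
      have e2 := hv₁.1.ne
      have e3 := hu₁.1.ne
      fin_cases a <;> fin_cases b <;> simp_all [eq_comm]
    · intro a; fin_cases a <;> simp_all
    · intro a b hab
      have e1 := hu.1.symm
      have e2 := hv₁.1.symm
      have e3 := hu₁.1.symm
      rw [pathOnFour_adj] at hab
      fin_cases a <;> fin_cases b <;> simp_all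

end Patterns

/-! ### Identities and inequalities for walk counts -/

section Counts

variable {V : Type} [Fintype V] [DecidableEq V] {G : SimpleGraph V} {L : Finset V}

lemma Dominating.pairs_on {V : Type} [DecidableEq V] {G : SimpleGraph V} {L : Finset V}
    (hL : Dominating G L) : pairs G L L = L.card * (L.card - 1) := by
  unfold pairs
  have : ∀ l ∈ L, ∑ m ∈ L, adjInd G l m = (L.card : ℝ) - 1 := by
    intro l hl
    rw [← Finset.sum_erase_add _ _ hl, adjInd_self, add_zero,
      Finset.sum_congr rfl fun m hm => adjInd_of_adj _ (hL l hl m (Finset.ne_of_mem_erase hm)),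
      Finset.sum_const, nsmul_eq_mul, mul_one, Finset.card_erase_of_mem hl,
      Nat.cast_sub (Finset.card_pos.2 ⟨l, hl⟩)]
    simp
  rw [Finset.sum_congr rfl this, Finset.sum_const, nsmul_eq_mul]

lemma pairs_eq_card_mul {V : Type} {G : SimpleGraph V} {S T : Finset V}
    (h : ∀ u ∈ S, ∀ v ∈ T, G.Adj u v) :
    pairs G S T = S.card * T.card := by
  unfold pairs
  rw [Finset.sum_congr rfl fun u hu =>
    Finset.sum_congr rfl fun v hv => adjInd_of_adj _ (h u hu v hv)]
  simp

lemma pairs_union {V : Type} [DecidableEq V] {G : SimpleGraph V} {S T : Finset V}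
    (h : Disjoint S T) :
    pairs G (S ∪ T) (S ∪ T) = pairs G S S + 2 * pairs G S T + pairs G T T := by
  rw [pairs_union_left h, pairs_comm S, pairs_comm T, pairs_union_left h, pairs_union_left h,
    pairs_comm T S]
  ring

lemma CompleteTo.pairs_univ (hL : CompleteTo G L) : pairs G Finset.univ Finset.univ
    = pairs G L L + 2 * L.card * (Lᶜ.card : ℝ) + pairs G Lᶜ Lᶜ := by
  have h1 := pairs_union (G := G) (disjoint_compl_right (a := L))
  rw [Finset.union_compl] at h1
  rw [h1, pairs_eq_card_mul fun u hu v hv => hL u hu v (Finset.mem_compl.1 hv)]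
  ring

lemma sum_offOp_offDeg : ∑ u ∈ Lᶜ, offOp G L (offDeg G L) u = offMoment2 G L := by
  have := sum_offOp_mul (G := G) (L := L) (offDeg G L) (fun _ => 1)
  rw [offOp_one] at this
  simp only [mul_one] at this
  rw [this, offMoment2]
  exact Finset.sum_congr rfl fun u _ => by ring

/-- Expand ∑ (d-1)(a-d), where d is the off-degree and a the number of two-step walks, using ∑ a = ∑
d². The point of this form is that each summand is nonnegative and vanishes wherever a ≤ 2. -/
lemma offMoment3_eq : offMoment3 G L = 2 * offMoment2 G L - pairs G Lᶜ Lᶜ +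
    ∑ u ∈ Lᶜ, (offDeg G L u - 1) * (offOp G L (offDeg G L) u - offDeg G L u) := by
  have h1 : ∑ u ∈ Lᶜ, (offDeg G L u - 1) * (offOp G L (offDeg G L) u - offDeg G L u)
      = offMoment3 G L - offMoment2 G L - ∑ u ∈ Lᶜ, offOp G L (offDeg G L) u
        + ∑ u ∈ Lᶜ, offDeg G L u := by
    rw [offMoment3, offMoment2, ← Finset.sum_sub_distrib, ← Finset.sum_sub_distrib,
      ← Finset.sum_add_distrib]
    exact Finset.sum_congr rfl fun u _ => by ring
  rw [sum_offOp_offDeg, sum_offDeg] at h1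
  linarith

lemma offDeg_le_offOp {u : V} (hu : u ∉ L) : offDeg G L u ≤ offOp G L (offDeg G L) u := by
  rw [offDeg_eq_card, offOp_eq_sum]
  calc ((offNbrs G L u).card : ℝ) = ∑ w ∈ offNbrs G L u, (1 : ℝ) := by simp
    _ ≤ _ := Finset.sum_le_sum fun w hw => by
      rw [offDeg_eq_card]
      have : 0 < (offNbrs G L w).card :=
        Finset.card_pos.2 ⟨u, mem_offNbrs.2 ⟨(mem_offNbrs.1 hw).1.symm, hu⟩⟩
      exact_mod_cast this

/-- The first factor is negative only at isolated vertices, where the second vanishes. -/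
lemma offDeg_excess_nonneg {u : V} (hu : u ∉ L) :
    0 ≤ (offDeg G L u - 1) * (offOp G L (offDeg G L) u - offDeg G L u) := by
  have h1 := offDeg_le_offOp (G := G) hu
  rcases Nat.eq_zero_or_pos (offNbrs G L u).card with h | h
  · have h2 : offOp G L (offDeg G L) u = 0 := by
      rw [offOp_eq_sum, Finset.card_eq_zero.1 h]; simp
    rw [h2, offDeg_eq_card, h]; simp
  · refine mul_nonneg ?_ (by linarith)
    rw [offDeg_eq_card]
    have : (1 : ℝ) ≤ (offNbrs G L u).card := by exact_mod_cast h
    linarith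

lemma offDeg_le_sq (u : V) : offDeg G L u ≤ offDeg G L u ^ 2 := by
  rw [offDeg_eq_card]
  have h : (offNbrs G L u).card ≤ (offNbrs G L u).card ^ 2 := Nat.le_self_pow (by norm_num) _
  exact_mod_cast h

lemma pairs_le_offMoment2 : pairs G Lᶜ Lᶜ ≤ offMoment2 G L :=
  Finset.sum_le_sum fun u _ => offDeg_le_sq u

/-- The sum of (d-1)(d-2) ≥ 0 over integer degrees d. -/
lemma three_pairs_le : 3 * pairs G Lᶜ Lᶜ ≤ offMoment2 G L + 2 * (Lᶜ.card : ℝ) := by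
  rw [← sum_offDeg, offMoment2, Finset.mul_sum]
  have : 2 * (Lᶜ.card : ℝ) = ∑ u ∈ Lᶜ, (2 : ℝ) := by simp [mul_comm]
  rw [this, ← Finset.sum_add_distrib]
  refine Finset.sum_le_sum fun u _ => ?_
  rw [offDeg_eq_card]
  have h : 3 * (offNbrs G L u).card ≤ (offNbrs G L u).card ^ 2 + 2 := by
    rcases Nat.lt_or_ge (offNbrs G L u).card 2 with h | h
    · interval_cases (offNbrs G L u).card <;> norm_num
    · nlinarith
  exact_mod_cast h

end Counts

/-! ### Comparing moments with the extremal graph -/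

/-- If `K_k` joined to arbitrarily many copies of `T` were `𝓕`-free, the edge bound would be at
least as large. -/
lemma ConnBound.exists_not_free_tile {𝓕 : GraphFamily} {h : ℕ → ℝ} {n₀ k : ℕ} {Q C : ℝ}
    (hb : ConnBound 𝓕 h n₀) (hk : 1 ≤ k)
    (hh : ∀ n : ℕ, n₀ ≤ n → k ≤ n → h n ≤ k * (k - 1) + 2 * k * (n - k) + 2 * Q * n + C)
    {m : ℕ} [NeZero m] (T : SimpleGraph (Fin m))
    (hT : 2 * Q * m < pairs T Finset.univ Finset.univ) :
    ∃ r, ¬ FamilyFree 𝓕 (cliqueJoin k (tile T r)) := by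
  by_contra hcon
  push Not at hcon
  have hm : 0 < m := Nat.pos_of_ne_zero (NeZero.ne m)
  obtain ⟨q, hq⟩ := exists_nat_gt ((2 * Q * k + C) / (pairs T Finset.univ Finset.univ - 2 * Q * m))
  rw [div_lt_iff₀ (by linarith)] at hq
  set p := max q n₀ with hp
  have hcard : Fintype.card (Fin k ⊕ Fin (m * p)) = k + m * p := by simp
  have hge : n₀ ≤ k + m * p := by
    have : p ≤ m * p := Nat.le_mul_of_pos_left _ hm
    have : n₀ ≤ p := le_max_right _ _
    omega
  have h1 := hb.le_card (by rw [hcard]; exact hge) (cliqueJoin_connected hk) (hcon (m * p))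
  rw [pairs_cliqueJoin, hcard] at h1
  have h2 := h1.trans (hh _ hge (Nat.le_add_right _ _))
  have h3 := le_pairs_tile (T := T) (r := m * p)
  rw [Nat.mul_div_cancel_left _ hm] at h3
  have h4 : (q : ℝ) ≤ p := by exact_mod_cast le_max_left _ _
  have h5 : (q : ℝ) * (pairs T Finset.univ Finset.univ - 2 * Q * m)
      ≤ p * (pairs T Finset.univ Finset.univ - 2 * Q * m) :=
    mul_le_mul_of_nonneg_right h4 (by linarith)
  simp only [Fintype.card_fin] at h2
  push_cast at h2
  linarith

section MomentBounds

variable {V : Type} [Fintype V] [DecidableEq V] {G : SimpleGraph V} {L : Finset V}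

/-- The vertices off `L` with at least three walks of length two off `L`. -/
noncomputable def busyVerts (G : SimpleGraph V) (L : Finset V) : Finset V := by
  classical exact Lᶜ.filter fun v => 2 < offOp G L (offDeg G L) v

/-- The vertices off `L` that are roots of copies of `T`. -/
noncomputable def roots (G : SimpleGraph V) (L : Finset V) {m : ℕ} [NeZero m]
    (T : SimpleGraph (Fin m)) : Finset V := by
  classical exact Finset.univ.filter fun v => ∃ f, RootedCopy G L T v f

lemma mem_roots {V : Type} [Fintype V] {G : SimpleGraph V} {L : Finset V} {m : ℕ}
    [NeZero m] {T : SimpleGraph (Fin m)} {v : V} :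
    v ∈ roots G L T ↔ ∃ f, RootedCopy G L T v f := by simp [roots]

/-- If neither v nor a neighbour of v is the centre of a K_{1,3}, their degrees are at most 2. If
moreover v has degree 2 and roots no P₄ or triangle, its neighbours have degree 1. Either way at
most two two-step walks start at v. -/
lemma busyVerts_subset : busyVerts G L ⊆ (roots G L (starOn 4) ∪
    (roots G L (starOn 4)).biUnion (offNbrs G L)) ∪
      (roots G L pathOnFour ∪ roots G L (⊤ : SimpleGraph (Fin 3))) := by
  intro v hv
  simp only [busyVerts, Finset.mem_filter, Finset.mem_compl] at hv
  obtain ⟨hvL, hbusy⟩ := hv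
  by_contra hcon
  simp only [Finset.mem_union, Finset.mem_biUnion, not_or, not_exists, not_and, mem_roots] at hcon
  obtain ⟨⟨h4, h4'⟩, hP, hK⟩ := hcon
  have hd : ∀ w ∉ L, (¬ ∃ f, RootedCopy G L (starOn 4) w f) → (offNbrs G L w).card ≤ 2 := by
    intro w hw hno
    by_contra h
    exact hno (exists_rooted_star (j := 3) hw (by omega))
  have hdv := hd v hvL fun ⟨f, hf⟩ => h4 f hf
  have hdu : ∀ u ∈ offNbrs G L v, (offNbrs G L u).card ≤ 2 := by
    intro u hu
    refine hd u (mem_offNbrs.1 hu).2 fun hf => h4' u hf ?_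
    exact mem_offNbrs.2 ⟨(mem_offNbrs.1 hu).1.symm, hvL⟩
  have hs : offOp G L (offDeg G L) v ≤ 2 := by
    rw [offOp_eq_sum]
    simp only [offDeg_eq_card]
    have : ∑ u ∈ offNbrs G L v, (offNbrs G L u).card ≤ 2 := by
      rcases Nat.lt_or_ge (offNbrs G L v).card 2 with h | h
      · calc _ ≤ ∑ u ∈ offNbrs G L v, 2 := Finset.sum_le_sum hdu
          _ ≤ 2 := by rw [Finset.sum_const, smul_eq_mul]; omega
      · calc _ ≤ ∑ u ∈ offNbrs G L v, 1 := by
              refine Finset.sum_le_sum fun u hu => ?_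
              by_contra hcon
              rcases exists_rooted_path_or_triangle hvL hu h (by omega) with ⟨f, hf⟩ | ⟨f, hf⟩
              · exact hP f hf
              · exact hK f hf
          _ ≤ 2 := by rw [Finset.sum_const, smul_eq_mul, mul_one]; exact hdv
    exact_mod_cast this
  linarith

/-- Uniform control of the second and third moments by those of an extremal comparison graph. -/
theorem moment_bounds {𝓕 : GraphFamily} {h : ℕ → ℝ} {n₀ k : ℕ} {Q C : ℝ}
    (hb : ConnBound 𝓕 h n₀) (hk : 1 ≤ k) (hQ : Q < 3 / 4)
    (hh : ∀ n : ℕ, n₀ ≤ n → k ≤ n → h n ≤ k * (k - 1) + 2 * k * (n - k) + 2 * Q * n + C) (D : ℕ) :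
    ∃ K : ℝ, 0 ≤ K ∧ ∀ (V : Type) [Fintype V] [DecidableEq V] (G G' : SimpleGraph V)
      (L : Finset V), L.card = k → Dominating G L → Dominating G' L → FamilyFree 𝓕 G →
      (∀ v ∉ L, (offNbrs G L v).card ≤ D) → n₀ ≤ Fintype.card V →
      pairs G' Finset.univ Finset.univ = h (Fintype.card V) →
      pairs G Lᶜ Lᶜ ≤ pairs G' Lᶜ Lᶜ →
      offMoment2 G L ≤ offMoment2 G' L + K ∧
      offMoment3 G L ≤ offMoment3 G' L + K + (pairs G' Lᶜ Lᶜ - pairs G Lᶜ Lᶜ) := by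
  -- Each of the three patterns has at least 3/4 edges per vertex, which exceeds Q.
  obtain ⟨r₄, hr₄⟩ := hb.exists_not_free_tile hk hh (starOn 4)
    (by rw [pairs_starOn_four]; push_cast; linarith)
  obtain ⟨rP, hrP⟩ := hb.exists_not_free_tile hk hh pathOnFour
    (by rw [pairs_pathOnFour]; push_cast; linarith)
  obtain ⟨rK, hrK⟩ := hb.exists_not_free_tile hk hh (⊤ : SimpleGraph (Fin 3))
    (by rw [pairs_top_three]; push_cast; linarith)
  set F : ℕ := 1 + D + D * D with hF
  set B : ℕ := r₄ * (4 * F) + r₄ * (4 * F) * D + (rP * (4 * F) + rK * (3 * F)) with hB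
  -- a bound for the second moment
  have hsecond : ∃ K₂ : ℝ, 0 ≤ K₂ ∧ ∀ (V : Type) [Fintype V] [DecidableEq V] (G G' : SimpleGraph V)
      (L : Finset V), L.card = k → Dominating G L → Dominating G' L → FamilyFree 𝓕 G →
      (∀ v ∉ L, (offNbrs G L v).card ≤ D) → n₀ ≤ Fintype.card V →
      pairs G' Finset.univ Finset.univ = h (Fintype.card V) →
      pairs G Lᶜ Lᶜ ≤ pairs G' Lᶜ Lᶜ → ((busyVerts G L).card : ℝ) ≤ B →
      offMoment2 G L ≤ offMoment2 G' L + K₂ := by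
    -- If many copies of P₃ are excluded, almost all off-degrees in `G` are at most 1, and w₂ ≤ w₁ +
    -- O(1) ≤ w₁' + O(1) ≤ w₂' + O(1).
    by_cases hex : ∃ r, ¬ FamilyFree 𝓕 (cliqueJoin k (tile (starOn 3) r))
    · obtain ⟨r₃, hr₃⟩ := hex
      refine ⟨r₃ * (3 * F) * D ^ 2, by positivity, ?_⟩
      intro V _ _ G G' L hLk hL hL' hG hD hn hG' hW hbusy
      have hroots : (roots G L (starOn 3)).card ≤ r₃ * (3 * F) :=
        card_roots_le hG hL (by rw [hLk]; exact hr₃) hD (by simp only [starOn_adj]; decide) _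
          fun v hv => mem_roots.1 hv
      have h1 : offMoment2 G L ≤ pairs G Lᶜ Lᶜ + (roots G L (starOn 3)).card * (D : ℝ) ^ 2 := by
        have h2 : ∀ u ∈ Lᶜ, offDeg G L u ^ 2
            ≤ offDeg G L u + if u ∈ roots G L (starOn 3) then (D : ℝ) ^ 2 else 0 := by
          intro u hu
          have hu' := Finset.mem_compl.1 hu
          have hle : offDeg G L u ≤ D := by rw [offDeg_eq_card]; exact_mod_cast hD u hu'
          by_cases hr : u ∈ roots G L (starOn 3)
          · rw [if_pos hr]
            have := pow_le_pow_left₀ (offDeg_nonneg (G := G) (L := L) u) hle 2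
            linarith [offDeg_nonneg (G := G) (L := L) u]
          · rw [if_neg hr, add_zero, offDeg_eq_card]
            have : (offNbrs G L u).card < 2 := by
              by_contra hcon
              exact hr (mem_roots.2 (exists_rooted_star (j := 2) hu' (by omega)))
            interval_cases (offNbrs G L u).card <;> norm_num
        calc offMoment2 G L ≤ _ := Finset.sum_le_sum h2
          _ = pairs G Lᶜ Lᶜ + ∑ u ∈ Lᶜ, if u ∈ roots G L (starOn 3) then (D : ℝ) ^ 2 else 0 := by
              rw [Finset.sum_add_distrib, sum_offDeg]
          _ ≤ pairs G Lᶜ Lᶜ + ∑ u, if u ∈ roots G L (starOn 3) then (D : ℝ) ^ 2 else 0 := by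
              gcongr
              exact Finset.subset_univ _
          _ = _ := by simp
      have h3 : ((roots G L (starOn 3)).card : ℝ) ≤ r₃ * (3 * F) := by exact_mod_cast hroots
      have h4 : ((roots G L (starOn 3)).card : ℝ) * (D : ℝ) ^ 2 ≤ r₃ * (3 * F) * (D : ℝ) ^ 2 := by
        gcongr
      have h5 := pairs_le_offMoment2 (G := G') (L := L)
      linarith
    -- Otherwise K_k joined to a tiling by P₃ competes with `G'`, so w₁' ≥ 4⌊r/3⌋ and
    -- `three_pairs_le` gives w₂' ≥ 2r - 8. In `G` every vertex that is not busy contributes at most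
    -- 2 to w₂.
    · push Not at hex
      refine ⟨B * (D : ℝ) ^ 2 + 12, by positivity, ?_⟩
      intro V _ _ G G' L hLk hL hL' hG hD hn hG' hW hbusy
      have hcard : L.card + Lᶜ.card = Fintype.card V := Finset.card_add_card_compl L
      have hcard' : Fintype.card (Fin k ⊕ Fin Lᶜ.card) = Fintype.card V := by
        rw [← hcard, hLk]; simp
      have h1 := hb.le_card (by rw [hcard']; exact hn) (cliqueJoin_connected hk) (hex Lᶜ.card)
      rw [pairs_cliqueJoin, hcard', ← hG', hL'.completeTo.pairs_univ, hL'.pairs_on, hLk] at h1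
      simp only [Fintype.card_fin] at h1
      have h2 := le_pairs_tile (T := starOn 3) (r := Lᶜ.card)
      rw [pairs_starOn_three] at h2
      have h3 : (Lᶜ.card : ℝ) ≤ 3 * ((Lᶜ.card / 3 : ℕ) : ℝ) + 2 := by
        have : Lᶜ.card ≤ 3 * (Lᶜ.card / 3) + 2 := by omega
        exact_mod_cast this
      have h4 := three_pairs_le (G := G') (L := L)
      have h5 : offMoment2 G L ≤ 2 * (Lᶜ.card : ℝ) + (busyVerts G L).card * (D : ℝ) ^ 2 := by
        rw [← sum_offOp_offDeg]
        have h6 : ∀ u ∈ Lᶜ, offOp G L (offDeg G L) u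
            ≤ 2 + if u ∈ busyVerts G L then (D : ℝ) ^ 2 else 0 := by
          intro u hu
          by_cases hbu : u ∈ busyVerts G L
          · rw [if_pos hbu]
            have := offOp_le (G := G) (L := L) (f := offDeg G L) (D := D) (E := D)
              (Nat.cast_nonneg _)
              (fun v hv => by rw [offDeg_eq_card]; exact_mod_cast hD v hv)
              (fun v hv => by rw [offDeg_eq_card]; exact_mod_cast hD v hv) (Finset.mem_compl.1 hu)
            rw [pow_two]; linarith
          · rw [if_neg hbu]
            simp only [busyVerts, Finset.mem_filter, not_and, not_lt] at hbu
            linarith [hbu hu]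
        calc _ ≤ _ := Finset.sum_le_sum h6
          _ = 2 * (Lᶜ.card : ℝ) + ∑ u ∈ Lᶜ, if u ∈ busyVerts G L then (D : ℝ) ^ 2 else 0 := by
              rw [Finset.sum_add_distrib, Finset.sum_const, nsmul_eq_mul, mul_comm]
          _ ≤ 2 * (Lᶜ.card : ℝ) + ∑ u, if u ∈ busyVerts G L then (D : ℝ) ^ 2 else 0 := by
              gcongr
              exact Finset.subset_univ _
          _ = _ := by simp
      have h7 : ((busyVerts G L).card : ℝ) * (D : ℝ) ^ 2 ≤ B * (D : ℝ) ^ 2 := by gcongr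
      linarith
  obtain ⟨K₂, hK₂, hsecond⟩ := hsecond
  refine ⟨2 * K₂ + B * (D * (D : ℝ) ^ 2), by positivity, ?_⟩
  intro V _ _ G G' L hLk hL hL' hG hD hn hG' hW
  have hbusy : (busyVerts G L).card ≤ B := by
    refine (Finset.card_le_card busyVerts_subset).trans ?_
    have c4 : (roots G L (starOn 4)).card ≤ r₄ * (4 * F) :=
      card_roots_le hG hL (by rw [hLk]; exact hr₄) hD (by simp only [starOn_adj]; decide) _
        fun v hv => mem_roots.1 hv
    have cP : (roots G L pathOnFour).card ≤ rP * (4 * F) :=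
      card_roots_le hG hL (by rw [hLk]; exact hrP) hD (by simp only [pathOnFour_adj]; decide) _
        fun v hv => mem_roots.1 hv
    have cK : (roots G L (⊤ : SimpleGraph (Fin 3))).card ≤ rK * (3 * F) :=
      card_roots_le hG hL (by rw [hLk]; exact hrK) hD (by simp only [SimpleGraph.top_adj]; decide) _
        fun v hv => mem_roots.1 hv
    refine (Finset.card_union_le _ _).trans (Nat.add_le_add ((Finset.card_union_le _ _).trans
      (Nat.add_le_add c4 ?_)) ((Finset.card_union_le _ _).trans (Nat.add_le_add cP cK)))
    refine (Finset.card_biUnion_le_card_mul _ _ D fun v hv => ?_).trans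
      (Nat.mul_le_mul_right _ c4)
    obtain ⟨f, hf⟩ := mem_roots.1 hv
    exact hD v (hf.1 ▸ hf.2.2.1 0)
  have hbusy' : ((busyVerts G L).card : ℝ) ≤ B := by exact_mod_cast hbusy
  have h2 := hsecond V G G' L hLk hL hL' hG hD hn hG' hW hbusy'
  have hB0 : 0 ≤ (B : ℝ) * (D * (D : ℝ) ^ 2) := by positivity
  refine ⟨by linarith, ?_⟩
  -- By `offMoment3_eq` it remains to compare the excess sums: nonnegative for `G'`, and carried by
  -- the boundedly many busy vertices for `G`.
  have hq' : 0 ≤ ∑ u ∈ Lᶜ, (offDeg G' L u - 1) * (offOp G' L (offDeg G' L) u - offDeg G' L u) :=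
    Finset.sum_nonneg fun u hu => offDeg_excess_nonneg (Finset.mem_compl.1 hu)
  have hq : ∑ u ∈ Lᶜ, (offDeg G L u - 1) * (offOp G L (offDeg G L) u - offDeg G L u)
      ≤ B * (D * (D : ℝ) ^ 2) := by
    have h6 : ∀ u ∈ Lᶜ, (offDeg G L u - 1) * (offOp G L (offDeg G L) u - offDeg G L u)
        ≤ if u ∈ busyVerts G L then D * (D : ℝ) ^ 2 else 0 := by
      intro u hu
      have hu' := Finset.mem_compl.1 hu
      have hdD : ∀ v ∉ L, offDeg G L v ≤ D := fun v hv => by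
        rw [offDeg_eq_card]; exact_mod_cast hD v hv
      have hs0 := offDeg_le_offOp (G := G) hu'
      have hd0 := offDeg_nonneg (G := G) (L := L) u
      by_cases hbu : u ∈ busyVerts G L
      · rw [if_pos hbu]
        have h7 := offOp_le (G := G) (L := L) (f := offDeg G L) (D := D) (E := D)
          (Nat.cast_nonneg _) hdD hdD hu'
        refine mul_le_mul (by linarith [hdD u hu']) ?_ (by linarith) (Nat.cast_nonneg _)
        rw [pow_two]; linarith
      · rw [if_neg hbu]
        simp only [busyVerts, Finset.mem_filter, not_and, not_lt] at hbu
        have hs := hbu hu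
        have hd2 : (offNbrs G L u).card ≤ 2 := by
          have : ((offNbrs G L u).card : ℝ) ≤ 2 := by rw [← offDeg_eq_card]; linarith
          exact_mod_cast this
        rcases Nat.eq_zero_or_pos (offNbrs G L u).card with h | h
        · have h8 : offOp G L (offDeg G L) u = 0 := by
            rw [offOp_eq_sum, Finset.card_eq_zero.1 h]; simp
          rw [h8, offDeg_eq_card, h]; simp
        · rcases Nat.lt_or_ge (offNbrs G L u).card 2 with h' | h'
          · have : (offNbrs G L u).card = 1 := by omega
            rw [offDeg_eq_card, this]; simp
          · have : (offNbrs G L u).card = 2 := by omega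
            rw [offDeg_eq_card, this] at hs0 ⊢
            push_cast at hs0 ⊢
            linarith
    calc _ ≤ _ := Finset.sum_le_sum h6
      _ ≤ ∑ u, if u ∈ busyVerts G L then D * (D : ℝ) ^ 2 else 0 := by
          gcongr
          exact Finset.subset_univ _
      _ = (busyVerts G L).card * (D * (D : ℝ) ^ 2) := by simp
      _ ≤ _ := by gcongr
  rw [offMoment3_eq, offMoment3_eq (G := G')]
  linarith

end MomentBounds

/-! ### The core graph -/

/-- The graph obtained from `G` by joining `L` completely to its complement, and keeping off `L`
only the edges inside `A`. -/
def coreGraph {V : Type} (G : SimpleGraph V) (L A : Finset V) : SimpleGraph V where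
  Adj u v := (u ∈ L ∧ v ∈ L ∧ G.Adj u v) ∨ (u ∈ L ∧ v ∉ L) ∨ (u ∉ L ∧ v ∈ L) ∨
    (u ∉ L ∧ v ∉ L ∧ u ∈ A ∧ v ∈ A ∧ G.Adj u v)
  symm := ⟨fun u v h => by
    rcases h with ⟨a, b, c⟩ | ⟨a, b⟩ | ⟨a, b⟩ | ⟨a, b, c, d, e⟩
    · exact Or.inl ⟨b, a, c.symm⟩
    · exact Or.inr (Or.inr (Or.inl ⟨b, a⟩))
    · exact Or.inr (Or.inl ⟨b, a⟩)
    · exact Or.inr (Or.inr (Or.inr ⟨b, a, d, c, e.symm⟩))⟩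
  loopless := ⟨fun u h => by
    rcases h with ⟨_, _, c⟩ | ⟨a, b⟩ | ⟨a, b⟩ | ⟨_, _, _, _, e⟩
    · exact G.irrefl c
    · exact b a
    · exact a b
    · exact G.irrefl e⟩

section CoreGraph

variable {V : Type} {G : SimpleGraph V} {L A : Finset V}

lemma coreGraph_completeTo : CompleteTo (coreGraph G L A) L :=
  fun _ hl _ hv => Or.inr (Or.inl ⟨hl, hv⟩)

lemma coreGraph_adj_on {u v : V} (hu : u ∈ L) (hv : v ∈ L) :
    (coreGraph G L A).Adj u v ↔ G.Adj u v := by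
  simp [coreGraph, hu, hv]

lemma coreGraph_adj_off {u v : V} (hu : u ∉ L) (hv : v ∉ L) :
    (coreGraph G L A).Adj u v ↔ u ∈ A ∧ v ∈ A ∧ G.Adj u v := by
  simp [coreGraph, hu, hv]

/-- Replacing vertices outside `A` by unused vertices of `A` shows that the core graph is
`𝓕`-free. -/
lemma FamilyFree.coreGraph {𝓕 : GraphFamily} {m : ℕ} (hG : FamilyFree 𝓕 G)
    (hm : ∀ F ∈ 𝓕, F.1 ≤ m) (hA : ∀ a ∈ A, a ∉ L ∧ ∀ l ∈ L, G.Adj l a) (hcard : 2 * m ≤ A.card) :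
    FamilyFree 𝓕 (coreGraph G L A) := by
  classical
  rintro F hF ⟨f⟩
  apply hG F hF
  have hFm := hm F hF
  set Im : Finset V := Finset.univ.image f with hIm
  have hImcard : Im.card ≤ F.1 := Finset.card_image_le.trans (by simp)
  -- Of the 2m vertices in `A`, the copy occupies at most m.
  have hfree : F.1 ≤ (A \ Im).card := by
    have := Finset.le_card_sdiff Im A
    omega
  obtain ⟨S, hS, hScard⟩ := Finset.exists_subset_card_eq hfree
  let g := (Finset.equivFinOfCardEq hScard).symm
  have hgA : ∀ i, (g i : V) ∈ A := fun i => (Finset.mem_sdiff.1 (hS (g i).2)).1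
  have hgIm : ∀ i j, (g i : V) ≠ f j := fun i j h =>
    (Finset.mem_sdiff.1 (hS (g i).2)).2 (h ▸ Finset.mem_image_of_mem _ (Finset.mem_univ j))
  -- A vertex outside `L` and `A` is adjacent only to `L` in the core graph, and any unused vertex
  -- of `A` is adjacent in `G` to all of `L`.
  set φ : Fin F.1 → V := fun i => if f i ∈ L ∨ f i ∈ A then f i else g i with hφ
  have hadj1 : ∀ i j, F.2.Adj i j → ¬ (f i ∈ L ∨ f i ∈ A) → G.Adj (φ i) (φ j) := by
    intro i j hij hi
    have h := f.toHom.map_adj hij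
    rw [not_or] at hi
    have hj : f j ∈ L := by
      rcases h with ⟨a, b, c⟩ | ⟨a, b⟩ | ⟨a, b⟩ | ⟨a, b, c, d, e⟩
      · exact absurd a hi.1
      · exact absurd a hi.1
      · exact b
      · exact absurd c hi.2
    simp only [hφ]
    rw [if_neg (by rw [not_or]; exact hi), if_pos (Or.inl hj)]
    exact ((hA _ (hgA i)).2 _ hj).symm
  refine ⟨⟨⟨φ, ?_⟩, ?_⟩⟩
  · intro i j hij
    by_cases hi : f i ∈ L ∨ f i ∈ A
    · by_cases hj : f j ∈ L ∨ f j ∈ A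
      · have h := f.toHom.map_adj hij
        simp only [hφ, if_pos hi, if_pos hj]
        rcases h with ⟨a, b, c⟩ | ⟨a, b⟩ | ⟨a, b⟩ | ⟨a, b, c, d, e⟩
        · exact c
        · exact (hA _ (hj.resolve_left b)).2 _ a
        · exact ((hA _ (hi.resolve_left a)).2 _ b).symm
        · exact e
      · exact (hadj1 j i hij.symm hj).symm
    · exact hadj1 i j hij hi
  · intro i j hij
    have hij' : φ i = φ j := hij
    simp only [hφ] at hij'
    split_ifs at hij' with hi hj hj
    · exact f.injective hij'
    · exact absurd hij'.symm (hgIm j i)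
    · exact absurd hij' (hgIm i j)
    · exact g.injective (Subtype.ext hij')

end CoreGraph

/-! ### Missing pairs and the cost of deletion -/

section Completion

variable {V : Type} [Fintype V] [DecidableEq V] {G : SimpleGraph V} {L : Finset V}

/-- The vertices off `L` adjacent to all of `L`. -/
noncomputable def completeVerts (G : SimpleGraph V) (L : Finset V) : Finset V :=
  Lᶜ \ incompleteVerts G L

lemma mem_completeVerts {v : V} : v ∈ completeVerts G L ↔ v ∉ L ∧ ∀ l ∈ L, G.Adj l v := by
  simp only [completeVerts, Finset.mem_sdiff, Finset.mem_compl, mem_incompleteVerts]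
  tauto

/-- The number of missing pairs between `L` and its complement. -/
noncomputable def missing (G : SimpleGraph V) (L : Finset V) : ℝ :=
  ∑ v ∈ Lᶜ, ∑ l ∈ L, (1 - adjInd G v l)

lemma card_incompleteVerts_le : ((incompleteVerts G L).card : ℝ) ≤ missing G L := by
  have hterm : ∀ v l, 0 ≤ 1 - adjInd G v l := fun v l => by linarith [adjInd_le_one G v l]
  have hsub : incompleteVerts G L ⊆ Lᶜ := fun v hv =>
    Finset.mem_compl.2 (mem_incompleteVerts.1 hv).1
  calc ((incompleteVerts G L).card : ℝ) = ∑ v ∈ incompleteVerts G L, (1 : ℝ) := by simp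
    _ ≤ ∑ v ∈ incompleteVerts G L, ∑ l ∈ L, (1 - adjInd G v l) := by
        refine Finset.sum_le_sum fun v hv => ?_
        have h := (mem_incompleteVerts.1 hv).2
        push Not at h
        obtain ⟨l, hl, hlv⟩ := h
        have h1 := Finset.single_le_sum (fun l _ => hterm v l) hl
        rwa [adjInd_of_not_adj _ fun h => hlv h.symm, sub_zero] at h1
    _ ≤ _ := Finset.sum_le_sum_of_subset_of_nonneg hsub fun v _ _ =>
        Finset.sum_nonneg fun l _ => hterm v l

lemma completeTo_of_incompleteVerts_eq_empty {V : Type} [Fintype V] {G : SimpleGraph V}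
    {L : Finset V} (h : incompleteVerts G L = ∅) : CompleteTo G L := by
  intro l hl v hv
  by_contra hcon
  have : v ∈ incompleteVerts G L := mem_incompleteVerts.2 ⟨hv, fun h => hcon (h l hl)⟩
  rw [h] at this
  simp at this

/-- Complete neighbours of v are common neighbours of `insert v L`. -/
lemma card_nbrs_inter_completeVerts_le {s : ℕ} (hs : FewCommon G (L.card + 1) s) {v : V}
    (hv : v ∉ L) : (completeVerts G L ∩ nbrs G v).card ≤ s := by
  refine le_trans (Finset.card_le_card ?_)
    (hs (insert v L) (Finset.card_insert_of_notMem hv)).le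
  intro u hu
  obtain ⟨h1, h2⟩ := Finset.mem_inter.1 hu
  rw [mem_commonNbrs]
  intro t ht
  rcases Finset.mem_insert.1 ht with rfl | ht
  · exact mem_nbrs.1 h2
  · exact (mem_completeVerts.1 h1).2 t ht

lemma sum_adjInd_eq_card (v : V) (S : Finset V) :
    ∑ u ∈ S, adjInd G v u = ((S ∩ nbrs G v).card : ℝ) := by
  have h0 : S ∩ nbrs G v = S.filter (· ∈ nbrs G v) := (Finset.filter_mem_eq_inter).symm
  rw [h0, Finset.card_filter]
  push_cast
  refine Finset.sum_congr rfl fun u _ => ?_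
  by_cases h : G.Adj v u <;> simp [adjInd, h, mem_nbrs]

/-- Off `L`, the pairs meeting an incomplete vertex number at most a multiple of the missing
pairs. -/
lemma pairs_off_le {s : ℕ} {c : ℝ} (hs : FewCommon G (L.card + 1) s) (hc : LinSparse G c)
    (hc0 : 0 ≤ c) :
    pairs G Lᶜ Lᶜ ≤ pairs G (completeVerts G L) (completeVerts G L)
      + (2 * s + c) * missing G L := by
  set B := incompleteVerts G L with hB
  set A := completeVerts G L with hA
  have hsub : B ⊆ Lᶜ := fun v hv => Finset.mem_compl.2 (mem_incompleteVerts.1 hv).1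
  have hun : Lᶜ = B ∪ A := (Finset.union_sdiff_of_subset hsub).symm
  rw [hun, pairs_union (show Disjoint B A from Finset.disjoint_sdiff)]
  have h1 : pairs G B A ≤ s * B.card := by
    calc pairs G B A ≤ ∑ b ∈ B, (s : ℝ) := by
          refine Finset.sum_le_sum fun b hb => ?_
          rw [sum_adjInd_eq_card]
          exact_mod_cast card_nbrs_inter_completeVerts_le hs (mem_incompleteVerts.1 hb).1
      _ = _ := by simp [mul_comm]
  have h2 := hc B
  have h3 := card_incompleteVerts_le (G := G) (L := L)
  -- Pairs between `B` and `A` count in both orders, giving 2s; those inside `B` give c.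
  have h4 : (2 * s + c) * (B.card : ℝ) ≤ (2 * s + c) * missing G L := by gcongr
  linarith

lemma pairs_coreGraph_off {A : Finset V} (hA : ∀ a ∈ A, a ∉ L) :
    pairs (coreGraph G L A) Lᶜ Lᶜ = pairs G A A := by
  have hsub : A ⊆ Lᶜ := fun a ha => Finset.mem_compl.2 (hA a ha)
  symm
  unfold pairs
  rw [← Finset.sum_subset hsub]
  · refine Finset.sum_congr rfl fun u hu => ?_
    rw [← Finset.sum_subset hsub]
    · refine Finset.sum_congr rfl fun v hv => adjInd_eq_of_iff ?_
      rw [coreGraph_adj_off (hA u hu) (hA v hv)]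
      simp [hu, hv]
    · intro v hv hvA
      apply adjInd_of_not_adj
      rw [coreGraph_adj_off (hA u hu) (Finset.mem_compl.1 hv)]
      tauto
  · intro u hu huA
    refine Finset.sum_eq_zero fun v hv => ?_
    apply adjInd_of_not_adj
    rw [coreGraph_adj_off (Finset.mem_compl.1 hu) (Finset.mem_compl.1 hv)]
    tauto

lemma offDeg_coreGraph_le {A : Finset V} {s : ℕ} (hs : FewCommon G (L.card + 1) s)
    (hA : A ⊆ completeVerts G L) {v : V} (hv : v ∉ L) :
    ∑ u ∈ Lᶜ, adjInd (coreGraph G L A) v u ≤ s := by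
  rw [sum_adjInd_eq_card]
  have hsub : Lᶜ ∩ nbrs (coreGraph G L A) v ⊆ completeVerts G L ∩ nbrs G v := by
    intro u hu
    obtain ⟨h1, h2⟩ := Finset.mem_inter.1 hu
    rw [mem_nbrs, coreGraph_adj_off hv (Finset.mem_compl.1 h1)] at h2
    exact Finset.mem_inter.2 ⟨hA h2.2.1, mem_nbrs.2 h2.2.2⟩
  exact_mod_cast (Finset.card_le_card hsub).trans (card_nbrs_inter_completeVerts_le hs hv)

end Completion

/-! ### Spectrally extremal graphs: core, completeness, edge count -/

/-- In a graph of maximum spectral radius, `L` is completely joined to its complement as soon as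
the core graph is `𝓕`-free and not too sparse. -/
lemma SPEX.completeTo {𝓕 : GraphFamily} {n s : ℕ} {G : SimpleGraph (Fin n)} (hG : G ∈ SPEX n 𝓕)
    {ρ ε C : ℝ} {x : Fin n → ℝ} {L A : Finset (Fin n)} (hx : IsPerron G ρ x)
    (hρG : adjSpectralRadius G = ENNReal.ofReal ρ) (hρ : 0 ≤ ρ)
    (hxL : ∀ l ∈ L, 1 / 2 ≤ x l) (hxR : ∀ v ∉ L, x v ≤ ε) (hε : 0 ≤ ε)
    (hs : FewCommon G (L.card + 1) s) (hA : A ⊆ completeVerts G L)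
    (hfree : FamilyFree 𝓕 (coreGraph G L A))
    (hC : pairs G Lᶜ Lᶜ - pairs G A A ≤ C * missing G L) (hεC : 4 * ε * C < 1)
    (hn : (2 * (s : ℝ)) ^ 2 < L.card * (n - L.card)) : CompleteTo G L := by
  have hn0 : 0 < n := by
    obtain ⟨v, -⟩ := hx.exists_one
    exact (Nat.zero_le _).trans_lt v.2
  obtain ⟨ρ', hρ', hρeq, hR, y, hy⟩ := exists_perron hn0 (coreGraph G L A)
  have hle : ρ' ≤ ρ := by
    have := hG.2 _ hfree
    rw [hρG, hρeq] at this
    exact (ENNReal.ofReal_le_ofReal_iff hρ).1 this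
  have hcard : (Lᶜ.card : ℝ) = n - L.card := by
    have : L.card + Lᶜ.card = n := by rw [Finset.card_add_card_compl, Fintype.card_fin]
    have h : (L.card : ℝ) + Lᶜ.card = n := by exact_mod_cast this
    linarith
  have hlow := hR.mul_card_le_sq hρ' L coreGraph_completeTo
  rw [hcard] at hlow
  have hbig : 2 * (s : ℝ) < ρ' := by
    have : (2 * (s : ℝ)) ^ 2 < ρ' ^ 2 := hn.trans_le hlow
    exact (sq_lt_sq₀ (by positivity) hρ').1 this
  have hAL : ∀ a ∈ A, a ∉ L := fun a ha => (mem_completeVerts.1 (hA ha)).1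
  refine completeTo_of_le hx hy hle hxL hxR hε coreGraph_completeTo
    (fun u hu v hv => coreGraph_adj_on hu hv)
    (fun u hu v hv h => ((coreGraph_adj_off hu hv).1 h).2.2) (Nat.cast_nonneg s)
    (fun v hv => offDeg_coreGraph_le hs hA hv) hbig ?_ hεC
  rw [pairs_coreGraph_off hAL]
  exact hC

lemma connected_of_split {V : Type} {G : SimpleGraph V} (p : V → Prop) {a b : V} (ha : p a)
    (hb : ¬ p b) (h : ∀ u v, p u → ¬ p v → G.Adj u v) : G.Connected := by
  rw [SimpleGraph.connected_iff_exists_forall_reachable]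
  refine ⟨a, fun v => ?_⟩
  by_cases hv : p v
  · exact (h a b ha hb).reachable.trans (h v b hv hb).symm.reachable
  · exact (h a v ha hv).reachable

lemma card_compl_fin {n : ℕ} (L : Finset (Fin n)) : (Lᶜ.card : ℝ) = n - L.card := by
  have : L.card + Lᶜ.card = n := by rw [Finset.card_add_card_compl, Fintype.card_fin]
  have h : (L.card : ℝ) + Lᶜ.card = n := by exact_mod_cast this
  linarith

lemma FamilyFree.iso {𝓕 : GraphFamily} {V W : Type} {G : SimpleGraph V} {G' : SimpleGraph W}
    (h : FamilyFree 𝓕 G) (e : G ≃g G') : FamilyFree 𝓕 G' := h.of_isContained e.isContained'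

/-- A graph isomorphic to one on `Fin k ⊕ W` can be relabelled so that `Fin k` becomes a given
`k`-set. -/
lemma exists_placement {n k : ℕ} {W : Type} [Fintype W] {P : SimpleGraph (Fin k ⊕ W)}
    {H : SimpleGraph (Fin n)} (e : H ≃g P) (L : Finset (Fin n)) (hL : L.card = k) :
    ∃ (H' : SimpleGraph (Fin n)) (f : P ≃g H'), (∀ a, f (Sum.inl a) ∈ L) ∧
      ∀ b, f (Sum.inr b) ∉ L := by
  classical
  have hcard : Fintype.card (Fin k ⊕ W) = n := by
    rw [← Fintype.card_congr e.toEquiv, Fintype.card_fin]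
  have hcard' : Fintype.card W = Lᶜ.card := by
    have : L.card + Lᶜ.card = n := by rw [Finset.card_add_card_compl, Fintype.card_fin]
    rw [Fintype.card_sum, Fintype.card_fin] at hcard
    omega
  let e₁ := (Finset.equivFinOfCardEq hL).symm
  let e₂ : W ≃ (Lᶜ : Finset (Fin n)) := Fintype.equivOfCardEq (by rw [hcard', Fintype.card_coe])
  let φ : Fin k ⊕ W → Fin n := Sum.elim (fun a => (e₁ a : Fin n)) fun b => (e₂ b : Fin n)
  have h₁ : ∀ a, φ (Sum.inl a) ∈ L := fun a => (e₁ a).2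
  have h₂ : ∀ b, φ (Sum.inr b) ∉ L := fun b => Finset.mem_compl.1 (e₂ b).2
  have hinj : Function.Injective φ := by
    intro u v huv
    rcases u with a | a <;> rcases v with b | b
    · rw [e₁.injective (Subtype.ext huv)]
    · exact absurd (huv ▸ h₁ a) (h₂ b)
    · exact absurd (huv ▸ h₁ b) (h₂ a)
    · rw [e₂.injective (Subtype.ext huv)]
  have hbij : Function.Bijective φ :=
    (Fintype.bijective_iff_injective_and_card φ).2 ⟨hinj, by rw [hcard, Fintype.card_fin]⟩
  let σ := Equiv.ofBijective φ hbij
  exact ⟨P.map σ.toEmbedding, SimpleGraph.Iso.map σ P, h₁, h₂⟩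

lemma dominating_of_placement {n k : ℕ} {W : Type} {X : SimpleGraph W} {H' : SimpleGraph (Fin n)}
    {L : Finset (Fin n)} (f : cliqueJoin k X ≃g H') (h₂ : ∀ b, f (Sum.inr b) ∉ L) :
    Dominating H' L := by
  intro l hl v hv
  obtain ⟨u, rfl⟩ := f.surjective l
  obtain ⟨w, rfl⟩ := f.surjective v
  rw [f.map_adj_iff]
  rcases u with a | b
  · exact cliqueJoin_adj_inl fun e => hv (by rw [e])
  · exact absurd hl (h₂ b)

lemma completeTo_of_placement {n k r : ℕ} {H' : SimpleGraph (Fin n)} {L : Finset (Fin n)}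
    (f : completeBipartiteGraph (Fin k) (Fin r) ≃g H') (h₁ : ∀ a, f (Sum.inl a) ∈ L)
    (h₂ : ∀ b, f (Sum.inr b) ∉ L) : CompleteTo H' L := by
  intro l hl v hv
  obtain ⟨u, rfl⟩ := f.surjective l
  obtain ⟨w, rfl⟩ := f.surjective v
  rw [f.map_adj_iff]
  rcases u with a | b
  · rcases w with a' | b'
    · exact absurd (h₁ a') hv
    · simp
  · exact absurd hl (h₂ b)

/-- Every large graph of maximum spectral radius has a `k`-element core of heavy vertices. -/
lemma exists_spex_core {𝓕 : GraphFamily} {k s n₀ : ℕ} {c : ℝ} (hk : 1 ≤ k) (hc : 1 ≤ c)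
    (hsparse : ∀ (n : ℕ) (G : SimpleGraph (Fin n)), FamilyFree 𝓕 G → LinSparse G c)
    (hs : ∀ (n : ℕ) (G : SimpleGraph (Fin n)), FamilyFree 𝓕 G → FewCommon G (k + 1) s)
    (hH : ∀ n, n₀ ≤ n → ∃ (H : SimpleGraph (Fin n)) (L : Finset (Fin n)), FamilyFree 𝓕 H ∧
      L.card = k ∧ CompleteTo H L) {ε : ℝ} (hε : 0 < ε) :
    ∃ N : ℕ, ∀ n, N ≤ n → ∀ G ∈ SPEX n 𝓕, ∃ (ρ : ℝ) (x : Fin n → ℝ) (L : Finset (Fin n)),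
      IsPerron G ρ x ∧ 0 ≤ ρ ∧ adjSpectralRadius G = ENNReal.ofReal ρ ∧ L.card = k ∧
      (k : ℝ) * (n - k) ≤ ρ ^ 2 ∧ (∀ l ∈ L, 1 - ε ≤ x l) ∧ (∀ v ∉ L, x v ≤ ε) ∧
      ((incompleteVerts G L).card : ℝ) ≤ ε * n := by
  obtain ⟨n₁, hcore⟩ := exists_core k s hk c ε hc hε
  refine ⟨max (max n₀ n₁) 1, fun n hn G hG => ?_⟩
  have hn0 : n₀ ≤ n := le_trans (le_trans (le_max_left _ _) (le_max_left _ _)) hn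
  have hn1 : n₁ ≤ n := le_trans (le_trans (le_max_right _ _) (le_max_left _ _)) hn
  have hn2 : 0 < n := lt_of_lt_of_le one_pos (le_trans (le_max_right _ _) hn)
  obtain ⟨ρ, hρ, hρeq, -, x, hx⟩ := exists_perron hn2 G
  obtain ⟨H, L₀, hfree, hL₀, hcompl⟩ := hH n hn0
  obtain ⟨ρ', hρ', hρeq', hR, -⟩ := exists_perron hn2 H
  have hle : ρ' ≤ ρ := by
    have := hG.2 _ hfree
    rw [hρeq, hρeq'] at this
    exact (ENNReal.ofReal_le_ofReal_iff hρ).1 this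
  have hlow : (k : ℝ) * (n - k) ≤ ρ ^ 2 := by
    have := hR.mul_card_le_sq hρ' L₀ hcompl
    rw [card_compl_fin, hL₀] at this
    exact this.trans (pow_le_pow_left₀ hρ' hle 2)
  obtain ⟨L, hL1, hL2, hL3, hL4⟩ := hcore (Fin n) G ρ x (by simpa using hn1) hx hρ
    (by simpa using hlow) (hsparse n G hG.1) (hs n G hG.1)
  exact ⟨ρ, x, L, hx, hρ, hρeq, hL1, hlow, hL2, hL3, by simpa using hL4⟩

/-- Off `L`, the complete vertices span few pairs. -/
lemma ConnBound.core_le {𝓕 : GraphFamily} {h : ℕ → ℝ} {n₀ n : ℕ} (hb : ConnBound 𝓕 h n₀)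
    {G : SimpleGraph (Fin n)} (hG : FamilyFree 𝓕 G) {L : Finset (Fin n)} (hL : L.Nonempty)
    (hA : (completeVerts G L).Nonempty) (hn : n₀ ≤ L.card + (completeVerts G L).card) :
    pairs G L L + 2 * L.card * ((completeVerts G L).card : ℝ)
      + pairs G (completeVerts G L) (completeVerts G L) ≤ h (L.card + (completeVerts G L).card) := by
  set A := completeVerts G L with hAdef
  have hdis : Disjoint L A := by
    rw [Finset.disjoint_right]
    exact fun a ha => (mem_completeVerts.1 ha).1
  have hcard : (L ∪ A).card = L.card + A.card := Finset.card_union_of_disjoint hdis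
  obtain ⟨l, hl⟩ := hL
  obtain ⟨a, ha⟩ := hA
  -- `G` itself need not be connected, but this induced subgraph is, so the edge bound applies to
  -- it.
  have hconn : (G.induce ((L ∪ A : Finset (Fin n)) : Set (Fin n))).Connected := by
    refine connected_of_split (fun v => (v : Fin n) ∈ L)
      (a := ⟨l, Finset.mem_coe.2 (Finset.mem_union_left _ hl)⟩)
      (b := ⟨a, Finset.mem_coe.2 (Finset.mem_union_right _ ha)⟩) hl
      (mem_completeVerts.1 ha).1 ?_
    intro u v hu hv
    have hvA : (v : Fin n) ∈ A := (Finset.mem_union.1 (Finset.mem_coe.1 v.2)).resolve_left hv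
    exact (mem_completeVerts.1 hvA).2 _ hu
  have := hb.le_card_induce hG (L ∪ A) (by rw [hcard]; exact hn) hconn
  rw [hcard, pairs_union hdis,
    pairs_eq_card_mul fun u hu v hv => (mem_completeVerts.1 hv).2 u hu] at this
  linarith

/-- If every `H n` is a join `K_k + X` with `e(X) < (3/4) n`, then any large spectrally extremal
graph with a complete core has at least as many edges as `H n`. -/
theorem le_pairs_of_completeTo {𝓕 : GraphFamily} {k s n₀ : ℕ} {Q C : ℝ}
    {H : ∀ n : ℕ, SimpleGraph (Fin n)} (hk : 1 ≤ k) (hQ : Q < 3 / 4) (hC0 : 0 ≤ C)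
    (hb : ConnBound 𝓕 (fun n => pairs (H n) Finset.univ Finset.univ) n₀)
    (hfree : ∀ n, n₀ ≤ n → FamilyFree 𝓕 (H n))
    (hs : ∀ (n : ℕ) (G : SimpleGraph (Fin n)), FamilyFree 𝓕 G → FewCommon G (k + 1) s)
    (hjoin : ∀ n, n₀ ≤ n → ∃ (W : Type) (_ : Fintype W) (X : SimpleGraph W),
      Nonempty (H n ≃g cliqueJoin k X) ∧ pairs X Finset.univ Finset.univ ≤ 2 * Q * n + C) :
    ∃ N : ℕ, ∀ n, N ≤ n → ∀ G ∈ SPEX n 𝓕, ∀ (ρ : ℝ) (x : Fin n → ℝ) (L : Finset (Fin n)),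
      IsPerron G ρ x → 0 ≤ ρ → adjSpectralRadius G = ENNReal.ofReal ρ → L.card = k →
      (k : ℝ) * (n - k) ≤ ρ ^ 2 → (∀ l ∈ L, 1 / 2 ≤ x l) → CompleteTo G L →
      pairs (H n) Finset.univ Finset.univ ≤ pairs G Finset.univ Finset.univ := by
  have hh : ∀ n : ℕ, n₀ ≤ n → k ≤ n → pairs (H n) Finset.univ Finset.univ
      ≤ k * (k - 1) + 2 * k * (n - k) + 2 * Q * n + C := by
    intro n hn hkn
    obtain ⟨W, _, X, ⟨e⟩, hX⟩ := hjoin n hn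
    have hcard : k + Fintype.card W = n := by
      have := Fintype.card_congr e.toEquiv
      simpa using this.symm
    rw [pairs_univ_iso e, pairs_cliqueJoin]
    have : (Fintype.card W : ℝ) = n - k := by rw [← hcard]; push_cast; ring
    rw [this]
    linarith
  obtain ⟨K, hK0, hK⟩ := moment_bounds hb hk hQ hh s
  -- The thresholds of `Dominating.lt_of_pairs` and `CompleteTo.lt_of_missing` with D = s and E =
  -- 2(2+C). Since both squared radii are at least n/2, taking n ≥ 2T² brings both radii up to `T`.
  obtain ⟨T, hT⟩ := exists_nat_gt (max (max (2 * (2 * K + (s : ℝ) ^ 4) + 2)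
    (4 * (k : ℝ) ^ 2 * ((s : ℝ) * (2 * (2 + C)) + 1) + 2 * (s : ℝ) + 1)) (k : ℝ) : ℝ)
  refine ⟨max (max n₀ (2 * k + 1)) (2 * T ^ 2), fun n hn G hG ρ x L hx hρ hρG hLk hρk hxL hL => ?_⟩
  have hn0 : n₀ ≤ n := le_trans (le_trans (le_max_left _ _) (le_max_left _ _)) hn
  have hn1 : 2 * k + 1 ≤ n := le_trans (le_trans (le_max_right _ _) (le_max_left _ _)) hn
  have hn2 : 2 * T ^ 2 ≤ n := le_trans (le_max_right _ _) hn
  have hkR : (1 : ℝ) ≤ k := by exact_mod_cast hk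
  have hn1R : 2 * (k : ℝ) + 1 ≤ n := by exact_mod_cast hn1
  have hn2R : 2 * (T : ℝ) ^ 2 ≤ n := by exact_mod_cast hn2
  have hhalf : ∀ z : ℝ, (k : ℝ) * (n - k) ≤ z → (n : ℝ) / 2 ≤ z := by
    intro z hz
    have : (n : ℝ) - k ≤ k * (n - k) := le_mul_of_one_le_left (by linarith) hkR
    linarith
  have hlarge : ∀ z : ℝ, 0 ≤ z → (k : ℝ) * (n - k) ≤ z ^ 2 → (T : ℝ) ≤ z := by
    intro z hz0 hz
    have := hhalf _ hz
    exact (sq_le_sq₀ (Nat.cast_nonneg _) hz0).1 (by linarith)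
  obtain ⟨hT1, hT3⟩ := max_lt_iff.1 hT
  obtain ⟨hT1, hT2⟩ := max_lt_iff.1 hT1
  have hTρ := hlarge ρ hρ hρk
  -- relabel the extremal graph
  obtain ⟨W, _, X, ⟨e⟩, hX⟩ := hjoin n hn0
  obtain ⟨H', f, h₁, h₂⟩ := exists_placement e L hLk
  have hdom : Dominating H' L := dominating_of_placement f h₂
  have hH'free : FamilyFree 𝓕 H' := (hfree n hn0).iso (e.trans f)
  have hpairs : pairs H' Finset.univ Finset.univ = pairs (H n) Finset.univ Finset.univ :=
    (pairs_univ_iso (e.trans f)).symm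
  have hnpos : 0 < n := by omega
  obtain ⟨ρ', hρ', hρeq', hR', y, hy⟩ := exists_perron hnpos H'
  have hle : ρ' ≤ ρ := by
    have := hG.2 _ hH'free
    rw [hρG, hρeq'] at this
    exact (ENNReal.ofReal_le_ofReal_iff hρ).1 this
  have hρk' : (k : ℝ) * (n - k) ≤ ρ' ^ 2 := by
    have := hR'.mul_card_le_sq hρ' L hdom.completeTo
    rwa [card_compl_fin, hLk] at this
  have hTρ' := hlarge ρ' hρ' hρk'
  have hρ'pos : 0 < ρ' := by linarith
  have hLne : L.Nonempty := Finset.card_pos.1 (by omega)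
  have hnbr : ∀ v ∉ L, (offNbrs G L v).card ≤ s := by
    intro v hv
    have hs' := hs n G hG.1
    rw [← hLk] at hs'
    refine le_trans (Finset.card_le_card ?_) (card_nbrs_inter_completeVerts_le hs' hv)
    intro u hu
    obtain ⟨h3, h4⟩ := mem_offNbrs.1 hu
    exact Finset.mem_inter.2 ⟨mem_completeVerts.2 ⟨h4, fun l hl => hL l hl u h4⟩, mem_nbrs.2 h3⟩
  have hdeg : ∀ v ∉ L, offDeg G L v ≤ s := fun v hv => by
    rw [offDeg_eq_card]; exact_mod_cast hnbr v hv
  by_contra hcon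
  -- Ordered pairs count edges twice, so a strict deficit is at least 2.
  have hgap : pairs G Finset.univ Finset.univ + 2 ≤ pairs H' Finset.univ Finset.univ := by
    rw [← two_mul_ncard_edgeSet, ← two_mul_ncard_edgeSet] at hcon
    rw [hpairs, ← two_mul_ncard_edgeSet, ← two_mul_ncard_edgeSet]
    have h3 : (G.edgeSet.ncard : ℝ) < ((H n).edgeSet.ncard : ℝ) := by linarith
    have h4 : G.edgeSet.ncard + 1 ≤ (H n).edgeSet.ncard := by exact_mod_cast h3
    have h5 : (G.edgeSet.ncard : ℝ) + 1 ≤ ((H n).edgeSet.ncard : ℝ) := by exact_mod_cast h4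
    linarith
  rw [hL.pairs_univ, hdom.completeTo.pairs_univ, hdom.pairs_on] at hgap
  by_cases hGdom : Dominating G L
  · rw [hGdom.pairs_on] at hgap
    obtain ⟨m2, m3⟩ := hK (Fin n) G H' L hLk hGdom hdom hG.1 hnbr (by simpa using hn0)
      (by rw [hpairs, Fintype.card_fin]) (by linarith)
    have := hGdom.lt_of_pairs hdom hx hy hLne hρ'pos hK0 (Nat.cast_nonneg s) hdeg (by linarith)
      m2 m3 (by linarith)
    linarith
  · have hmiss : pairs G L L + 1 ≤ L.card * (L.card - 1) := by
      unfold Dominating at hGdom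
      push Not at hGdom
      obtain ⟨l, hl, v, hvl, hnadj⟩ := hGdom
      have hv : v ∈ L := by
        by_contra hv
        exact hnadj (hL l hl v hv)
      rw [← hdom.pairs_on]
      unfold pairs
      have hle' : ∀ u ∈ L, ∑ w ∈ L, adjInd G u w ≤ ∑ w ∈ L, adjInd H' u w := by
        intro u hu
        refine Finset.sum_le_sum fun w _ => ?_
        by_cases huw : u = w
        · rw [huw, adjInd_self, adjInd_self]
        · rw [adjInd_of_adj H' (hdom u hu w (Ne.symm huw))]; exact adjInd_le_one _ _ _
      rw [← Finset.add_sum_erase _ _ hl,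
        ← Finset.add_sum_erase _ (fun u => ∑ w ∈ L, adjInd H' u w) hl]
      have hlt : ∑ w ∈ L, adjInd G l w + 1 ≤ ∑ w ∈ L, adjInd H' l w := by
        rw [← Finset.add_sum_erase _ _ hv, ← Finset.add_sum_erase _ (adjInd H' l) hv,
          adjInd_of_not_adj _ hnadj, adjInd_of_adj _ (hdom l hl v hvl)]
        have : ∑ w ∈ L.erase v, adjInd G l w ≤ ∑ w ∈ L.erase v, adjInd H' l w := by
          refine Finset.sum_le_sum fun w _ => ?_
          by_cases huw : l = w
          · rw [huw, adjInd_self, adjInd_self]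
          · rw [adjInd_of_adj H' (hdom l hl w (Ne.symm huw))]; exact adjInd_le_one _ _ _
        linarith
      have hrest : ∑ u ∈ L.erase l, ∑ w ∈ L, adjInd G u w
          ≤ ∑ u ∈ L.erase l, ∑ w ∈ L, adjInd H' u w :=
        Finset.sum_le_sum fun u hu => hle' u (Finset.mem_of_mem_erase hu)
      linarith
    have hXbound : pairs H' Lᶜ Lᶜ ≤ 2 * (2 + C) * ρ ^ 2 := by
      have h3 := hh n hn0 (by omega)
      rw [← hpairs, hdom.completeTo.pairs_univ, hdom.pairs_on, card_compl_fin, hLk] at h3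
      have h4 := hhalf _ hρk
      have h5 : 2 * Q * (n : ℝ) ≤ 2 * n := by
        have : (0 : ℝ) ≤ n := Nat.cast_nonneg _
        have := mul_le_mul_of_nonneg_right hQ.le this
        linarith
      have h6 : C ≤ C * n := le_mul_of_one_le_right hC0 (by linarith)
      have h7 : (2 + C) * ((n : ℝ) / 2) ≤ (2 + C) * ρ ^ 2 := by gcongr
      linarith
    have := hL.lt_of_missing hdom hx hy hLne hρ'pos (by rw [hLk]; linarith) (Nat.cast_nonneg s)
      (by positivity : 0 ≤ 2 * (2 + C)) hdeg hxL hmiss (by linarith) hXbound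
      (by rw [hLk]; linarith)
    linarith

lemma ConnBound.mono {𝓕 : GraphFamily} {h : ℕ → ℝ} {n₀ n₁ : ℕ} (hb : ConnBound 𝓕 h n₀)
    (hn : n₀ ≤ n₁) : ConnBound 𝓕 h n₁ := fun n h1 => hb n (hn.trans h1)

/-- A linear edge bound with slope below `k + 1` makes all `𝓕`-free graphs sparse, with few common
neighbours of `k + 1` vertices. -/
lemma ConnBound.exists_sparse_few {𝓕 : GraphFamily} {h : ℕ → ℝ} {n₀ k : ℕ} {Q C : ℝ}
    (hb : ConnBound 𝓕 h n₀) (hQ : Q < 1) (hh : ∀ n : ℕ, n₀ ≤ n → h n ≤ 2 * (k + Q) * n + C) :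
    ∃ (s : ℕ) (c : ℝ), 1 ≤ c ∧
      (∀ (n : ℕ) (G : SimpleGraph (Fin n)), FamilyFree 𝓕 G → LinSparse G c) ∧
      ∀ (V : Type) [Fintype V] (G : SimpleGraph V), FamilyFree 𝓕 G → FewCommon G (k + 1) s := by
  obtain ⟨s, -, hs⟩ := hb.exists_not_free_bipartite hQ hh
  -- The term n₀ + 1 takes care of small sets, the rest of the slope and the additive constant.
  refine ⟨s, n₀ + 1 + (2 * (k + 1) + |C|), ?_, fun n G hG => ?_,
    fun V _ G hG => hG.fewCommon hs⟩
  · have : (0 : ℝ) ≤ n₀ := Nat.cast_nonneg _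
    have : (0 : ℝ) ≤ k := Nat.cast_nonneg _
    have := abs_nonneg C
    linarith
  · have h0 : (0 : ℝ) ≤ n₀ := Nat.cast_nonneg _
    have h1 : (0 : ℝ) ≤ k := Nat.cast_nonneg _
    have h2 := abs_nonneg C
    refine (hb.mono (Nat.le_succ n₀)).linSparse (by push_cast; linarith) (fun n hn => ?_) hG
    refine (hh n (by omega)).trans ?_
    have h3 : (1 : ℝ) ≤ n := by exact_mod_cast (show 1 ≤ n by omega)
    have h4 : C ≤ |C| * n := (le_abs_self C).trans (le_mul_of_one_le_right h2 h3)
    have h5 : 2 * (k + Q) * (n : ℝ) ≤ 2 * (k + 1) * n := by gcongr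
    have h6 : 0 ≤ ((n₀ : ℝ) + 1) * n := by positivity
    linarith

/-- If passing to some `𝓕`-free core graph costs few pairs, large spectrally extremal graphs have a
complete core. -/
lemma exists_completeTo {𝓕 : GraphFamily} {k s n₀ : ℕ} {c C : ℝ} (hk : 1 ≤ k) (hc : 1 ≤ c)
    (hsparse : ∀ (n : ℕ) (G : SimpleGraph (Fin n)), FamilyFree 𝓕 G → LinSparse G c)
    (hs : ∀ (n : ℕ) (G : SimpleGraph (Fin n)), FamilyFree 𝓕 G → FewCommon G (k + 1) s)
    (hH : ∀ n, n₀ ≤ n → ∀ L : Finset (Fin n), L.card = k → ∃ H : SimpleGraph (Fin n),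
      FamilyFree 𝓕 H ∧ CompleteTo H L) (hC : 0 ≤ C)
    (hcore : ∀ n, n₀ ≤ n → ∀ G : SimpleGraph (Fin n), FamilyFree 𝓕 G → ∀ L : Finset (Fin n),
      L.card = k → (incompleteVerts G L).Nonempty → 2 * ((incompleteVerts G L).card : ℝ) ≤ n →
      ∃ A ⊆ completeVerts G L, FamilyFree 𝓕 (coreGraph G L A) ∧
        pairs G Lᶜ Lᶜ - pairs G A A ≤ C * missing G L) :
    ∃ N : ℕ, ∀ n, N ≤ n → ∀ G ∈ SPEX n 𝓕, ∃ (ρ : ℝ) (x : Fin n → ℝ) (L : Finset (Fin n)),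
      IsPerron G ρ x ∧ 0 ≤ ρ ∧ adjSpectralRadius G = ENNReal.ofReal ρ ∧ L.card = k ∧
      (k : ℝ) * (n - k) ≤ ρ ^ 2 ∧ (∀ l ∈ L, 1 / 2 ≤ x l) ∧ CompleteTo G L := by
  have hH' : ∀ n, max n₀ k ≤ n → ∃ (H : SimpleGraph (Fin n)) (L : Finset (Fin n)),
      FamilyFree 𝓕 H ∧ L.card = k ∧ CompleteTo H L := by
    intro n hn
    obtain ⟨L, -, hL⟩ := Finset.exists_subset_card_eq
      (show k ≤ (Finset.univ : Finset (Fin n)).card by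
        rw [Finset.card_univ, Fintype.card_fin]; exact le_trans (le_max_right _ _) hn)
    obtain ⟨H, h1, h2⟩ := hH n (le_trans (le_max_left _ _) hn) L hL
    exact ⟨H, L, h1, hL, h2⟩
  -- This ε gives 4εC < 1, as the exchange argument requires, and ε ≤ 1/8, so that core weights
  -- exceed 1/2 and at most half the vertices are incomplete.
  have hεpos : (0 : ℝ) < 1 / (8 * (C + 1)) := by positivity
  have hε8 : 1 / (8 * (C + 1)) ≤ 1 / 8 := by
    apply one_div_le_one_div_of_le <;> linarith
  have hεC : 4 * (1 / (8 * (C + 1))) * C < 1 := by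
    have : 4 * (1 / (8 * (C + 1))) * C = C / (2 * (C + 1)) := by field_simp; ring
    rw [this, div_lt_one (by positivity)]
    linarith
  set ε := 1 / (8 * (C + 1)) with hε
  obtain ⟨N, hN⟩ := exists_spex_core hk hc hsparse hs hH' hεpos
  refine ⟨max (max N n₀) ((2 * s) ^ 2 + k + 1), fun n hn G hG => ?_⟩
  have hn1 : N ≤ n := le_trans (le_trans (le_max_left _ _) (le_max_left _ _)) hn
  have hn2 : n₀ ≤ n := le_trans (le_trans (le_max_right _ _) (le_max_left _ _)) hn
  have hn3 : (2 * s) ^ 2 + k + 1 ≤ n := le_trans (le_max_right _ _) hn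
  obtain ⟨ρ, x, L, hx, hρ, hρG, hL, hlow, hxL, hxR, hB⟩ := hN n hn1 G hG
  have hxL' : ∀ l ∈ L, 1 / 2 ≤ x l := fun l hl => by linarith [hxL l hl]
  refine ⟨ρ, x, L, hx, hρ, hρG, hL, hlow, hxL', ?_⟩
  rcases (incompleteVerts G L).eq_empty_or_nonempty with h0 | h0
  · exact completeTo_of_incompleteVerts_eq_empty h0
  have hB' : 2 * ((incompleteVerts G L).card : ℝ) ≤ n := by
    have : ε * (n : ℝ) ≤ 1 / 8 * n := by gcongr
    have : (0 : ℝ) ≤ n := Nat.cast_nonneg _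
    linarith
  obtain ⟨A, hA, hfree, hCA⟩ := hcore n hn2 G hG.1 L hL h0 hB'
  refine SPEX.completeTo hG hx hρG hρ hxL' hxR hεpos.le (by rw [hL]; exact hs n G hG.1) hA hfree
    hCA hεC ?_
  rw [hL]
  have h3 : (2 * (s : ℝ)) ^ 2 + k + 1 ≤ n := by exact_mod_cast hn3
  have hkR : (1 : ℝ) ≤ k := by exact_mod_cast hk
  have : (n : ℝ) - k ≤ k * (n - k) :=
    le_mul_of_one_le_left (by have := sq_nonneg (2 * (s : ℝ)); linarith) hkR
  linarith

lemma card_completeVerts {n : ℕ} (G : SimpleGraph (Fin n)) (L : Finset (Fin n)) :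
    L.card + (completeVerts G L).card + (incompleteVerts G L).card = n := by
  have hsub : incompleteVerts G L ⊆ Lᶜ := fun v hv =>
    Finset.mem_compl.2 (mem_incompleteVerts.1 hv).1
  have h1 := Finset.card_sdiff_add_card_eq_card hsub
  have h2 : L.card + Lᶜ.card = n := by rw [Finset.card_add_card_compl, Fintype.card_fin]
  rw [completeVerts]
  omega

/-- For a finite family the complete vertices carry an `𝓕`-free core graph. -/
lemma exists_core_of_finite {𝓕 : GraphFamily} {k s : ℕ} {c : ℝ} (hfin : 𝓕.Finite) (hc : 0 ≤ c)
    (hsparse : ∀ (n : ℕ) (G : SimpleGraph (Fin n)), FamilyFree 𝓕 G → LinSparse G c)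
    (hs : ∀ (n : ℕ) (G : SimpleGraph (Fin n)), FamilyFree 𝓕 G → FewCommon G (k + 1) s) :
    ∃ n₀ : ℕ, ∀ n, n₀ ≤ n → ∀ G : SimpleGraph (Fin n), FamilyFree 𝓕 G → ∀ L : Finset (Fin n),
      L.card = k → 2 * ((incompleteVerts G L).card : ℝ) ≤ n →
      ∃ A ⊆ completeVerts G L, FamilyFree 𝓕 (coreGraph G L A) ∧
        pairs G Lᶜ Lᶜ - pairs G A A ≤ (2 * s + c) * missing G L := by
  obtain ⟨m, hm⟩ := (hfin.image Sigma.fst).bddAbove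
  refine ⟨2 * (k + 2 * m), fun n hn G hG L hL hB => ⟨completeVerts G L, subset_rfl, ?_, ?_⟩⟩
  · refine hG.coreGraph (fun F hF => hm ⟨F, hF, rfl⟩) (fun a ha => mem_completeVerts.1 ha) ?_
    have h1 := card_completeVerts G L
    have h2 : 2 * (incompleteVerts G L).card ≤ n := by exact_mod_cast hB
    omega
  · have := pairs_off_le (by rw [hL]; exact hs n G hG) (hsparse n G hG) hc
    linarith

/-- If `H n` has only boundedly many pairs besides those of `K_{k,n-k}`, deleting everything off
the core keeps the graph `𝓕`-free. -/
lemma exists_core_of_pairs_le {𝓕 : GraphFamily} {h : ℕ → ℝ} {k s n₀ : ℕ} {c M : ℝ} (hk : 1 ≤ k)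
    (hb : ConnBound 𝓕 h n₀) (hc : 0 ≤ c) (hM : 0 ≤ M)
    (hsparse : ∀ (n : ℕ) (G : SimpleGraph (Fin n)), FamilyFree 𝓕 G → LinSparse G c)
    (hs : ∀ (n : ℕ) (G : SimpleGraph (Fin n)), FamilyFree 𝓕 G → FewCommon G (k + 1) s)
    (hh : ∀ n : ℕ, n₀ ≤ n → h n ≤ 2 * k * (n - k) + M)
    (hH : ∀ n, n₀ ≤ n → ∀ L : Finset (Fin n), L.card = k → ∃ H : SimpleGraph (Fin n),
      FamilyFree 𝓕 H ∧ CompleteTo H L ∧ (M = 0 ∨ Dominating H L)) :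
    ∃ n₁ : ℕ, ∀ n, n₁ ≤ n → ∀ G : SimpleGraph (Fin n), FamilyFree 𝓕 G → ∀ L : Finset (Fin n),
      L.card = k → (incompleteVerts G L).Nonempty → 2 * ((incompleteVerts G L).card : ℝ) ≤ n →
      ∃ A ⊆ completeVerts G L, FamilyFree 𝓕 (coreGraph G L A) ∧
        pairs G Lᶜ Lᶜ - pairs G A A ≤ (2 * s + c + M) * missing G L := by
  refine ⟨max n₀ (2 * (n₀ + k + 1)), fun n hn G hG L hL hne hB => ?_⟩
  have hn0 : n₀ ≤ n := le_trans (le_max_left _ _) hn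
  have hn1 : 2 * (n₀ + k + 1) ≤ n := le_trans (le_max_right _ _) hn
  have hcard := card_completeVerts G L
  have hB' : 2 * (incompleteVerts G L).card ≤ n := by exact_mod_cast hB
  -- The edge bound on `L` and the complete vertices leaves at most M pairs besides those joining
  -- the two sets.
  have hle := hb.core_le hG (L := L) (Finset.card_pos.1 (by omega)) (Finset.card_pos.1 (by omega))
    (by omega)
  have hle' := hle.trans (hh _ (by omega))
  rw [hL] at hle'
  push_cast at hle'
  have hLL := pairs_nonneg (G := G) L L
  have hAA := pairs_nonneg (G := G) (completeVerts G L) (completeVerts G L)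
  -- Nothing is kept off `L`, so the core graph lies in a copy of the extremal graph placed on `L`.
  -- If M = 0, `L` is independent; otherwise `L` dominates that copy.
  refine ⟨∅, Finset.empty_subset _, ?_, ?_⟩
  · obtain ⟨H, hHfree, hHc, hHd⟩ := hH n hn0 L hL
    refine hHfree.of_isContained (SimpleGraph.IsContained.of_le fun u v huv => ?_)
    rcases huv with ⟨hu, hv, huv⟩ | ⟨hu, hv⟩ | ⟨hu, hv⟩ | ⟨_, _, hu, _⟩
    · rcases hHd with h0 | hd
      · exfalso
        have h1 : adjInd G u v ≤ pairs G L L :=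
          (Finset.single_le_sum (fun w _ => adjInd_nonneg G u w) hv).trans
            (Finset.single_le_sum (f := fun u => ∑ w ∈ L, adjInd G u w)
              (fun w _ => Finset.sum_nonneg fun _ _ => adjInd_nonneg G _ _) hu)
        rw [adjInd_of_adj _ huv] at h1
        linarith
      · exact hd u hu v huv.ne.symm
    · exact hHc u hu v hv
    · exact (hHc v hv u hu).symm
    · simp at hu
  · have h1 := pairs_off_le (by rw [hL]; exact hs n G hG) (hsparse n G hG) hc
    -- An incomplete vertex supplies a missing pair, which pays for deleting the M remaining pairs.
    have h2 : (1 : ℝ) ≤ missing G L :=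
      le_trans (by exact_mod_cast hne.card_pos) (card_incompleteVerts_le (G := G) (L := L))
    have h3 : M ≤ M * missing G L := le_mul_of_one_le_right hM h2
    have h4 : pairs G ∅ ∅ = 0 := by simp [pairs]
    rw [h4]
    linarith

lemma CompleteTo.connected {n : ℕ} {G : SimpleGraph (Fin n)} {L : Finset (Fin n)}
    (h : CompleteTo G L) (h1 : 1 ≤ L.card) (h2 : L.card < n) : G.Connected := by
  obtain ⟨a, ha⟩ := Finset.card_pos.1 h1
  obtain ⟨b, hb⟩ : (Lᶜ).Nonempty := Finset.card_pos.1 (by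
    rw [Finset.card_compl, Fintype.card_fin]; omega)
  exact connected_of_split (· ∈ L) ha (Finset.mem_compl.1 hb) fun u v hu hv => h u hu v hv

/-! ### The individual cases and the conclusion -/

/-- `H n` is `𝓕`-free and has the most edges among connected `𝓕`-free graphs, for large `n`. -/
def EdgeExtremal (𝓕 : GraphFamily) (H : ∀ n : ℕ, SimpleGraph (Fin n)) : Prop :=
  ∀ᶠ n in atTop, FamilyFree 𝓕 (H n) ∧ ∀ G : SimpleGraph (Fin n), G.Connected → FamilyFree 𝓕 G →
    pairs G Finset.univ Finset.univ ≤ pairs (H n) Finset.univ Finset.univ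

/-- Large spectrally extremal graphs are connected, with at least as many edges as `H n`. -/
def SpexDominates (𝓕 : GraphFamily) (H : ∀ n : ℕ, SimpleGraph (Fin n)) : Prop :=
  ∀ᶠ n in atTop, ∀ G ∈ SPEX n 𝓕, G.Connected ∧
    pairs (H n) Finset.univ Finset.univ ≤ pairs G Finset.univ Finset.univ

/-- For large `n`, the graph `H n` is a join `K_k + X` with `2 e(X) ≤ 2 Q n + C`. -/
def JoinForm (k : ℕ) (H : ∀ n : ℕ, SimpleGraph (Fin n)) (Q C : ℝ) : Prop :=
  ∀ᶠ n : ℕ in atTop, ∃ (W : Type) (_ : Fintype W) (X : SimpleGraph W),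
    Nonempty (H n ≃g cliqueJoin k X) ∧ pairs X Finset.univ Finset.univ ≤ 2 * Q * n + C

section Cases

variable {𝓕 : GraphFamily} {k : ℕ} {H : ∀ n : ℕ, SimpleGraph (Fin n)}

lemma EdgeExtremal.exists_bound (h : EdgeExtremal 𝓕 H) {p : ℕ → Prop} (hp : ∀ᶠ n in atTop, p n) :
    ∃ n₀, ConnBound 𝓕 (fun n => pairs (H n) Finset.univ Finset.univ) n₀ ∧
      (∀ n, n₀ ≤ n → FamilyFree 𝓕 (H n)) ∧ (∀ n, n₀ ≤ n → p n) ∧ ∀ n, n₀ ≤ n → k < n := by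
  obtain ⟨n₀, hn₀⟩ := eventually_atTop.1 ((h.and hp).and (eventually_gt_atTop k))
  exact ⟨n₀, fun n hn => (hn₀ n hn).1.1.2, fun n hn => (hn₀ n hn).1.1.1,
    fun n hn => (hn₀ n hn).1.2, fun n hn => (hn₀ n hn).2⟩

lemma pairs_of_iso_cliqueJoin {n : ℕ} {G : SimpleGraph (Fin n)} {W : Type} [Fintype W]
    {X : SimpleGraph W} (e : G ≃g cliqueJoin k X) :
    pairs G Finset.univ Finset.univ
      = k * (k - 1) + 2 * k * (n - k) + pairs X Finset.univ Finset.univ := by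
  have hcard : k + Fintype.card W = n := by
    have := Fintype.card_congr e.toEquiv
    simpa using this.symm
  rw [pairs_univ_iso e, pairs_cliqueJoin, ← hcard]
  push_cast
  ring

lemma pairs_le_of_iso_cliqueJoin {n : ℕ} {G : SimpleGraph (Fin n)} {W : Type} [Fintype W]
    {X : SimpleGraph W} (e : G ≃g cliqueJoin k X) {Q C : ℝ}
    (hX : pairs X Finset.univ Finset.univ ≤ 2 * Q * n + C) :
    pairs G Finset.univ Finset.univ ≤ 2 * (k + Q) * n + C := by
  rw [pairs_of_iso_cliqueJoin e]
  have h1 : (0 : ℝ) ≤ k := Nat.cast_nonneg _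
  have h2 : 0 ≤ (k : ℝ) ^ 2 := sq_nonneg _
  linarith

/-- Join-shaped extremal graphs are beaten only by spectral extremal graphs with as many edges. -/
lemma spexDominates_of_joinForm (hk : 1 ≤ k) (h : EdgeExtremal 𝓕 H) {Q C : ℝ} (hQ : Q < 3 / 4)
    (hC : 0 ≤ C) (hj : JoinForm k H Q C) (hcase : 𝓕.Finite ∨ Q = 0) : SpexDominates 𝓕 H := by
  obtain ⟨n₀, hb, hfree, hjoin, hkn⟩ := h.exists_bound (k := k) hj
  obtain ⟨s, c, hc, hsparse, hs⟩ := hb.exists_sparse_few (k := k) (Q := Q) (C := C) (by linarith)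
    (fun n hn => by
      obtain ⟨W, _, X, ⟨e⟩, hX⟩ := hjoin n hn
      exact pairs_le_of_iso_cliqueJoin e hX)
  have hs' : ∀ (n : ℕ) (G : SimpleGraph (Fin n)), FamilyFree 𝓕 G → FewCommon G (k + 1) s :=
    fun n G => hs (Fin n) G
  have hplace : ∀ n, n₀ ≤ n → ∀ L : Finset (Fin n), L.card = k → ∃ H' : SimpleGraph (Fin n),
      FamilyFree 𝓕 H' ∧ Dominating H' L := by
    intro n hn L hL
    obtain ⟨W, _, X, ⟨e⟩, -⟩ := hjoin n hn
    obtain ⟨H', f, -, h₂⟩ := exists_placement e L hL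
    exact ⟨H', (hfree n hn).iso (e.trans f), dominating_of_placement f h₂⟩
  have hcore : ∃ (C₁ : ℝ) (n₁ : ℕ), 0 ≤ C₁ ∧ ∀ n, n₁ ≤ n → ∀ G : SimpleGraph (Fin n),
      FamilyFree 𝓕 G → ∀ L : Finset (Fin n), L.card = k → (incompleteVerts G L).Nonempty →
      2 * ((incompleteVerts G L).card : ℝ) ≤ n → ∃ A ⊆ completeVerts G L,
        FamilyFree 𝓕 (coreGraph G L A) ∧ pairs G Lᶜ Lᶜ - pairs G A A ≤ C₁ * missing G L := by
    -- A finite family permits keeping the edges among complete vertices. For Q = 0 these are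
    -- boundedly many and can all be deleted, so infinite families are covered.
    rcases hcase with hfin | rfl
    · obtain ⟨n₁, hn₁⟩ := exists_core_of_finite hfin (by linarith) hsparse hs'
      exact ⟨2 * s + c, n₁, by positivity, fun n hn G hG L hL _ => hn₁ n hn G hG L hL⟩
    · have hM : 0 ≤ (k : ℝ) * (k - 1) + C := by
        have : (1 : ℝ) ≤ k := by exact_mod_cast hk
        have : 0 ≤ (k : ℝ) * (k - 1) := mul_nonneg (by linarith) (by linarith)
        linarith
      obtain ⟨n₁, hn₁⟩ := exists_core_of_pairs_le hk hb (by linarith) hM hsparse hs'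
        (fun n hn => by
          obtain ⟨W, _, X, ⟨e⟩, hX⟩ := hjoin n hn
          rw [pairs_of_iso_cliqueJoin e]
          linarith)
        (fun n hn L hL => by
          obtain ⟨H', h1, h2⟩ := hplace n hn L hL
          exact ⟨H', h1, h2.completeTo, Or.inr h2⟩)
      exact ⟨2 * s + c + (k * (k - 1) + C), n₁, by positivity, hn₁⟩
  obtain ⟨C₁, n₁, hC₁, hcore⟩ := hcore
  obtain ⟨N, hN⟩ := exists_completeTo (n₀ := max n₀ n₁) hk hc hsparse hs'
    (fun n hn L hL => by
      obtain ⟨H', h1, h2⟩ := hplace n (le_trans (le_max_left _ _) hn) L hL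
      exact ⟨H', h1, h2.completeTo⟩) hC₁
    (fun n hn => hcore n (le_trans (le_max_right _ _) hn))
  obtain ⟨N', hN'⟩ := le_pairs_of_completeTo hk hQ hC hb hfree hs' hjoin
  refine eventually_atTop.2 ⟨max (max N N') n₀, fun n hn G hG => ?_⟩
  have hn1 : N ≤ n := le_trans (le_trans (le_max_left _ _) (le_max_left _ _)) hn
  have hn2 : N' ≤ n := le_trans (le_trans (le_max_right _ _) (le_max_left _ _)) hn
  have hn3 : n₀ ≤ n := le_trans (le_max_right _ _) hn
  obtain ⟨ρ, x, L, hx, hρ, hρG, hL, hlow, hxL, hcompl⟩ := hN n hn1 G hG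
  exact ⟨hcompl.connected (by omega) (by rw [hL]; exact hkn n hn3),
    hN' n hn2 G hG ρ x L hx hρ hρG hL hlow hxL hcompl⟩

lemma pairs_completeBipartite (k r : ℕ) :
    pairs (completeBipartiteGraph (Fin k) (Fin r)) Finset.univ Finset.univ = 2 * (k : ℝ) * r := by
  unfold pairs
  simp only [Fintype.sum_sum_type, Finset.sum_add_distrib]
  simp [adjInd]
  ring

/-- K_{k,n-k} has no edges besides the complete join, so a complete core already gives enough edges
and no walk expansion is needed. -/
lemma spexDominates_of_bipartite (hk : 1 ≤ k) (h : EdgeExtremal 𝓕 H) (ha : CaseA k H) :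
    SpexDominates 𝓕 H := by
  obtain ⟨n₀, hb, hfree, hiso, hkn⟩ := h.exists_bound (k := k) ha
  have hpairs : ∀ n, n₀ ≤ n →
      pairs (H n) Finset.univ Finset.univ = 2 * (k : ℝ) * (n - k) := by
    intro n hn
    obtain ⟨e⟩ := hiso n hn
    rw [pairs_univ_iso e, pairs_completeBipartite, Nat.cast_sub (hkn n hn).le]
  obtain ⟨s, c, hc, hsparse, hs⟩ := hb.exists_sparse_few (k := k) (Q := 0) (C := 0) one_pos
    (fun n hn => by
      rw [hpairs n hn]
      have := sq_nonneg (k : ℝ)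
      linarith)
  have hs' : ∀ (n : ℕ) (G : SimpleGraph (Fin n)), FamilyFree 𝓕 G → FewCommon G (k + 1) s :=
    fun n G => hs (Fin n) G
  have hplace : ∀ n, n₀ ≤ n → ∀ L : Finset (Fin n), L.card = k → ∃ H' : SimpleGraph (Fin n),
      FamilyFree 𝓕 H' ∧ CompleteTo H' L := by
    intro n hn L hL
    obtain ⟨e⟩ := hiso n hn
    obtain ⟨H', f, h₁, h₂⟩ := exists_placement e L hL
    exact ⟨H', (hfree n hn).iso (e.trans f), completeTo_of_placement f h₁ h₂⟩
  obtain ⟨n₁, hcore⟩ := exists_core_of_pairs_le hk hb (by linarith) le_rfl hsparse hs'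
    (fun n hn => by rw [add_zero]; exact (hpairs n hn).le)
    (fun n hn L hL => by
      obtain ⟨H', h1, h2⟩ := hplace n hn L hL
      exact ⟨H', h1, h2, Or.inl rfl⟩)
  obtain ⟨N, hN⟩ := exists_completeTo (n₀ := max n₀ n₁) hk hc hsparse hs'
    (fun n hn L hL => hplace n (le_trans (le_max_left _ _) hn) L hL) (by positivity)
    (fun n hn => hcore n (le_trans (le_max_right _ _) hn))
  refine eventually_atTop.2 ⟨max N n₀, fun n hn G hG => ?_⟩
  have hn1 : N ≤ n := le_trans (le_max_left _ _) hn
  have hn3 : n₀ ≤ n := le_trans (le_max_right _ _) hn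
  obtain ⟨ρ, x, L, -, -, -, hL, -, -, hcompl⟩ := hN n hn1 G hG
  refine ⟨hcompl.connected (by omega) (by rw [hL]; exact hkn n hn3), ?_⟩
  rw [hpairs n hn3, hcompl.pairs_univ, card_compl_fin, hL]
  linarith [pairs_nonneg (G := G) L L, pairs_nonneg (G := G) Lᶜ Lᶜ]

lemma CaseB.joinForm (hB : CaseB k H) : JoinForm k H 0 0 := by
  filter_upwards [hB] with n ⟨e⟩
  refine ⟨Fin (n - k), inferInstance, ⊥, ⟨e⟩, ?_⟩
  rw [pairs_eq_zero fun u _ v _ => by simp]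
  simp

lemma CaseC.joinForm (hC : CaseC k H) : JoinForm k H 0 2 := by
  filter_upwards [hC] with n ⟨e⟩
  refine ⟨_, inferInstance, _, ⟨e⟩, ?_⟩
  unfold pairs
  simp only [Fintype.sum_sum_type, Finset.sum_add_distrib]
  simp [adjInd, Fin.sum_univ_two]
  norm_num

lemma CaseD.joinForm (hD : CaseD 𝓕 k H) : ∃ Q C : ℝ, Q < 3 / 4 ∧ 0 ≤ C ∧ JoinForm k H Q C := by
  obtain ⟨-, Q, -, hQ, C, h⟩ := hD
  refine ⟨Q, 2 * |C|, hQ, by positivity, ?_⟩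
  filter_upwards [h] with n ⟨X, e, hX⟩
  refine ⟨_, inferInstance, X, e, ?_⟩
  rw [← two_mul_ncard_edgeSet]
  linarith [le_abs_self C]

/-- Neighbours of v in X are common neighbours of v and the k clique vertices. -/
lemma degR_le_of_fewCommon_cliqueJoin {s : ℕ} {W : Type} [Fintype W]
    {X : SimpleGraph W} (hs : FewCommon (cliqueJoin k X) (k + 1) s) (v : W) : degR X v ≤ s := by
  classical
  rw [degR_eq_card]
  have hcard : (insert (Sum.inr v) ((Finset.univ : Finset (Fin k)).map
      Function.Embedding.inl) : Finset (Fin k ⊕ W)).card = k + 1 := by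
    rw [Finset.card_insert_of_notMem (by simp)]
    simp
  have h1 := hs _ hcard
  have h2 : ((nbrs X v).map (Function.Embedding.inr : W ↪ Fin k ⊕ W)) ⊆
      commonNbrs (cliqueJoin k X) (insert (Sum.inr v) ((Finset.univ : Finset (Fin k)).map
        Function.Embedding.inl)) := by
    intro z hz
    obtain ⟨u, hu, rfl⟩ := Finset.mem_map.1 hz
    refine mem_commonNbrs.2 fun t ht => ?_
    rcases Finset.mem_insert.1 ht with rfl | ht
    · exact cliqueJoin_adj_inr_inr.2 (mem_nbrs.1 hu)
    · obtain ⟨a, -, rfl⟩ := Finset.mem_map.1 ht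
      exact cliqueJoin_adj_inl_inr
  have h3 := Finset.card_le_card h2
  rw [Finset.card_map] at h3
  exact_mod_cast h3.trans h1.le

/-- An almost regular `X` with fewer than `n` edges has degree at most one. -/
lemma CaseF.joinForm (h : EdgeExtremal 𝓕 H) (hF : CaseF 𝓕 k H) :
    ∃ Q C : ℝ, Q < 3 / 4 ∧ 0 ≤ C ∧ JoinForm k H Q C := by
  classical
  obtain ⟨-, Q, -, hQ, C, d, B, hX, -⟩ := hF
  obtain ⟨n₀, hb, hfree, hjoin, hkn⟩ := h.exists_bound (k := k) hX
  obtain ⟨s, c, -, -, hs⟩ := hb.exists_sparse_few (k := k) (Q := Q) (C := 2 * C) hQ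
    (fun n hn => by
      obtain ⟨X, ⟨e⟩, hX, -⟩ := hjoin n hn
      refine pairs_le_of_iso_cliqueJoin e ?_
      rw [← two_mul_ncard_edgeSet]
      linarith)
  have hdata : ∀ n, n₀ ≤ n → ∃ X : SimpleGraph (Fin (n - k)), Nonempty (H n ≃g cliqueJoin k X) ∧
      pairs X Finset.univ Finset.univ ≤ 2 * Q * n + 2 * C ∧
      (d : ℝ) * (n - k - B) ≤ pairs X Finset.univ Finset.univ ∧
      pairs X Finset.univ Finset.univ ≤ d * n + s * B := by
    intro n hn
    obtain ⟨X, ⟨e⟩, hX, hdeg⟩ := hjoin n hn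
    refine ⟨X, ⟨e⟩, by rw [← two_mul_ncard_edgeSet]; linarith, ?_⟩
    set S : Finset (Fin (n - k)) := Finset.univ.filter fun v => degR X v ≠ d with hS
    have hset : {v | (X.neighborSet v).ncard ≠ d} = (S : Set (Fin (n - k))) := by
      ext v
      have h1 : (X.neighborSet v).ncard = (nbrs X v).card := by
        rw [← Set.ncard_coe_finset]
        congr 1
        ext u
        simp [mem_nbrs]
      simp [hS, h1, degR_eq_card]
    rw [hset, Set.ncard_coe_finset] at hdeg
    have hdegR : (S.card : ℝ) ≤ B := by exact_mod_cast hdeg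
    have hsplit : pairs X Finset.univ Finset.univ = ∑ v ∈ S, degR X v + ∑ v ∈ Sᶜ, degR X v := by
      rw [Finset.sum_add_sum_compl]; rfl
    have hcompl : ∑ v ∈ Sᶜ, degR X v = d * (n - k - S.card) := by
      rw [Finset.sum_congr rfl fun v hv => show degR X v = d by
        simpa [hS] using Finset.mem_compl.1 hv]
      rw [Finset.sum_const, nsmul_eq_mul, card_compl_fin, Nat.cast_sub (hkn n hn).le]
      ring
    have hbad : ∑ v ∈ S, degR X v ≤ s * S.card := by
      have := Finset.sum_le_card_nsmul S (degR X) s fun v _ =>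
        degR_le_of_fewCommon_cliqueJoin (hs _ _ ((hfree n hn).iso e)) v
      rw [nsmul_eq_mul] at this
      linarith
    have hbad0 : 0 ≤ ∑ v ∈ S, degR X v := Finset.sum_nonneg fun v _ => degR_nonneg v
    have hd0 : (0 : ℝ) ≤ d := Nat.cast_nonneg _
    have h4 : (s : ℝ) * S.card ≤ s * B := by gcongr
    have h5 : (d : ℝ) * S.card ≤ d * B := by gcongr
    have h6 : 0 ≤ (d : ℝ) * k := by positivity
    have h7 : 0 ≤ (d : ℝ) * S.card := by positivity
    rw [hsplit, hcompl]
    constructor <;> linarith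
  -- Degree d ≥ 2 would give 2n - O(1) ordered pairs, against at most 2Qn + O(1) with Q < 1.
  have hd : (d : ℝ) ≤ 1 := by
    by_contra hcon
    have hd2 : (2 : ℝ) ≤ d := by
      have h1 : 1 < d := by exact_mod_cast not_le.1 hcon
      exact_mod_cast h1
    obtain ⟨n, hn⟩ := exists_nat_gt (max (max (n₀ : ℝ) (k + B))
      ((2 * C + 2 * (k + B)) / (2 * (1 - Q))))
    obtain ⟨h1, h2⟩ := max_lt_iff.1 hn
    obtain ⟨h1, h3⟩ := max_lt_iff.1 h1
    obtain ⟨X, -, h4, h5, -⟩ := hdata n (by exact_mod_cast h1.le)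
    rw [div_lt_iff₀ (by linarith)] at h2
    have h6 : (2 : ℝ) * (n - k - B) ≤ d * (n - k - B) :=
      mul_le_mul_of_nonneg_right hd2 (by linarith)
    linarith
  -- With d ≤ 1 there are at most n ordered pairs, plus at most s for each of the `B` exceptional
  -- vertices.
  refine ⟨1 / 2, s * B, by norm_num, by positivity, eventually_atTop.2 ⟨n₀, fun n hn => ?_⟩⟩
  obtain ⟨X, e, -, -, h1⟩ := hdata n hn
  refine ⟨_, inferInstance, X, e, h1.trans ?_⟩
  have : (d : ℝ) * n ≤ 1 * n := by gcongr
  linarith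

lemma spexDominates (hk : 1 ≤ k) (h : EdgeExtremal 𝓕 H)
    (hH : CaseA k H ∨ CaseB k H ∨ CaseC k H ∨ CaseD 𝓕 k H ∨ CaseF 𝓕 k H) : SpexDominates 𝓕 H := by
  rcases hH with hA | hB | hC | hD | hF
  · exact spexDominates_of_bipartite hk h hA
  · exact spexDominates_of_joinForm hk h (by norm_num) le_rfl hB.joinForm (Or.inr rfl)
  · exact spexDominates_of_joinForm hk h (by norm_num) zero_le_two hC.joinForm (Or.inr rfl)
  · obtain ⟨Q, C, hQ, hC, hj⟩ := hD.joinForm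
    exact spexDominates_of_joinForm hk h hQ hC hj (Or.inl hD.1)
  · obtain ⟨Q, C, hQ, hC, hj⟩ := CaseF.joinForm h hF
    exact spexDominates_of_joinForm hk h hQ hC hj (Or.inl hF.1)

end Cases

lemma pairs_le_pairs_iff {n : ℕ} {G G' : SimpleGraph (Fin n)} :
    pairs G Finset.univ Finset.univ ≤ pairs G' Finset.univ Finset.univ ↔
      G.edgeSet.ncard ≤ G'.edgeSet.ncard := by
  rw [← two_mul_ncard_edgeSet, ← two_mul_ncard_edgeSet, mul_le_mul_iff_of_pos_left two_pos,
    Nat.cast_le]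

theorem corollary1p3 (𝓕 : GraphFamily) (k : ℕ) (hk : 1 ≤ k)
    (H : ∀ n : ℕ, SimpleGraph (Fin n))
    (hH : CaseA k H ∨ CaseB k H ∨ CaseC k H ∨ CaseD 𝓕 k H ∨ CaseF 𝓕 k H) :
    ((∀ᶠ n in atTop, H n ∈ EX n 𝓕) → ∀ᶠ n in atTop, SPEX n 𝓕 ⊆ EX n 𝓕) ∧
    ((∀ᶠ n in atTop, H n ∈ EXc n 𝓕) → ∀ᶠ n in atTop, SPEX n 𝓕 ⊆ EXc n 𝓕) := by
  constructor
  · intro hE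
    have hext : EdgeExtremal 𝓕 H := by
      filter_upwards [hE] with n hn
      -- Maximality is needed only against connected graphs, so one argument serves both claims.
      exact ⟨hn.1, fun G _ hG => pairs_le_pairs_iff.2 (hn.2 G hG)⟩
    filter_upwards [hE, spexDominates hk hext hH] with n hn hdom G hG
    exact ⟨hG.1, fun G' hG' => (hn.2 G' hG').trans (pairs_le_pairs_iff.1 (hdom G hG).2)⟩
  · intro hE
    have hext : EdgeExtremal 𝓕 H := by
      filter_upwards [hE] with n hn
      exact ⟨hn.1.2, fun G hc hG => pairs_le_pairs_iff.2 (hn.2 G hc hG)⟩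
    filter_upwards [hE, spexDominates hk hext hH] with n hn hdom G hG
    obtain ⟨hc, hle⟩ := hdom G hG
    exact ⟨⟨hc, hG.1⟩, fun G' hc' hG' => (hn.2 G' hc' hG').trans (pairs_le_pairs_iff.1 hle)⟩
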